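/- **Setting.** Let $\delta,\gamma,r,c,p,\bar x$ be real numbers and $F:[0,\infty)\to\mathbb R$. Put $\kappa=\delta+\gamma$, $r'=r\kappa$, $c_*=c+r'$ and, for $0<x\le\bar x$, $$g(x)=\delta-F'(x)+\tfrac{F(x)}x,\quad \psi(x)=(px-c)(\delta-F'(x))-\tfrac{cF(x)}x,\quad \psi_*(x)=(px-c_*)(\delta-F'(x))-\tfrac{c_*F(x)}x .$$ Assume: * (V1) $\bar x>0$, $F\in C^2[0,\infty)\cap C^3(0,\bar x)$, $F(0)=F(\bar x)=0$, $F>0$ on $(0,\bar x)$, $F''<0$ on $[0,\bar x]$; * (V2) $\delta,r,c,\gamma>0$; (V3) $c_*-p\bar x<0$; * (V4) there are $\tilde x,x^*\in(0,\bar x)$ such that $\psi<0$ on $(0,\tilde x)$, $\psi(\tilde x)=0$, $\psi>0$ on $(\tilde x,\bar x)$, and $\psi_*<0$ on $(0,x^*)$, $\psi_*(x^*)=0$, $\psi_*>0$ on $(x^*,\bar x)$; * (V5) $\psi'>0$ on $(0,\tilde x)$, $\psi_*'>0$ on $(\tilde x,\bar x)$; (V6) $g'>0$ on $(0,\bar x)$.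 **Problem.** For given $(x_0,K_0)$ minimize $$J=\int_{[0,\infty)}e^{-\delta t}r\,\mu(dt)+\int_0^\infty e^{-\delta t}(c-px(t))u(t)K(t)\,dt$$ over measurable $u$ with $0\le u\le1$ a.e. and non-negative Borel measures $\mu$ on $[0,\infty)$, finite on bounded intervals, where $x,K\ge0$ solve $x'=F(x)-uKx$, $x(0)=x_0$, and $K(t)=K_0-\int_0^t\gamma K\,ds+\mu([0,t])$ for $t\ge 0$. Thus $K$ is right continuous; write $K_{0,+}=\lim_{t\downarrow0}K(t)$. An optimal process $(x,K,u,\mu)$ is an admissible one with minimal $J\in(-\infty,\infty]$. Adjoint variables of it are continuous functions $z,\lambda:[0,\infty)\to\mathbb R$ with $$z'=zg(x)-\psi(x),\qquad \lambda'=(\lambda-r)\kappa-zu+r'\ \text{(in integrated form)},\qquad \lambda\le r,\qquad \lambda=r\ \ \mu\text{-a.e.},$$ and $z(t)K(t)u(t)=\max_{w\in[0,1]}z(t)K(t)w$ for a.e. $t\ge 0$. Write $z_0=z(0)$, $\lambda_0=\lambda(0)$. **Curves.** Let $K^*=F(x^*)/x^*$, $\Sigma^*=\{x^*\}\times[0,K^*]$,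 $\widetilde\Sigma=\{\tilde x\}\times[0,\infty)$. For $K_1\in[0,K^*]$ let $(x,z,\lambda)(\cdot;K_1)$ be the solution, as long as $0<x\le\bar x$, of $$x'=-F(x)+K_1e^{\gamma t}x,\quad z'=-(z-r')g(x)+\psi_*(x),\quad \lambda'=-(\lambda-r)\kappa+z-r',\qquad x(0)=x^*,\ z(0)=r',\ \lambda(0)=r,$$ and let $K(t;K_1)=K_1e^{\gamma t}$. * $\Sigma_0$ is the set of points $(x,K)(\sigma;K_1)$, $K_1\in[0,K^*)$, where $\sigma>0$ is the first zero of $z(\cdot;K_1)$ and $x(\cdot;K_1)<x^*$ on $(0,\sigma]$. Let $\widetilde K_1\in(0,K^*)$ be the value of $K_1$ for which this first zero is a double zero ($z=z'=0$); the corresponding point of $\Sigma_0$ is $(\tilde x,K_c)$ and is the end point of $\Sigma_0$. * $\Gamma_3$ is the trajectory of $x'=-F(x)+Kx$, $K'=\gamma K$, $(x,K)(0)=(\tilde x,K_c)$ up to $x=\bar x$; $\Gamma_4$ is the trajectory of $x'=-F(x)$, $K'=\gamma K$, $(x,K)(0)=(\tilde x,K_c)$, for $t\ge0$. * $\Sigma_s$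 consists of $(x^*,K^*)$ and of the points $(x,K)(\tau;K_1)$ with $K_1\in[\widetilde K_1,K^*)$, where $\tau>0$ is the first positive time with $\lambda(\tau;K_1)=r$, provided that $\lambda(\cdot;K_1)<r$ on $(0,\tau)$ and $0<x(\cdot;K_1)\le\bar x$ on $[0,\tau]$. Assume that $x_s=\bar x$, i.e. there is a continuous $h_s$ on $[x^*,\bar x]$ with $(x,h_s(x))\in\Sigma_s$ for all $x\in[x^*,\bar x]$, and that $\Sigma_s$ and $\Gamma_3$ have no common point with $x<\bar x$. **Regions** (open): * (R1): $x^*<x<\bar x$, $K>0$, below $\Sigma_s$; * (R2): $K>0$, $x<\bar x$, and either $x<\tilde x$ and $(x,K)$ lies to the right of $\Sigma_0$ (some $(s,K)\in\Sigma_0$ has $s<x$), or $x\ge\tilde x$, $(x,K)$ lies below $\Gamma_3$ and, if $x\ge x^*$, above $\Sigma_s$; * (R3): $0<x<\tilde x$, $K>0$, below $\Gamma_4$ and to the left of $\Sigma_0$ (every $(s,K)\in\Sigma_0$ has $x<s$); * (R4): $0<x<\tilde x$, above $\Gamma_4$; * (R5): $\tilde x<x<\bar x$, above $\Gamma_3$.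 **Theorem.** Let $(x,K,u,\mu)$ be an optimal process for $(x_0,K_0)$ with adjoint variables $z,\lambda$. * (a) If $(x_0,K_0)\in$ (R1), then $z_0>r'$, $\lambda_0=r$, $(x_0,K_{0,+})\in\Sigma_s$, and there is $\tau>0$ with $(x(\tau),K(\tau))\in\Sigma^*$ and $u\equiv1$, $\mu\equiv0$ in $(0,\tau)$. * (b) If $(x_0,K_0)\in$ (R2), then $z_0>0$, $\lambda_0<r$, and there is $\tau>0$ with $(x(\tau),K(\tau))\in\Sigma^*$ and $u\equiv1$, $\mu\equiv0$ in $(0,\tau)$. * (c) If $(x_0,K_0)\in$ (R3), then $z_0<0$, $\lambda_0<r$, and there is $\tau>0$ with $(x(\tau),K(\tau))\in\Sigma_0$ and $u\equiv0$, $\mu\equiv0$ in $(0,\tau)$. * (d) If $(x_0,K_0)\in$ (R4), then $z_0<0$, $\lambda_0<r$, and there is $\tau>0$ with $(x(\tau),K(\tau))\in\widetilde\Sigma$ and $u\equiv0$, $\mu\equiv0$ in $(0,\tau)$. * (e) If $(x_0,K_0)\in$ (R5), then $z_0>0$, $\lambda_0<r$, and there is $\tau>0$ with $(x(\tau),K(\tau))\in\widetilde\Sigma$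 and $u\equiv1$, $\mu\equiv0$ in $(0,\tau)$. Here $u\equiv w$ on $(0,\tau)$ means almost everywhere. -/

import Mathlib

open Set MeasureTheory Filter Topology

noncomputable section

/-- The data of the fishery model: growth function `F`, discount rate `δ`, depreciation rate `γ`,
price of capital `r`, operating cost `c`, price of fish `p`, the biological equilibrium `xbar`, and
the two singular biomass levels `xtil` (the zero of `ψ`) and `xstar` (the zero of `ψ_*`). -/
structure Fishery where
  F : ℝ → ℝ
  δ : ℝ
  γ : ℝ
  r : ℝ
  c : ℝ
  p : ℝ
  xbar : ℝ
  xtil : ℝ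
  xstar : ℝ

namespace Fishery

variable (M : Fishery)

/-- `κ = δ + γ` -/
def κ : ℝ := M.δ + M.γ

/-- `r' = r κ` -/
def r' : ℝ := M.r * M.κ

/-- `c_* = c + r'` -/
def cstar : ℝ := M.c + M.r'

def g (x : ℝ) : ℝ := M.δ - deriv M.F x + M.F x / x

def ψ (x : ℝ) : ℝ := (M.p * x - M.c) * (M.δ - deriv M.F x) - M.c * M.F x / x

def ψstar (x : ℝ) : ℝ := (M.p * x - M.cstar) * (M.δ - deriv M.F x) - M.cstar * M.F x / x

/-- `K^* = F(x^*) / x^*` -/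
def Kstar : ℝ := M.F M.xstar / M.xstar

/-- The standing assumptions (V1) to (V6). -/
structure Assumptions : Prop where
  xbar_pos : 0 < M.xbar
  F_C2 : ContDiffOn ℝ 2 M.F (Ici 0)
  F_C3 : ContDiffOn ℝ 3 M.F (Ioo 0 M.xbar)
  F_zero : M.F 0 = 0
  F_xbar : M.F M.xbar = 0
  F_pos : ∀ x ∈ Ioo 0 M.xbar, 0 < M.F x
  F_concave : ∀ x ∈ Icc 0 M.xbar, iteratedDerivWithin 2 M.F (Ici 0) x < 0
  δ_pos : 0 < M.δ
  r_pos : 0 < M.r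
  c_pos : 0 < M.c
  γ_pos : 0 < M.γ
  profitable : M.cstar - M.p * M.xbar < 0
  xtil_mem : M.xtil ∈ Ioo 0 M.xbar
  xstar_mem : M.xstar ∈ Ioo 0 M.xbar
  ψ_neg : ∀ x ∈ Ioo 0 M.xtil, M.ψ x < 0
  ψ_xtil : M.ψ M.xtil = 0
  ψ_pos : ∀ x ∈ Ioo M.xtil M.xbar, 0 < M.ψ x
  ψstar_neg : ∀ x ∈ Ioo 0 M.xstar, M.ψstar x < 0
  ψstar_xstar : M.ψstar M.xstar = 0
  ψstar_pos : ∀ x ∈ Ioo M.xstar M.xbar, 0 < M.ψstar x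
  ψ_deriv_pos : ∀ x ∈ Ioo 0 M.xtil, 0 < deriv M.ψ x
  ψstar_deriv_pos : ∀ x ∈ Ioo M.xtil M.xbar, 0 < deriv M.ψstar x
  g_deriv_pos : ∀ x ∈ Ioo 0 M.xbar, 0 < deriv M.g x

/-! ### The optimal control problem -/

/-- `(x, K, u, μ)` is an admissible process for the initial state `(x₀, K₀)`. The Borel measure `μ`
on `[0, ∞)` is a measure on `ℝ` which vanishes on `(-∞, 0)`; the measure differential equation for
`K` is the integral equation `K(t) = K₀ - ∫₀ᵗ γ K + μ([0,t])`, so that `K` is right continuous and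
`K(0) = K₀ + μ({0})` is the value after a possible jump at time `0`. -/
structure IsAdmissible (x₀ K₀ : ℝ) (x K u : ℝ → ℝ) (μ : Measure ℝ) : Prop where
  u_meas : AEMeasurable u (volume.restrict (Ici 0))
  u_mem : ∀ᵐ t ∂(volume.restrict (Ici (0 : ℝ))), u t ∈ Icc (0 : ℝ) 1
  μ_neg : μ (Iio 0) = 0
  μ_finite : ∀ t : ℝ, μ (Icc 0 t) < ⊤
  K_nonneg : ∀ t, 0 ≤ t → 0 ≤ K t
  K_int : ∀ t, 0 ≤ t → IntervalIntegrable K volume 0 t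
  K_eq : ∀ t, 0 ≤ t → K t = K₀ - (∫ s in (0 : ℝ)..t, M.γ * K s) + (μ (Icc 0 t)).toReal
  x_nonneg : ∀ t, 0 ≤ t → 0 ≤ x t
  x_cont : ContinuousOn x (Ici 0)
  x_int : ∀ t, 0 ≤ t →
    IntervalIntegrable (fun s => M.F (x s) - u s * K s * x s) volume 0 t
  x_eq : ∀ t, 0 ≤ t → x t = x₀ + ∫ s in (0 : ℝ)..t, (M.F (x s) - u s * K s * x s)

/-- The objective functional
`J = ∫ e^{-δt} r μ(dt) + ∫ e^{-δt} (c - p x(t)) u(t) K(t) dt`, with values in `(-∞, ∞]`.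
If the first integral is finite, then `e^{-δt} K(t)`, and with it the second integrand, is
integrable; the second integral is always bounded below, so `J = ∞` if the first one is infinite. -/
def cost (x K u : ℝ → ℝ) (μ : Measure ℝ) : EReal :=
  ((∫⁻ t, ENNReal.ofReal (Real.exp (-M.δ * t) * M.r) ∂μ : ENNReal) : EReal) +
    ((∫ t in Ici (0 : ℝ), Real.exp (-M.δ * t) * ((M.c - M.p * x t) * u t * K t) : ℝ) : EReal)

/-- `(x, K, u, μ)` is an optimal process for the initial state `(x₀, K₀)`. -/
def IsOptimal (x₀ K₀ : ℝ) (x K u : ℝ → ℝ) (μ : Measure ℝ) : Prop :=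
  M.IsAdmissible x₀ K₀ x K u μ ∧
    ∀ (y L v : ℝ → ℝ) (ν : Measure ℝ), M.IsAdmissible x₀ K₀ y L v ν →
      M.cost x K u μ ≤ M.cost y L v ν

/-- `z, lam` are adjoint variables (switch variables) of the process `(x, K, u, μ)`: the necessary
conditions of the maximum principle, with the multiplier of the objective normalized to one. -/
structure IsAdjoint (x K u : ℝ → ℝ) (μ : Measure ℝ) (z lam : ℝ → ℝ) : Prop where
  z_deriv : ∀ t, 0 ≤ t → HasDerivWithinAt z (z t * M.g (x t) - M.ψ (x t)) (Ici 0) t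
  lam_cont : ContinuousOn lam (Ici 0)
  lam_eq : ∀ t, 0 ≤ t →
    lam t = lam 0 + ∫ s in (0 : ℝ)..t, ((lam s - M.r) * M.κ - z s * u s + M.r')
  lam_le : ∀ t, 0 ≤ t → lam t ≤ M.r
  lam_eq_ae : ∀ᵐ t ∂μ, lam t = M.r
  maximum : ∀ᵐ t ∂(volume.restrict (Ici (0 : ℝ))),
    ∀ w ∈ Icc (0 : ℝ) 1, z t * K t * w ≤ z t * K t * u t

/-! ### The curves in the phase plane -/

/-- The curve `Σ^*`. -/
def SigmaStar : Set (ℝ × ℝ) := {P | P.1 = M.xstar ∧ 0 ≤ P.2 ∧ P.2 ≤ M.Kstar}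

/-- The curve `Σ~`. -/
def SigmaTil : Set (ℝ × ℝ) := {P | P.1 = M.xtil ∧ 0 ≤ P.2}

/-- The system with `u = 1`, `μ = 0`, solved backwards in time on `[0, T]` from the point
`(x^*, K₁)` of `Σ^*`, with `z = r'`, `λ = r` there. Its capital component is `K₁ e^{γ t}`. -/
structure IsBackward (K₁ T : ℝ) (x z l : ℝ → ℝ) : Prop where
  x_zero : x 0 = M.xstar
  z_zero : z 0 = M.r'
  l_zero : l 0 = M.r
  x_mem : ∀ t ∈ Icc 0 T, x t ∈ Ioc 0 M.xbar
  x_deriv : ∀ t ∈ Icc 0 T,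
    HasDerivWithinAt x (-M.F (x t) + K₁ * Real.exp (M.γ * t) * x t) (Icc 0 T) t
  z_deriv : ∀ t ∈ Icc 0 T,
    HasDerivWithinAt z (-(z t - M.r') * M.g (x t) + M.ψstar (x t)) (Icc 0 T) t
  l_deriv : ∀ t ∈ Icc 0 T,
    HasDerivWithinAt l (-(l t - M.r) * M.κ + z t - M.r') (Icc 0 T) t

/-- On the backward trajectory from `(x^*, K₁)`, the first zero of `z` before the trajectory
returns to `x = x^*` is attained at the phase point `P`. -/
def IsSwitchPoint (K₁ : ℝ) (P : ℝ × ℝ) : Prop :=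
  ∃ (σ : ℝ) (x z l : ℝ → ℝ), 0 < σ ∧ M.IsBackward K₁ σ x z l ∧
    (∀ t ∈ Ioc 0 σ, x t < M.xstar) ∧ (∀ t ∈ Ico 0 σ, 0 < z t) ∧ z σ = 0 ∧
    P = (x σ, K₁ * Real.exp (M.γ * σ))

/-- The switching curve `Σ₀`. -/
def Sigma0 : Set (ℝ × ℝ) := {P | ∃ K₁ ∈ Ico 0 M.Kstar, M.IsSwitchPoint K₁ P}

/-- `K₁` is the threshold value for which the zero of `z` is a double zero, `z = z' = 0`, which,
as `z' = ψ(x)` when `z = 0`, says that it lies on the line `x = xtil`; `Kc` is the value of the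
capital there. Thus `(xtil, Kc)` is the end point of `Σ₀`. -/
def IsThreshold (K₁ Kc : ℝ) : Prop := K₁ ∈ Ioo 0 M.Kstar ∧ M.IsSwitchPoint K₁ (M.xtil, Kc)

/-- The curve `Γ₃`: the trajectory with `u = 1`, `μ = 0`, backwards in time from the end point of
`Σ₀` until `x = xbar`. -/
def Gamma3 : Set (ℝ × ℝ) :=
  {P | ∃ (K₁ Kc T : ℝ) (x : ℝ → ℝ), M.IsThreshold K₁ Kc ∧ 0 ≤ T ∧ x 0 = M.xtil ∧
    (∀ t ∈ Icc 0 T, x t ∈ Icc M.xtil M.xbar) ∧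
    (∀ t ∈ Icc 0 T,
      HasDerivWithinAt x (-M.F (x t) + Kc * Real.exp (M.γ * t) * x t) (Icc 0 T) t) ∧
    P = (x T, Kc * Real.exp (M.γ * T))}

/-- The curve `Γ₄`: the trajectory with `u = 0`, `μ = 0`, backwards in time from the end point of
`Σ₀`. -/
def Gamma4 : Set (ℝ × ℝ) :=
  {P | ∃ (K₁ Kc T : ℝ) (x : ℝ → ℝ), M.IsThreshold K₁ Kc ∧ 0 ≤ T ∧ x 0 = M.xtil ∧
    (∀ t ∈ Icc 0 T, x t ∈ Ioc 0 M.xtil) ∧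
    (∀ t ∈ Icc 0 T, HasDerivWithinAt x (-M.F (x t)) (Icc 0 T) t) ∧
    P = (x T, Kc * Real.exp (M.γ * T))}

/-- The jump curve `Σ_s` on and below `Γ₃`: the point `(x^*, K^*)` together with the points where,
on the backward trajectories from `(x^*, K₁)`, `K₁` between the threshold and `K^*`, the
switch variable `λ` returns to the value `r` for the first time. -/
def SigmaS : Set (ℝ × ℝ) :=
  {P | P = (M.xstar, M.Kstar) ∨
    ∃ (Kt Kc K₁ τ : ℝ) (x z l : ℝ → ℝ), M.IsThreshold Kt Kc ∧ K₁ ∈ Ico Kt M.Kstar ∧ 0 < τ ∧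
      M.IsBackward K₁ τ x z l ∧ (∀ t ∈ Ioo 0 τ, l t < M.r) ∧ l τ = M.r ∧
      P = (x τ, K₁ * Real.exp (M.γ * τ))}

/-- The assumption `x_s = xbar`: `Σ_s` contains the graph of a continuous function over the whole
interval `[x^*, xbar]`. -/
def JumpCurveReaches : Prop :=
  ∃ h : ℝ → ℝ, ContinuousOn h (Icc M.xstar M.xbar) ∧
    ∀ ξ ∈ Icc M.xstar M.xbar, (ξ, h ξ) ∈ M.SigmaS

/-- `Σ_s` and `Γ₃` do not intersect (to the left of the boundary line `x = xbar`). -/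
def NoIntersection : Prop := ∀ P ∈ M.SigmaS ∩ M.Gamma3, ¬ P.1 < M.xbar

/-! ### The five main regions -/

/-- Bounded by `Σ^*`, `Σ_s` and the line `x = xbar`. -/
def R1 : Set (ℝ × ℝ) :=
  {P | M.xstar < P.1 ∧ P.1 < M.xbar ∧ 0 < P.2 ∧ ∃ h, (P.1, h) ∈ M.SigmaS ∧ P.2 < h}

/-- Bounded by `Σ₀`, `Σ^*`, `Σ_s`, `Γ₃` (and the line `x = xbar`): to the right of `Σ₀`,
below `Γ₃`, and, for `x ≥ x^*`, above `Σ_s`. -/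
def R2 : Set (ℝ × ℝ) :=
  {P | 0 < P.2 ∧
    ((P.1 < M.xtil ∧ ∃ s, (s, P.2) ∈ M.Sigma0 ∧ s < P.1) ∨
     (M.xtil ≤ P.1 ∧ P.1 < M.xbar ∧ (∃ h, (P.1, h) ∈ M.Gamma3 ∧ P.2 < h) ∧
      (M.xstar ≤ P.1 → ∃ h, (P.1, h) ∈ M.SigmaS ∧ h < P.2)))}

/-- Bounded by the line `x = 0`, `Σ₀` and `Γ₄`: below `Γ₄` and to the left of `Σ₀`. -/
def R3 : Set (ℝ × ℝ) :=
  {P | 0 < P.1 ∧ P.1 < M.xtil ∧ 0 < P.2 ∧ (∃ h, (P.1, h) ∈ M.Gamma4 ∧ P.2 < h) ∧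
    ∀ s, (s, P.2) ∈ M.Sigma0 → P.1 < s}

/-- Bounded by the line `x = 0`, `Γ₄` and `Σ~`. -/
def R4 : Set (ℝ × ℝ) :=
  {P | 0 < P.1 ∧ P.1 < M.xtil ∧ ∃ h, (P.1, h) ∈ M.Gamma4 ∧ h < P.2}

/-- Bounded by `Σ~`, `Γ₃` and the line `x = xbar`. -/
def R5 : Set (ℝ × ℝ) :=
  {P | M.xtil < P.1 ∧ P.1 < M.xbar ∧ ∃ h, (P.1, h) ∈ M.Gamma3 ∧ h < P.2}

end Fishery

/-- There is `τ > 0` with `(x(τ), K(τ)) ∈ S`, and `u ≡ w`, `μ ≡ 0` on `(0, τ)`. -/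
def ReachesWith (x K u : ℝ → ℝ) (μ : Measure ℝ) (w : ℝ) (S : Set (ℝ × ℝ)) : Prop :=
  ∃ τ : ℝ, 0 < τ ∧ (x τ, K τ) ∈ S ∧
    (∀ᵐ t ∂(volume.restrict (Ioo 0 τ)), u t = w) ∧ μ (Ioo 0 τ) = 0

end

/-! The proof runs backwards in time from the arrival on `Σ^*`. Let `G x z = ψ(x) − z g(x)` be the
backward velocity of `z`, and φ(x) = F(x)/x. Two facts drive all comparisons. First, `G` is strictly
increasing in the stock as long as 0 ≤ z ≤ p x − c (`Assumptions.G_lt`). Second, under full effort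
the excess K − φ(x) can change sign only from negative to positive backwards in time
(`IsFull.excess_pos`), so that the stock first falls, if at all, and then rises for good.

Reduction to an approach. An optimal process never ceases to invest
(`IsCandidate.exists_lam_eq_gt`): otherwise the capital decays, the stock recovers beyond x^*, and
an explicit continuation with margin p x^* − c_* > 0 is cheaper. At a positive time with λ = r one
has z = r' and x ≤ x^*, and there is no gap between two such times, since λ would be below r at the
earlier one. Hence from the first positive contact time τ on the process rests at x = x^* with
capital at most K^*, and before τ nothing is invested. If contact times accumulate at 0 instead, the
process starts on `Σ^*`, which no region meets. So the reversed motion starts at (x^*, K₁) with K₁ <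
K^* (`IsCandidate.isApproach_or`).

Shapes. Along the reversed motion either z > 0 throughout, or z has a first zero, at a stock ≤ xtil
(`IsExtremal.cases`). If this zero lies strictly left of xtil, z stays negative and no effort is
exerted any more; if it lies on the line, the motion may rest there for a while before z takes a
definite sign.

Ordering by K₁. At equal capital a larger K₁ gives larger x, z and λ (`IsSubpath.lt_of_cap`); this
makes the threshold unique and shows on which side of it z can vanish. At equal stock to the right
of x^*, a larger K₁ gives smaller capital (`IsSub.cap_lt_cap`) and larger λ
(`IsSubpath.l_lt_of_x_eq`), so that over a given stock the condition λ = r singles out one path.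
Since a path may rest on xtil or idle, these comparisons are made for trajectories which grow at
most as fast as under full effort.

In each region all shapes but one are eliminated by comparison with the bounding curves. Only for
(R3) is an existence result needed: a point reached with z > 0 to the left of xtil has a point of
`Σ₀` on its left (`IsBackward.exists_mem_Sigma0`), found by continuity in K₁. -/

noncomputable section

/-! ### Monotonicity and signs of φ, g, ψ, ψ_* and G. -/

namespace Fishery

variable {M : Fishery}

/-- The average growth rate `F(x) / x`. -/
def phi (M : Fishery) (x : ℝ) : ℝ := M.F x / x

/-- The right-hand side of the backward equation of `z`. -/
def G (M : Fishery) (x z : ℝ) : ℝ := M.ψ x - z * M.g x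

theorem g_eq (x : ℝ) : M.g x = M.δ - deriv M.F x + M.phi x := rfl

theorem ψ_eq (x : ℝ) : M.ψ x = (M.p * x - M.c) * (M.δ - deriv M.F x) - M.c * M.phi x := by
  simp only [ψ, phi]; ring

theorem ψstar_eq (x : ℝ) : M.ψstar x = M.ψ x - M.r' * M.g x := by
  simp only [ψstar, ψ, g, cstar]; ring

theorem G_eq (x z : ℝ) :
    M.G x z = (M.p * x - M.c - z) * (M.δ - deriv M.F x) - (M.c + z) * M.phi x := by
  simp only [G, ψ_eq, g_eq]; ring

theorem G_eq_ψstar (x z : ℝ) : M.G x z = M.ψstar x - (z - M.r') * M.g x := by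
  rw [G, ψstar_eq]; ring

theorem G_sub (x z w : ℝ) : M.G x z = M.G x w - (z - w) * M.g x := by
  simp only [G]; ring

theorem F_eq {x : ℝ} (hx : x ≠ 0) : M.F x = x * M.phi x := by
  rw [phi]; field_simp

namespace Assumptions

theorem κ_pos (hM : M.Assumptions) : 0 < M.κ := add_pos hM.δ_pos hM.γ_pos

theorem r'_pos (hM : M.Assumptions) : 0 < M.r' := mul_pos hM.r_pos hM.κ_pos

theorem cstar_pos (hM : M.Assumptions) : 0 < M.cstar := add_pos hM.c_pos hM.r'_pos

theorem p_pos (hM : M.Assumptions) : 0 < M.p := by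
  have h := hM.profitable
  have h1 := hM.cstar_pos
  have h2 := hM.xbar_pos
  by_contra hp
  nlinarith

theorem contDiffAt_F (hM : M.Assumptions) {x : ℝ} (hx : 0 < x) : ContDiffAt ℝ 2 M.F x :=
  hM.F_C2.contDiffAt (Ici_mem_nhds hx)

theorem hasDerivAt_F (hM : M.Assumptions) {x : ℝ} (hx : 0 < x) :
    HasDerivAt M.F (deriv M.F x) x :=
  ((hM.contDiffAt_F hx).differentiableAt (by norm_num)).hasDerivAt

theorem continuousOn_F (hM : M.Assumptions) : ContinuousOn M.F (Ici 0) := hM.F_C2.continuousOn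

theorem derivWithin_eq {x : ℝ} (hx : 0 < x) :
    derivWithin M.F (Ici 0) x = deriv M.F x :=
  derivWithin_of_mem_nhds (Ici_mem_nhds hx)

theorem continuousOn_derivWithin (hM : M.Assumptions) :
    ContinuousOn (derivWithin M.F (Ici 0)) (Ici 0) :=
  hM.F_C2.continuousOn_derivWithin (uniqueDiffOn_Ici 0) (by norm_num)

theorem continuousOn_deriv (hM : M.Assumptions) : ContinuousOn (deriv M.F) (Ioi 0) :=
  (hM.continuousOn_derivWithin.mono Ioi_subset_Ici_self).congr
    fun _ hx => (derivWithin_eq hx).symm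

theorem strictAntiOn_derivWithin (hM : M.Assumptions) :
    StrictAntiOn (derivWithin M.F (Ici 0)) (Icc 0 M.xbar) := by
  apply strictAntiOn_of_deriv_neg (convex_Icc _ _)
  · exact hM.continuousOn_derivWithin.mono Icc_subset_Ici_self
  · intro x hx
    rw [interior_Icc] at hx
    have h := hM.F_concave x ⟨hx.1.le, hx.2.le⟩
    rw [iteratedDerivWithin_succ, derivWithin_of_mem_nhds (Ici_mem_nhds hx.1)] at h
    refine lt_of_eq_of_lt (Filter.EventuallyEq.deriv_eq ?_) h
    filter_upwards [Ioi_mem_nhds hx.1] with y hy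
    rw [iteratedDerivWithin_one]

theorem deriv_lt (hM : M.Assumptions) {x y : ℝ} (hx : 0 < x) (hxy : x < y) (hy : y ≤ M.xbar) :
    deriv M.F y < deriv M.F x := by
  rw [← derivWithin_eq hx, ← derivWithin_eq (hx.trans hxy)]
  exact hM.strictAntiOn_derivWithin ⟨hx.le, (hxy.trans_le hy).le⟩ ⟨(hx.trans hxy).le, hy⟩ hxy

theorem deriv_lt_phi (hM : M.Assumptions) {x : ℝ} (hx : x ∈ Ioc 0 M.xbar) :
    deriv M.F x < M.phi x := by
  obtain ⟨c, hc, h⟩ := exists_deriv_eq_slope M.F hx.1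
    (hM.continuousOn_F.mono Icc_subset_Ici_self)
    (fun y hy => (hM.hasDerivAt_F hy.1).differentiableAt.differentiableWithinAt)
  rw [hM.F_zero, sub_zero, sub_zero] at h
  rw [phi, ← h]
  exact hM.deriv_lt hc.1 hc.2 hx.2

theorem hasDerivAt_phi (hM : M.Assumptions) {x : ℝ} (hx : 0 < x) :
    HasDerivAt M.phi ((deriv M.F x - M.phi x) / x) x := by
  have h := (hM.hasDerivAt_F hx).div (hasDerivAt_id x) hx.ne'
  refine h.congr_deriv ?_
  simp only [phi, id]
  field_simp

theorem continuousOn_phi (hM : M.Assumptions) : ContinuousOn M.phi (Ioi 0) :=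
  fun _ hx => (hM.hasDerivAt_phi hx).continuousAt.continuousWithinAt

theorem continuousOn_g (hM : M.Assumptions) : ContinuousOn M.g (Ioi 0) :=
  (continuousOn_const.sub hM.continuousOn_deriv).add hM.continuousOn_phi

theorem continuousOn_ψ (hM : M.Assumptions) : ContinuousOn M.ψ (Ioi 0) := by
  have : M.ψ = fun x => (M.p * x - M.c) * (M.δ - deriv M.F x) - M.c * M.phi x := funext ψ_eq
  rw [this]
  have h1 := hM.continuousOn_deriv
  have h2 := hM.continuousOn_phi
  fun_prop

theorem strictAntiOn_phi (hM : M.Assumptions) : StrictAntiOn M.phi (Ioc 0 M.xbar) := by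
  apply strictAntiOn_of_deriv_neg (convex_Ioc _ _)
  · exact hM.continuousOn_phi.mono Ioc_subset_Ioi_self
  · intro x hx
    rw [interior_Ioc] at hx
    rw [(hM.hasDerivAt_phi hx.1).deriv]
    exact div_neg_of_neg_of_pos (sub_neg.2 (hM.deriv_lt_phi ⟨hx.1, hx.2.le⟩)) hx.1

theorem phi_lt (hM : M.Assumptions) {x y : ℝ} (hx : 0 < x) (hxy : x < y) (hy : y ≤ M.xbar) :
    M.phi y < M.phi x :=
  hM.strictAntiOn_phi ⟨hx, (hxy.trans_le hy).le⟩ ⟨hx.trans hxy, hy⟩ hxy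

theorem phi_le (hM : M.Assumptions) {x y : ℝ} (hx : 0 < x) (hxy : x ≤ y) (hy : y ≤ M.xbar) :
    M.phi y ≤ M.phi x :=
  hM.strictAntiOn_phi.antitoneOn ⟨hx, hxy.trans hy⟩ ⟨hx.trans_le hxy, hy⟩ hxy

theorem phi_xbar (hM : M.Assumptions) : M.phi M.xbar = 0 := by simp [phi, hM.F_xbar]

theorem phi_pos (hM : M.Assumptions) {x : ℝ} (hx : x ∈ Ioo 0 M.xbar) : 0 < M.phi x :=
  div_pos (hM.F_pos x hx) hx.1

theorem phi_nonneg (hM : M.Assumptions) {x : ℝ} (hx : x ∈ Ioc 0 M.xbar) : 0 ≤ M.phi x := by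
  rw [← hM.phi_xbar]; exact hM.phi_le hx.1 hx.2 le_rfl

theorem phi_le_deriv_zero (hM : M.Assumptions) {x : ℝ} (hx : x ∈ Ioc 0 M.xbar) :
    M.phi x ≤ derivWithin M.F (Ici 0) 0 := by
  obtain ⟨c, hc, h⟩ := exists_deriv_eq_slope M.F hx.1
    (hM.continuousOn_F.mono Icc_subset_Ici_self)
    (fun y hy => (hM.hasDerivAt_F hy.1).differentiableAt.differentiableWithinAt)
  rw [hM.F_zero, sub_zero, sub_zero] at h
  rw [phi, ← h, ← derivWithin_eq hc.1]
  exact (hM.strictAntiOn_derivWithin ⟨le_rfl, hM.xbar_pos.le⟩ ⟨hc.1.le, hc.2.le.trans hx.2⟩ hc.1).le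

theorem exists_lipschitz_F (hM : M.Assumptions) :
    ∃ L : NNReal, LipschitzOnWith L M.F (Icc 0 M.xbar) := by
  obtain ⟨C, hC⟩ := isCompact_Icc.exists_bound_of_continuousOn
    (hM.continuousOn_derivWithin.mono (show Icc 0 M.xbar ⊆ Ici 0 from Icc_subset_Ici_self))
  refine ⟨C.toNNReal, (convex_Icc _ _).lipschitzOnWith_of_nnnorm_hasDerivWithin_le
    (f' := derivWithin M.F (Ici 0)) (fun x hx => ?_) (fun x hx => ?_)⟩
  · exact ((hM.F_C2.differentiableOn (by norm_num) x hx.1).hasDerivWithinAt).mono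
      Icc_subset_Ici_self
  · rw [← NNReal.coe_le_coe, coe_nnnorm]
    exact (hC x hx).trans (Real.le_coe_toNNReal C)

/-- Both F' and φ tend to F'(0), so the terms with c F'(0) cancel in the limit. -/
theorem tendsto_ψ_zero (hM : M.Assumptions) :
    Tendsto M.ψ (𝓝[>] 0) (𝓝 (-M.c * M.δ)) := by
  have h1 : Tendsto (deriv M.F) (𝓝[>] 0) (𝓝 (derivWithin M.F (Ici 0) 0)) := by
    have h := (hM.continuousOn_derivWithin 0 self_mem_Ici).mono_left
      (nhdsWithin_mono 0 Ioi_subset_Ici_self)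
    refine h.congr' ?_
    filter_upwards [self_mem_nhdsWithin] with x hx using derivWithin_eq hx
  have h2 : Tendsto M.phi (𝓝[>] 0) (𝓝 (derivWithin M.F (Ici 0) 0)) := by
    have h := ((hM.F_C2.differentiableOn (by norm_num) 0 self_mem_Ici).hasDerivWithinAt)
    have h := hasDerivWithinAt_iff_tendsto_slope.1 h
    rw [Ici_sdiff_left] at h
    refine h.congr fun x => ?_
    simp [slope, hM.F_zero, phi, div_eq_inv_mul]
  have h3 : Tendsto (fun x : ℝ => x) (𝓝[>] 0) (𝓝 0) := tendsto_id.mono_left nhdsWithin_le_nhds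
  have h4 := (((h3.const_mul M.p).sub_const M.c).mul (h1.const_sub M.δ)).sub (h2.const_mul M.c)
  refine (h4.congr fun x => (ψ_eq x).symm).trans_eq ?_
  congr 1; ring

/-- As ψ increases on (0, xtil) from its limit −cδ, it is at least −cδ there. Since p x (δ − F') = ψ
+ c(δ − F') + cφ, the left side is at least c(φ − F') > 0. Concavity of F carries the inequality
beyond xtil. -/
theorem deriv_lt_δ (hM : M.Assumptions) {x : ℝ} (hx : x ∈ Ioc 0 M.xbar) : deriv M.F x < M.δ := by
  have key : ∀ y ∈ Ioo 0 M.xtil, deriv M.F y < M.δ := by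
    intro y hy
    have hmono : StrictMonoOn M.ψ (Ioo 0 M.xtil) := by
      apply strictMonoOn_of_deriv_pos (convex_Ioo _ _)
      · exact hM.continuousOn_ψ.mono Ioo_subset_Ioi_self
      · intro x hx
        rw [interior_Ioo] at hx
        exact hM.ψ_deriv_pos x hx
    have h1 : -M.c * M.δ ≤ M.ψ y := by
      refine le_of_tendsto hM.tendsto_ψ_zero ?_
      filter_upwards [Ioo_mem_nhdsGT hy.1] with x hx
      exact (hmono ⟨hx.1, hx.2.trans hy.2⟩ hy hx.2).le
    rw [ψ_eq] at h1
    have h2 := hM.deriv_lt_phi ⟨hy.1, (hy.2.trans hM.xtil_mem.2).le⟩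
    have h3 : 0 < M.p * y * (M.δ - deriv M.F y) := by nlinarith [hM.c_pos]
    have h4 := pos_of_mul_pos_right h3 (mul_pos hM.p_pos hy.1).le
    linarith
  rcases lt_or_ge x M.xtil with h | h
  · exact key x ⟨hx.1, h⟩
  · have h0 := hM.xtil_mem.1
    have := hM.deriv_lt (x := M.xtil / 2) (y := x) (by linarith) (by linarith) hx.2
    exact this.trans (key _ ⟨by linarith, by linarith⟩)

theorem g_pos (hM : M.Assumptions) {x : ℝ} (hx : x ∈ Ioc 0 M.xbar) : 0 < M.g x := by
  rw [g_eq]; linarith [hM.deriv_lt_δ hx, hM.phi_nonneg hx]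

/-- The restriction 0 ≤ z ≤ p x − c makes both coefficients in `G_eq` nonnegative, and then F' and
φ, which decrease in x, push G up. -/
theorem G_lt (hM : M.Assumptions) {x y z : ℝ} (hx : 0 < x) (hxy : x < y) (hy : y ≤ M.xbar)
    (hz : 0 ≤ z) (hz' : z ≤ M.p * x - M.c) : M.G x z < M.G y z := by
  rw [G_eq, G_eq]
  have h1 := hM.deriv_lt hx hxy hy
  have h2 := hM.deriv_lt_δ (x := x) ⟨hx, hxy.le.trans hy⟩
  have h3 := hM.phi_lt hx hxy hy
  have h4 := mul_lt_mul_of_pos_left hxy hM.p_pos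
  have h5 := hM.c_pos
  have h6 : (M.c + z) * M.phi y < (M.c + z) * M.phi x :=
    mul_lt_mul_of_pos_left h3 (by linarith)
  have h7 : (M.p * x - M.c - z) * (M.δ - deriv M.F x) ≤
      (M.p * y - M.c - z) * (M.δ - deriv M.F y) :=
    mul_le_mul (by linarith) (by linarith) (by linarith) (by linarith)
  linarith

theorem ψstar_lt_ψ (hM : M.Assumptions) {x : ℝ} (hx : x ∈ Ioc 0 M.xbar) : M.ψstar x < M.ψ x := by
  rw [ψstar_eq]; linarith [mul_pos hM.r'_pos (hM.g_pos hx)]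

theorem xtil_lt_xstar (hM : M.Assumptions) : M.xtil < M.xstar := by
  have h := hM.ψstar_lt_ψ (x := M.xtil) ⟨hM.xtil_mem.1, hM.xtil_mem.2.le⟩
  rw [hM.ψ_xtil] at h
  rcases lt_trichotomy M.xtil M.xstar with h1 | h1 | h1
  · exact h1
  · rw [h1, hM.ψstar_xstar] at h; exact absurd h (lt_irrefl _)
  · exact absurd (hM.ψstar_pos _ ⟨h1, hM.xtil_mem.2⟩) (by linarith)

/-- ψ_*(x^*) = 0 reads (p x^* − c_*)(δ − F') = c_* φ(x^*), and the right side is positive. This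
margin is what makes renewed investment profitable. -/
theorem cstar_lt (hM : M.Assumptions) : M.cstar < M.p * M.xstar := by
  have hx : M.xstar ∈ Ioc 0 M.xbar := ⟨hM.xstar_mem.1, hM.xstar_mem.2.le⟩
  have h := hM.ψstar_xstar
  have h1 : (M.p * M.xstar - M.cstar) * (M.δ - deriv M.F M.xstar) = M.cstar * M.phi M.xstar := by
    rw [ψstar] at h; rw [phi]; linear_combination h
  have h2 : 0 < M.cstar * M.phi M.xstar := mul_pos hM.cstar_pos (hM.phi_pos hM.xstar_mem)
  rw [← h1] at h2
  have := pos_of_mul_pos_left h2 (by linarith [hM.deriv_lt_δ hx])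
  linarith

theorem ψ_pos' (hM : M.Assumptions) {x : ℝ} (h1 : M.xtil < x) (h2 : x ≤ M.xbar) : 0 < M.ψ x := by
  rcases h2.lt_or_eq with h | h
  · exact hM.ψ_pos x ⟨h1, h⟩
  · rw [h, ψ_eq, hM.phi_xbar]
    have := hM.deriv_lt_δ (x := M.xbar) ⟨hM.xbar_pos, le_rfl⟩
    have h3 := hM.profitable
    have h4 : M.c < M.cstar := by rw [cstar]; linarith [hM.r'_pos]
    have := mul_pos (a := M.p * M.xbar - M.c) (b := M.δ - deriv M.F M.xbar) (by linarith)
      (by linarith)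
    linarith

theorem ψstar_pos' (hM : M.Assumptions) {x : ℝ} (h1 : M.xstar < x) (h2 : x ≤ M.xbar) :
    0 < M.ψstar x := by
  rcases h2.lt_or_eq with h | h
  · exact hM.ψstar_pos x ⟨h1, h⟩
  · have h5 : M.ψstar x = (M.p * M.xbar - M.cstar) * (M.δ - deriv M.F M.xbar) := by
      rw [h, ψstar, hM.F_xbar]; simp
    rw [h5]
    have := hM.deriv_lt_δ (x := M.xbar) ⟨hM.xbar_pos, le_rfl⟩
    have h3 := hM.profitable
    exact mul_pos (by linarith) (by linarith)

theorem ψ_neg_of_lt (hM : M.Assumptions) {x : ℝ} (h0 : 0 < x) (h : x < M.xtil) : M.ψ x < 0 :=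
  hM.ψ_neg x ⟨h0, h⟩

theorem ψ_nonneg_of_le (hM : M.Assumptions) {x : ℝ} (h1 : M.xtil ≤ x) (h2 : x ≤ M.xbar) :
    0 ≤ M.ψ x := by
  rcases h1.lt_or_eq with h | h
  · exact (hM.ψ_pos' h h2).le
  · rw [← h, hM.ψ_xtil]

theorem ψ_nonpos_of_le (hM : M.Assumptions) {x : ℝ} (h0 : 0 < x) (h : x ≤ M.xtil) : M.ψ x ≤ 0 := by
  rcases h.lt_or_eq with h | h
  · exact (hM.ψ_neg_of_lt h0 h).le
  · rw [h, hM.ψ_xtil]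

theorem ψstar_nonpos_of_le (hM : M.Assumptions) {x : ℝ} (h0 : 0 < x) (h : x ≤ M.xstar) :
    M.ψstar x ≤ 0 := by
  rcases h.lt_or_eq with h | h
  · exact (hM.ψstar_neg x ⟨h0, h⟩).le
  · rw [h, hM.ψstar_xstar]

theorem eq_xstar (hM : M.Assumptions) {x : ℝ} (h0 : x ∈ Ioc 0 M.xbar)
    (h : M.ψstar x = 0) : x = M.xstar := by
  rcases lt_trichotomy x M.xstar with h1 | h1 | h1
  · exact absurd (hM.ψstar_neg x ⟨h0.1, h1⟩) (by simp [h])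
  · exact h1
  · exact absurd (hM.ψstar_pos' h1 h0.2) (by simp [h])

theorem le_xtil_of_ψ_nonpos (hM : M.Assumptions) {x : ℝ} (h0 : x ≤ M.xbar)
    (h : M.ψ x ≤ 0) : x ≤ M.xtil := by
  by_contra hx
  exact absurd (hM.ψ_pos' (not_le.1 hx) h0) (not_lt.2 h)

theorem xtil_le_of_ψ_nonneg (hM : M.Assumptions) {x : ℝ} (h0 : 0 < x)
    (h : 0 ≤ M.ψ x) : M.xtil ≤ x := by
  by_contra hx
  exact absurd (hM.ψ_neg_of_lt h0 (not_le.1 hx)) (not_lt.2 h)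

theorem c_lt (hM : M.Assumptions) : M.c < M.p * M.xtil := by
  have hx : M.xtil ∈ Ioc 0 M.xbar := ⟨hM.xtil_mem.1, hM.xtil_mem.2.le⟩
  have h := hM.ψ_xtil
  rw [ψ_eq] at h
  have h1 := mul_pos hM.c_pos (hM.phi_pos hM.xtil_mem)
  have h2 := sub_pos.2 (hM.deriv_lt_δ hx)
  have h3 : 0 < M.p * M.xtil - M.c := pos_of_mul_pos_left (by linarith) h2.le
  linarith

theorem Kstar_lt (hM : M.Assumptions) : M.Kstar < M.phi M.xtil :=
  hM.phi_lt hM.xtil_mem.1 hM.xtil_lt_xstar hM.xstar_mem.2.le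

theorem Kstar_pos (hM : M.Assumptions) : 0 < M.Kstar := hM.phi_pos hM.xstar_mem

end Assumptions
end Fishery

/-! ### Real analysis -/

/-- The coefficient is extended by constants beyond the interval, so that E is differentiable in the
full sense at the end points too. -/
theorem exists_integrating_factor {k : ℝ → ℝ} {a b : ℝ} (hab : a ≤ b)
    (hk : ContinuousOn k (Icc a b)) :
    ∃ E : ℝ → ℝ, (∀ t, 0 < E t) ∧ ∀ t ∈ Icc a b, HasDerivAt E (k t * E t) t := by
  have hc : Continuous (IccExtend hab ((Icc a b).domRestrict k)) :=
    continuous_IccExtend_iff.2 hk.domRestrict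
  refine ⟨fun t => Real.exp (∫ s in a..t, IccExtend hab ((Icc a b).domRestrict k) s),
    fun t => Real.exp_pos _, fun t ht => ?_⟩
  have h := (intervalIntegral.integral_hasDerivAt_right (hc.intervalIntegrable a t)
    (hc.stronglyMeasurableAtFilter _ _) hc.continuousAt).exp
  rw [IccExtend_of_mem hab _ ht] at h
  rw [mul_comm]
  exact h

theorem exists_integrating_factor_mul {k w w' : ℝ → ℝ} {a b : ℝ} (hab : a ≤ b)
    (hk : ContinuousOn k (Icc a b))
    (hw : ∀ t ∈ Icc a b, HasDerivWithinAt w (w' t) (Icc a b) t) :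
    ∃ E : ℝ → ℝ, (∀ t, 0 < E t) ∧ ContinuousOn (fun t => w t * E t) (Icc a b) ∧
      ∀ t ∈ Ioo a b, HasDerivAt (fun t => w t * E t) ((w' t + k t * w t) * E t) t := by
  obtain ⟨E, hE, hE'⟩ := exists_integrating_factor hab hk
  refine ⟨E, hE, fun t ht => ((hw t ht).continuousWithinAt.mul
    (hE' t ht).continuousAt.continuousWithinAt), fun t ht => ?_⟩
  have h := ((hw t (Ioo_subset_Icc_self ht)).hasDerivAt (Icc_mem_nhds ht.1 ht.2)).mul
    (hE' t (Ioo_subset_Icc_self ht))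
  exact h.congr_deriv (by ring)

/-- The integrating factor turns w' + k w ≥ 0 into monotonicity of w E. The sign lemmas that follow
rest on this device and provide all barriers for z and λ. -/
theorem lin_monotone {k w w' : ℝ → ℝ} {a b : ℝ} (hab : a ≤ b) (hk : ContinuousOn k (Icc a b))
    (hw : ∀ t ∈ Icc a b, HasDerivWithinAt w (w' t) (Icc a b) t)
    (h : ∀ t ∈ Ioo a b, 0 ≤ w' t + k t * w t) :
    ∃ E : ℝ → ℝ, (∀ t, 0 < E t) ∧ MonotoneOn (fun t => w t * E t) (Icc a b) := by
  obtain ⟨E, hE, hc, hd⟩ := exists_integrating_factor_mul hab hk hw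
  refine ⟨E, hE, monotoneOn_of_deriv_nonneg (convex_Icc _ _) hc ?_ ?_⟩ <;> rw [interior_Icc]
  · exact fun t ht => (hd t ht).differentiableAt.differentiableWithinAt
  · intro t ht
    rw [(hd t ht).deriv]
    exact mul_nonneg (h t ht) (hE t).le

theorem lin_nonneg {k w w' : ℝ → ℝ} {a b : ℝ} (hk : ContinuousOn k (Icc a b))
    (hw : ∀ t ∈ Icc a b, HasDerivWithinAt w (w' t) (Icc a b) t)
    (h : ∀ t ∈ Ioo a b, 0 ≤ w' t + k t * w t) (ha : 0 ≤ w a) {t : ℝ} (ht : t ∈ Icc a b) :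
    0 ≤ w t := by
  obtain ⟨E, hE, hm⟩ := lin_monotone (ht.1.trans ht.2) hk hw h
  have h1 := hm ⟨le_rfl, ht.1.trans ht.2⟩ ht ht.1
  exact nonneg_of_mul_nonneg_left ((mul_nonneg ha (hE a).le).trans h1) (hE t)

theorem lin_pos {k w w' : ℝ → ℝ} {a b : ℝ} (hk : ContinuousOn k (Icc a b))
    (hw : ∀ t ∈ Icc a b, HasDerivWithinAt w (w' t) (Icc a b) t)
    (h : ∀ t ∈ Ioo a b, 0 ≤ w' t + k t * w t) (ha : 0 < w a) {t : ℝ} (ht : t ∈ Icc a b) :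
    0 < w t := by
  obtain ⟨E, hE, hm⟩ := lin_monotone (ht.1.trans ht.2) hk hw h
  have h1 := hm ⟨le_rfl, ht.1.trans ht.2⟩ ht ht.1
  exact pos_of_mul_pos_left ((mul_pos ha (hE a)).trans_le h1) (hE t).le

theorem lin_pos_of_strict {k w w' : ℝ → ℝ} {a b : ℝ} (hk : ContinuousOn k (Icc a b))
    (hw : ∀ t ∈ Icc a b, HasDerivWithinAt w (w' t) (Icc a b) t)
    (h : ∀ t ∈ Ioo a b, 0 < w' t + k t * w t) (ha : 0 ≤ w a) {t : ℝ} (ht : t ∈ Ioc a b) :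
    0 < w t := by
  obtain ⟨E, hE, hc, hd⟩ := exists_integrating_factor_mul (ht.1.le.trans ht.2) hk hw
  have hm : StrictMonoOn (fun t => w t * E t) (Icc a b) := by
    refine strictMonoOn_of_deriv_pos (convex_Icc _ _) hc ?_
    rw [interior_Icc]
    intro t ht
    rw [(hd t ht).deriv]
    exact mul_pos (h t ht) (hE t)
  have h1 := hm ⟨le_rfl, ht.1.le.trans ht.2⟩ (Ioc_subset_Icc_self ht) ht.1
  exact pos_of_mul_pos_left ((mul_nonneg ha (hE a).le).trans_lt h1) (hE t).le

theorem lin_zero {k w w' : ℝ → ℝ} {a b : ℝ} (hk : ContinuousOn k (Icc a b))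
    (hw : ∀ t ∈ Icc a b, HasDerivWithinAt w (w' t) (Icc a b) t)
    (h : ∀ t ∈ Ioo a b, w' t + k t * w t = 0) (ha : w a = 0) {t : ℝ} (ht : t ∈ Icc a b) :
    w t = 0 := by
  have h1 := lin_nonneg hk hw (fun s hs => (h s hs).ge) ha.ge ht
  have h2 := lin_nonneg (w := fun s => - w s) (w' := fun s => - w' s) hk
    (fun s hs => (hw s hs).neg) (fun s hs => by linarith [h s hs]) (by simp [ha]) ht
  linarith

theorem exists_first_zero {f : ℝ → ℝ} {a t : ℝ} (hf : ContinuousOn f (Icc a t)) (ha : 0 < f a)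
    (hat : a ≤ t) (ht : f t ≤ 0) : ∃ σ ∈ Ioc a t, f σ = 0 ∧ ∀ s ∈ Ico a σ, 0 < f s := by
  set S := {s ∈ Icc a t | f s ≤ 0} with hS
  have hcl : IsClosed S := hf.preimage_isClosed_of_isClosed isClosed_Icc isClosed_Iic
  have hne : S.Nonempty := ⟨t, ⟨hat, le_rfl⟩, ht⟩
  have hbd : BddBelow S := ⟨a, fun s hs => hs.1.1⟩
  have hm := hcl.csInf_mem hne hbd
  set σ := sInf S
  have hlt : ∀ s ∈ Ico a σ, 0 < f s := by
    intro s hs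
    by_contra hc
    exact absurd (csInf_le hbd ⟨⟨hs.1, hs.2.le.trans hm.1.2⟩, not_lt.1 hc⟩) (not_le.2 hs.2)
  have haσ : a < σ := by
    rcases hm.1.1.lt_or_eq with h | h
    · exact h
    · rw [h] at ha; exact absurd hm.2 (not_le.2 ha)
  refine ⟨σ, ⟨haσ, hm.1.2⟩, le_antisymm hm.2 ?_, hlt⟩
  by_contra hc
  obtain ⟨c, hc1, hc2⟩ := intermediate_value_Icc' haσ.le
    (hf.mono (Icc_subset_Icc_right hm.1.2)) ⟨(not_le.1 hc).le, ha.le⟩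
  rcases hc1.2.lt_or_eq with h | h
  · exact absurd (hlt c ⟨hc1.1, h⟩) (by rw [hc2]; exact lt_irrefl _)
  · rw [h] at hc2; exact hc (by rw [hc2])

theorem exists_last_zero {f : ℝ → ℝ} {t b : ℝ} (hf : ContinuousOn f (Icc t b)) (hb : 0 < f b)
    (htb : t ≤ b) (ht : f t ≤ 0) : ∃ σ ∈ Ico t b, f σ = 0 ∧ ∀ s ∈ Ioc σ b, 0 < f s := by
  have hmaps : MapsTo (fun s : ℝ => -s) (Icc (-b) (-t)) (Icc t b) :=
    fun s hs => ⟨by linarith [hs.2], by linarith [hs.1]⟩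
  obtain ⟨σ, h1, h2, h3⟩ := exists_first_zero (f := fun s => f (-s)) (a := -b) (t := -t)
    (hf.comp continuous_neg.continuousOn hmaps) (by simpa using hb) (by linarith) (by simpa using ht)
  refine ⟨-σ, ⟨by linarith [h1.2], by linarith [h1.1]⟩, h2, fun s hs => ?_⟩
  have := h3 (-s) ⟨by linarith [hs.2], by linarith [hs.1]⟩
  simpa using this

/-- A bootstrap: the lower bound for D is assumed only as long as D has stayed nonnegative, but it
then prevents D from ever coming down to zero. -/
theorem barrier {D : ℝ → ℝ} {a b : ℝ} (hD : ContinuousOn D (Icc a b)) (h0 : 0 < D a)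
    (h : ∀ t ∈ Icc a b, (∀ s ∈ Icc a t, 0 ≤ D s) → D a ≤ D t) {t : ℝ} (ht : t ∈ Icc a b) :
    D a ≤ D t := by
  have hpos : ∀ s ∈ Icc a b, 0 < D s := by
    intro s hs
    by_contra hc
    obtain ⟨σ, h1, h2, h3⟩ := exists_first_zero (hD.mono (Icc_subset_Icc_right hs.2)) h0 hs.1
      (not_lt.1 hc)
    have := h σ ⟨h1.1.le, h1.2.trans hs.2⟩ fun u hu => by
      rcases hu.2.lt_or_eq with h | h
      · exact (h3 u ⟨hu.1, h⟩).le
      · rw [h, h2]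
    linarith
  exact h t ht fun s hs => (hpos s ⟨hs.1, hs.2.trans ht.2⟩).le

theorem HasDerivWithinAt.shift {f : ℝ → ℝ} {f' d a b a' b' s : ℝ}
    (h : HasDerivWithinAt f f' (Icc a b) (d + s)) (ha : a ≤ d + a') (hb : d + b' ≤ b) :
    HasDerivWithinAt (fun s => f (d + s)) f' (Icc a' b') s := by
  have h1 : HasDerivWithinAt (fun s : ℝ => d + s) 1 (Icc a' b') s :=
    ((hasDerivAt_id s).const_add d).hasDerivWithinAt
  have := HasDerivWithinAt.comp s h h1
    (fun u hu => ⟨by linarith [hu.1], by linarith [hu.2]⟩)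
  exact this.congr_deriv (mul_one _)

theorem HasDerivWithinAt.reflect {f : ℝ → ℝ} {f' d a b a' b' s : ℝ}
    (h : HasDerivWithinAt f f' (Icc a b) (d - s)) (ha : a ≤ d - b') (hb : d - a' ≤ b) :
    HasDerivWithinAt (fun s => f (d - s)) (-f') (Icc a' b') s := by
  have h1 : HasDerivWithinAt (fun s : ℝ => d - s) (-1) (Icc a' b') s :=
    ((hasDerivAt_id s).const_sub d).hasDerivWithinAt
  have := HasDerivWithinAt.comp s h h1
    (fun u hu => ⟨by linarith [hu.2], by linarith [hu.1]⟩)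
  exact this.congr_deriv (mul_neg_one _)

theorem nonpos_of_hasDerivWithinAt_right {f : ℝ → ℝ} {f' a b : ℝ} (hab : a < b)
    (h : HasDerivWithinAt f f' (Icc a b) a) (hle : ∀ s ∈ Ioo a b, f s ≤ f a) : f' ≤ 0 := by
  have h := (h.mono Ioo_subset_Icc_self)
  rw [hasDerivWithinAt_iff_tendsto_slope' (by simp)] at h
  have hne : (𝓝[Ioo a b] a).NeBot := by
    rw [nhdsWithin_Ioo_eq_nhdsGT hab]; infer_instance
  refine le_of_tendsto h ?_
  filter_upwards [self_mem_nhdsWithin] with s hs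
  rw [slope_def_field]
  exact div_nonpos_of_nonpos_of_nonneg (by linarith [hle s hs]) (by linarith [hs.1])

theorem nonneg_of_hasDerivWithinAt_right {f : ℝ → ℝ} {f' a b : ℝ} (hab : a < b)
    (h : HasDerivWithinAt f f' (Icc a b) a) (hle : ∀ s ∈ Ioo a b, f a ≤ f s) : 0 ≤ f' := by
  have := nonpos_of_hasDerivWithinAt_right hab h.neg (fun s hs => neg_le_neg (hle s hs))
  linarith

theorem nonneg_of_hasDerivWithinAt_left {f : ℝ → ℝ} {f' a b : ℝ} (hab : a < b)
    (h : HasDerivWithinAt f f' (Icc a b) b) (hle : ∀ s ∈ Ioo a b, f s ≤ f b) : 0 ≤ f' := by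
  have h1 : HasDerivWithinAt f f' (Icc a b) (b - 0) := by simpa using h
  have := nonpos_of_hasDerivWithinAt_right (a := 0) (b := b - a) (by linarith)
    (h1.reflect (a' := 0) (b' := b - a) (by linarith) (by linarith)) (fun s hs => by
      simpa using hle (b - s) ⟨by linarith [hs.2], by linarith [hs.1]⟩)
  linarith

theorem nonpos_of_hasDerivWithinAt_left {f : ℝ → ℝ} {f' a b : ℝ} (hab : a < b)
    (h : HasDerivWithinAt f f' (Icc a b) b) (hle : ∀ s ∈ Ioo a b, f b ≤ f s) : f' ≤ 0 := by
  have := nonneg_of_hasDerivWithinAt_left hab h.neg (fun s hs => neg_le_neg (hle s hs))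
  linarith

namespace Fishery
variable {M : Fishery}

/-! ### Trajectories with full effort, backwards in time -/

/-- The capital `K₁ e^{γ t}`. -/
def cap (M : Fishery) (K₁ t : ℝ) : ℝ := K₁ * Real.exp (M.γ * t)

theorem cap_zero (K₁ : ℝ) : M.cap K₁ 0 = K₁ := by simp [cap]

theorem cap_add (K₁ s t : ℝ) : M.cap K₁ (s + t) = M.cap (M.cap K₁ s) t := by
  simp only [cap, mul_add, Real.exp_add]; ring

theorem cap_pos {K₁ : ℝ} (h : 0 < K₁) (t : ℝ) : 0 < M.cap K₁ t := mul_pos h (Real.exp_pos _)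

theorem continuous_cap (K₁ : ℝ) : Continuous (M.cap K₁) := by unfold cap; fun_prop

theorem hasDerivAt_cap (K₁ t : ℝ) : HasDerivAt (M.cap K₁) (M.γ * M.cap K₁ t) t := by
  have h := (((hasDerivAt_id t).const_mul M.γ).exp).const_mul K₁
  refine h.congr_deriv ?_
  simp only [cap, id]; ring

theorem Assumptions.cap_lt (hM : M.Assumptions) {K₁ s t : ℝ} (h : 0 < K₁) (hst : s < t) :
    M.cap K₁ s < M.cap K₁ t :=
  mul_lt_mul_of_pos_left (Real.exp_lt_exp.2 (mul_lt_mul_of_pos_left hst hM.γ_pos)) h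

theorem Assumptions.cap_le (hM : M.Assumptions) {K₁ s t : ℝ} (h : 0 < K₁) (hst : s ≤ t) :
    M.cap K₁ s ≤ M.cap K₁ t :=
  mul_le_mul_of_nonneg_left (Real.exp_le_exp.2 (mul_le_mul_of_nonneg_left hst hM.γ_pos.le)) h.le

theorem Assumptions.cap_lt_iff (hM : M.Assumptions) {K₁ s t : ℝ} (h : 0 < K₁) :
    M.cap K₁ s < M.cap K₁ t ↔ s < t :=
  ⟨fun h1 => by
    by_contra hc
    exact absurd (hM.cap_le h (not_lt.1 hc)) (not_le.2 h1), hM.cap_lt h⟩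

theorem Assumptions.exists_cap_eq (hM : M.Assumptions) {K₁ K₂ : ℝ} (h1 : 0 < K₁) (h : K₁ ≤ K₂) :
    ∃ d, 0 ≤ d ∧ M.cap K₁ d = K₂ := by
  refine ⟨Real.log (K₂ / K₁) / M.γ, div_nonneg (Real.log_nonneg ?_) hM.γ_pos.le, ?_⟩
  · rwa [le_div_iff₀ h1, one_mul]
  · rw [cap, mul_div_cancel₀ _ hM.γ_pos.ne', Real.exp_log (div_pos (h1.trans_le h) h1)]
    field_simp

/-- `x` is a solution of the backward equation with full effort on `[a, b]`. -/
structure IsFull (M : Fishery) (K₁ : ℝ) (x : ℝ → ℝ) (a b : ℝ) : Prop where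
  mem : ∀ t ∈ Icc a b, x t ∈ Ioc 0 M.xbar
  deriv : ∀ t ∈ Icc a b,
    HasDerivWithinAt x (-M.F (x t) + M.cap K₁ t * x t) (Icc a b) t

/-- `z` solves the backward equation of the first switch variable along `x`. -/
structure IsSwitch (M : Fishery) (x z : ℝ → ℝ) (a b : ℝ) : Prop where
  mem : ∀ t ∈ Icc a b, x t ∈ Ioc 0 M.xbar
  cont : ContinuousOn x (Icc a b)
  deriv : ∀ t ∈ Icc a b, HasDerivWithinAt z (M.G (x t) (z t)) (Icc a b) t

namespace IsFull

variable {K₁ a b : ℝ} {x z : ℝ → ℝ}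

theorem mono (h : M.IsFull K₁ x a b) {a' b' : ℝ} (ha : a ≤ a') (hb : b' ≤ b) :
    M.IsFull K₁ x a' b' :=
  ⟨fun t ht => h.mem t ⟨ha.trans ht.1, ht.2.trans hb⟩,
    fun t ht => (h.deriv t ⟨ha.trans ht.1, ht.2.trans hb⟩).mono (Icc_subset_Icc ha hb)⟩

theorem shift {d : ℝ} (h : M.IsFull K₁ x (d + a) (d + b)) :
    M.IsFull (M.cap K₁ d) (fun s => x (d + s)) a b := by
  refine ⟨fun t ht => h.mem _ ⟨by linarith [ht.1], by linarith [ht.2]⟩, fun t ht => ?_⟩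
  have := (h.deriv (d + t) ⟨by linarith [ht.1], by linarith [ht.2]⟩).shift (a' := a) (b' := b)
    le_rfl le_rfl
  rwa [cap_add] at this

theorem cont (h : M.IsFull K₁ x a b) : ContinuousOn x (Icc a b) :=
  fun t ht => (h.deriv t ht).continuousWithinAt

theorem excess_deriv (hM : M.Assumptions) (h : M.IsFull K₁ x a b) {t : ℝ} (ht : t ∈ Icc a b) :
    HasDerivWithinAt (fun s => M.cap K₁ s - M.phi (x s))
      (M.γ * M.cap K₁ t + (M.phi (x t) - _root_.deriv M.F (x t)) * (M.cap K₁ t - M.phi (x t)))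
      (Icc a b) t := by
  have hx := (h.mem t ht).1
  have h1 := (hasDerivAt_cap (M := M) K₁ t).hasDerivWithinAt (s := Icc a b)
  have h2 := (hM.hasDerivAt_phi hx).comp_hasDerivWithinAt t (h.deriv t ht)
  refine (h1.sub h2).congr_deriv ?_
  rw [F_eq hx.ne']
  field_simp
  ring

/-- The excess e = cap − φ(x) satisfies e' − (φ − F') e = γ cap > 0, so it can cross zero only
upwards. -/
theorem excess_pos (hM : M.Assumptions) (hK : 0 < K₁) (h : M.IsFull K₁ x a b) {s t : ℝ}
    (hs : a ≤ s) (ha : M.phi (x s) ≤ M.cap K₁ s) (ht : t ∈ Ioc s b) :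
    M.phi (x t) < M.cap K₁ t := by
  have h' := h.mono hs (le_refl b)
  have hmaps : MapsTo x (Icc s b) (Ioi 0) := fun u hu => (h'.mem u hu).1
  have := lin_pos_of_strict (k := fun u => -(M.phi (x u) - _root_.deriv M.F (x u)))
    (((hM.continuousOn_phi.comp h'.cont hmaps).sub
      (hM.continuousOn_deriv.comp h'.cont hmaps)).neg)
    (fun u hu => h'.excess_deriv hM hu)
    (fun u hu => by
      have := mul_pos hM.γ_pos (cap_pos (M := M) hK u)
      linarith) (by linarith) ht
  linarith

theorem hasDerivAt (h : M.IsFull K₁ x a b) {t : ℝ} (ht : t ∈ Ioo a b) :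
    HasDerivAt x (x t * (M.cap K₁ t - M.phi (x t))) t := by
  refine ((h.deriv t (Ioo_subset_Icc_self ht)).hasDerivAt (Icc_mem_nhds ht.1 ht.2)).congr_deriv ?_
  rw [F_eq (h.mem t (Ioo_subset_Icc_self ht)).1.ne']; ring

theorem strictMonoOn (hM : M.Assumptions) (hK : 0 < K₁) (h : M.IsFull K₁ x a b)
    (ha : M.phi (x a) ≤ M.cap K₁ a) : StrictMonoOn x (Icc a b) := by
  refine strictMonoOn_of_deriv_pos (convex_Icc _ _) h.cont ?_
  rw [interior_Icc]
  intro t ht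
  rw [(h.hasDerivAt ht).deriv]
  exact mul_pos (h.mem t (Ioo_subset_Icc_self ht)).1
    (sub_pos.2 (h.excess_pos hM hK le_rfl ha ⟨ht.1, ht.2.le⟩))

theorem lt_of_ascending (hM : M.Assumptions) (hK : 0 < K₁) (h : M.IsFull K₁ x a b) {s t : ℝ}
    (hs : a ≤ s) (ha : M.phi (x s) ≤ M.cap K₁ s) (ht : t ∈ Ioc s b) : x s < x t :=
  (h.mono hs le_rfl).strictMonoOn hM hK ha ⟨le_rfl, ht.1.le.trans ht.2⟩ (Ioc_subset_Icc_self ht) ht.1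

theorem lt_of_descending (hM : M.Assumptions) (hK : 0 < K₁) (h : M.IsFull K₁ x a b) {s t : ℝ}
    (hs : s ≤ b) (ha : M.cap K₁ s ≤ M.phi (x s)) (ht : t ∈ Ico a s) : x s < x t := by
  have hanti : StrictAntiOn x (Icc a s) := by
    have h' := h.mono (le_refl a) hs
    refine strictAntiOn_of_deriv_neg (convex_Icc _ _) h'.cont ?_
    rw [interior_Icc]
    intro u hu
    rw [(h'.hasDerivAt hu).deriv]
    refine mul_neg_of_pos_of_neg (h'.mem u (Ioo_subset_Icc_self hu)).1 ?_
    by_contra hc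
    have := h'.excess_pos hM hK hu.1.le (by linarith) ⟨hu.2, le_rfl⟩
    linarith
  exact hanti (Ico_subset_Icc_self ht) ⟨ht.1.trans ht.2.le, le_rfl⟩ ht.2

theorem eqOn (hM : M.Assumptions) (hK : 0 ≤ K₁) {y : ℝ → ℝ} (h : M.IsFull K₁ x a b)
    (h' : M.IsFull K₁ y a b) (hxy : x a = y a) {t : ℝ} (ht : t ∈ Icc a b) : x t = y t := by
  obtain ⟨L, hL⟩ := hM.exists_lipschitz_F
  have hcap : ∀ u ∈ Icc a b, M.cap K₁ u ≤ M.cap K₁ b := fun u hu =>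
    mul_le_mul_of_nonneg_left (Real.exp_le_exp.2 (mul_le_mul_of_nonneg_left hu.2 hM.γ_pos.le)) hK
  have hsub : ∀ {v}, v ∈ Ioc 0 M.xbar → v ∈ Icc 0 M.xbar := fun hv => Ioc_subset_Icc_self hv
  -- Uniqueness by an energy estimate: −(x − y)² starts at 0 and, by the Lipschitz bound for F and
  -- the bound for the capital, satisfies w' + k w ≥ 0 with the constant k chosen here.
  have := lin_nonneg (w := fun u => -(x u - y u) ^ 2)
    (w' := fun u => -(2 * (x u - y u) * ((-M.F (x u) + M.cap K₁ u * x u) -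
      (-M.F (y u) + M.cap K₁ u * y u)))) (k := fun _ => -(2 * (L + M.cap K₁ b)))
    (a := a) (b := b) continuousOn_const
    (fun u hu => ((((h.deriv u hu).sub (h'.deriv u hu)).pow 2).neg).congr_deriv (by
      simp [mul_comm, mul_assoc]))
    (fun u hu => by
      have hu' := Ioo_subset_Icc_self hu
      have h1 := hL.dist_le_mul _ (hsub (h.mem u hu')) _ (hsub (h'.mem u hu'))
      rw [Real.dist_eq, Real.dist_eq] at h1
      have h2 : -((M.F (x u) - M.F (y u)) * (x u - y u)) ≤ L * (x u - y u) ^ 2 := by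
        calc -((M.F (x u) - M.F (y u)) * (x u - y u))
            ≤ |(M.F (x u) - M.F (y u)) * (x u - y u)| := neg_le_abs _
          _ = |M.F (x u) - M.F (y u)| * |x u - y u| := abs_mul _ _
          _ ≤ (L * |x u - y u|) * |x u - y u| := mul_le_mul_of_nonneg_right h1 (abs_nonneg _)
          _ = L * (x u - y u) ^ 2 := by rw [mul_assoc, ← abs_mul, ← sq, abs_of_nonneg (sq_nonneg _)]
      have h3 := mul_le_mul_of_nonneg_right (hcap u hu') (sq_nonneg (x u - y u))
      nlinarith) (by simp [hxy]) ht
  have h2 : (x t - y t) ^ 2 = 0 := le_antisymm (by linarith) (sq_nonneg _)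
  exact sub_eq_zero.1 (pow_eq_zero_iff (two_ne_zero) |>.1 h2)

end IsFull

namespace IsSwitch

variable {K₁ a b : ℝ} {x z : ℝ → ℝ}

theorem mono (h : M.IsSwitch x z a b) {a' b' : ℝ} (ha : a ≤ a') (hb : b' ≤ b) :
    M.IsSwitch x z a' b' :=
  ⟨fun t ht => h.mem t ⟨ha.trans ht.1, ht.2.trans hb⟩, h.cont.mono (Icc_subset_Icc ha hb),
    fun t ht => (h.deriv t ⟨ha.trans ht.1, ht.2.trans hb⟩).mono (Icc_subset_Icc ha hb)⟩

theorem shift {d : ℝ} (h : M.IsSwitch x z (d + a) (d + b)) :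
    M.IsSwitch (fun s => x (d + s)) (fun s => z (d + s)) a b := by
  refine ⟨fun t ht => h.mem _ ⟨by linarith [ht.1], by linarith [ht.2]⟩,
    h.cont.comp (by fun_prop) fun t ht => ⟨by linarith [ht.1], by linarith [ht.2]⟩,
    fun t ht => (h.deriv (d + t) ⟨by linarith [ht.1], by linarith [ht.2]⟩).shift le_rfl le_rfl⟩

theorem z_cont (h : M.IsSwitch x z a b) : ContinuousOn z (Icc a b) :=
  fun t ht => (h.deriv t ht).continuousWithinAt

theorem maps (h : M.IsSwitch x z a b) : MapsTo x (Icc a b) (Ioi 0) := fun u hu => (h.mem u hu).1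

theorem g_cont (hM : M.Assumptions) (h : M.IsSwitch x z a b) :
    ContinuousOn (fun t => M.g (x t)) (Icc a b) := hM.continuousOn_g.comp h.cont h.maps

theorem G_cont (hM : M.Assumptions) (h : M.IsSwitch x z a b) :
    ContinuousOn (fun t => M.G (x t) (z t)) (Icc a b) :=
  (hM.continuousOn_ψ.comp h.cont h.maps).sub (h.z_cont.mul (h.g_cont hM))

theorem ge (hM : M.Assumptions) (h : M.IsSwitch x z a b) {ζ t : ℝ}
    (hG : ∀ t ∈ Ioo a b, 0 ≤ M.G (x t) ζ) (ha : ζ ≤ z a) (ht : t ∈ Icc a b) : ζ ≤ z t := by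
  have := lin_nonneg (w := fun s => z s - ζ) (h.g_cont hM) (fun u hu => (h.deriv u hu).sub_const ζ)
    (fun u hu => by have := hG u hu; rw [G_sub _ _ ζ]; linarith) (by linarith) ht
  linarith

theorem gt (hM : M.Assumptions) (h : M.IsSwitch x z a b) {ζ t : ℝ}
    (hG : ∀ t ∈ Ioo a b, 0 ≤ M.G (x t) ζ) (ha : ζ < z a) (ht : t ∈ Icc a b) : ζ < z t := by
  have := lin_pos (w := fun s => z s - ζ) (h.g_cont hM) (fun u hu => (h.deriv u hu).sub_const ζ)
    (fun u hu => by have := hG u hu; rw [G_sub _ _ ζ]; linarith) (by linarith) ht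
  linarith

theorem gt_of_strict (hM : M.Assumptions) (h : M.IsSwitch x z a b) {ζ t : ℝ}
    (hG : ∀ t ∈ Ioo a b, 0 < M.G (x t) ζ) (ha : ζ ≤ z a) (ht : t ∈ Ioc a b) : ζ < z t := by
  have := lin_pos_of_strict (w := fun s => z s - ζ) (h.g_cont hM)
    (fun u hu => (h.deriv u hu).sub_const ζ)
    (fun u hu => by have := hG u hu; rw [G_sub _ _ ζ]; linarith) (by linarith) ht
  linarith

theorem le (hM : M.Assumptions) (h : M.IsSwitch x z a b) {ζ t : ℝ}
    (hG : ∀ t ∈ Ioo a b, M.G (x t) ζ ≤ 0) (ha : z a ≤ ζ) (ht : t ∈ Icc a b) : z t ≤ ζ := by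
  have := lin_nonneg (w := fun s => ζ - z s) (h.g_cont hM) (fun u hu => (h.deriv u hu).const_sub ζ)
    (fun u hu => by have := hG u hu; rw [G_sub _ _ ζ]; linarith) (by linarith) ht
  linarith

theorem lt (hM : M.Assumptions) (h : M.IsSwitch x z a b) {ζ t : ℝ}
    (hG : ∀ t ∈ Ioo a b, M.G (x t) ζ ≤ 0) (ha : z a < ζ) (ht : t ∈ Icc a b) : z t < ζ := by
  have := lin_pos (w := fun s => ζ - z s) (h.g_cont hM) (fun u hu => (h.deriv u hu).const_sub ζ)
    (fun u hu => by have := hG u hu; rw [G_sub _ _ ζ]; linarith) (by linarith) ht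
  linarith

theorem lt_of_strict (hM : M.Assumptions) (h : M.IsSwitch x z a b) {ζ t : ℝ}
    (hG : ∀ t ∈ Ioo a b, M.G (x t) ζ < 0) (ha : z a ≤ ζ) (ht : t ∈ Ioc a b) : z t < ζ := by
  have := lin_pos_of_strict (w := fun s => ζ - z s) (h.g_cont hM)
    (fun u hu => (h.deriv u hu).const_sub ζ)
    (fun u hu => by have := hG u hu; rw [G_sub _ _ ζ]; linarith) (by linarith) ht
  linarith

theorem G_zero (x : ℝ) : M.G x 0 = M.ψ x := by simp [G]

theorem G_r' (x : ℝ) : M.G x M.r' = M.ψstar x := by simp [G_eq_ψstar]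

/-- Along a trajectory with full effort, the shadow price of the stock remains positive. -/
theorem lt_profit (hM : M.Assumptions) (hK : 0 < K₁) (hf : M.IsFull K₁ x a b)
    (h : M.IsSwitch x z a b) (ha : z a < M.p * x a - M.c) {t : ℝ} (ht : t ∈ Icc a b) :
    z t < M.p * x t - M.c := by
  -- The margin w = p x − c − z satisfies w' + g w = p x cap > 0.
  have := lin_pos (w := fun s => M.p * x s - M.c - z s) (h.g_cont hM)
    (fun u hu => (((hf.deriv u hu).const_mul M.p).sub_const M.c).sub (h.deriv u hu))
    (fun u hu => by
      have hx := (h.mem u (Ioo_subset_Icc_self hu)).1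
      have h1 := mul_pos hM.p_pos (mul_pos (cap_pos (M := M) hK u) hx)
      rw [G_eq, g_eq, F_eq hx.ne']
      nlinarith) (by linarith) ht
  linarith

/-- While the stock has been decreasing, `z` is decreasing. -/
theorem G_neg_of_descending (hM : M.Assumptions) (hK : 0 < K₁) (hf : M.IsFull K₁ x a b)
    (h : M.IsSwitch x z a b) (hab : a < b) (hd : M.cap K₁ b ≤ M.phi (x b)) (hz : 0 ≤ z b)
    (hzp : z b ≤ M.p * x b - M.c) (hza : z b ≤ z a) : M.G (x b) (z b) < 0 := by
  -- If G(x b, z b) ≥ 0, then G(x t, z b) > 0 at the earlier, larger stocks, and the constant z b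
  -- would be a strict lower barrier for z at its own end point.
  by_contra hc
  refine absurd (h.gt_of_strict hM (fun t ht => ?_) hza (t := b) ⟨hab, le_rfl⟩) (lt_irrefl _)
  exact (not_lt.1 hc).trans_lt (hM.G_lt (h.mem b ⟨hab.le, le_rfl⟩).1
    (hf.lt_of_descending hM hK le_rfl hd ⟨ht.1.le, ht.2⟩) (h.mem t (Ioo_subset_Icc_self ht)).2 hz hzp)

theorem lt_r' (hM : M.Assumptions) (h : M.IsSwitch x z a b) (hab : a < b) (ha : z a ≤ M.r')
    (hx : ∀ t ∈ Ioo a b, x t < M.xstar) : z b < M.r' := by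
  refine h.lt_of_strict hM (fun t ht => ?_) ha ⟨hab, le_rfl⟩
  rw [G_r']
  exact hM.ψstar_neg _ ⟨(h.mem t (Ioo_subset_Icc_self ht)).1, hx t ht⟩

theorem le_r' (hM : M.Assumptions) (h : M.IsSwitch x z a b) (ha : z a ≤ M.r')
    (hx : ∀ t ∈ Ioo a b, x t ≤ M.xstar) {t : ℝ} (ht : t ∈ Icc a b) : z t ≤ M.r' := by
  refine h.le hM (fun t ht => ?_) ha ht
  rw [G_r']
  exact hM.ψstar_nonpos_of_le (h.mem t (Ioo_subset_Icc_self ht)).1 (hx t ht)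

/-- Once `z` is nondecreasing on an ascending trajectory, it remains so. -/
theorem G_nonneg (hM : M.Assumptions) (h : M.IsSwitch x z a b) (hx : StrictMonoOn x (Icc a b))
    (hz : ∀ t ∈ Icc a b, 0 ≤ z t) (hzp : ∀ t ∈ Icc a b, z t ≤ M.p * x t - M.c)
    (ha : 0 ≤ M.G (x a) (z a)) {t : ℝ} (ht : t ∈ Icc a b) : 0 ≤ M.G (x t) (z t) := by
  -- After the last zero m of G before t, z is nonincreasing; but x > x m makes the constant z m a
  -- strict lower barrier, so that z t > z m.
  by_contra hc
  obtain ⟨m, h1, h2, h3⟩ := exists_last_zero (f := fun s => - M.G (x s) (z s))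
    ((h.G_cont hM).neg.mono (Icc_subset_Icc_right ht.2)) (by linarith) ht.1 (by linarith)
  have hm : m ∈ Icc a b := ⟨h1.1, h1.2.le.trans ht.2⟩
  have h4 := (h.mono h1.1 ht.2).gt_of_strict hM (ζ := z m) (t := t) (fun s hs => by
    have := hM.G_lt (h.mem m hm).1 (hx hm ⟨hm.1.trans hs.1.le, hs.2.le.trans ht.2⟩ hs.1)
      (h.mem s ⟨hm.1.trans hs.1.le, hs.2.le.trans ht.2⟩).2 (hz m hm) (hzp m hm)
    linarith) le_rfl ⟨h1.2, le_rfl⟩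
  have h5 : AntitoneOn z (Icc m t) := by
    refine antitoneOn_of_deriv_nonpos (convex_Icc _ _)
      (h.z_cont.mono (Icc_subset_Icc h1.1 ht.2)) ?_ ?_ <;> rw [interior_Icc] <;> intro s hs
    all_goals
      have hd := ((h.mono h1.1 ht.2).deriv s (Ioo_subset_Icc_self hs)).hasDerivAt
        (Icc_mem_nhds hs.1 hs.2)
    · exact hd.differentiableAt.differentiableWithinAt
    · rw [hd.deriv]
      linarith [h3 s ⟨hs.1, hs.2.le⟩]
  linarith [h5 ⟨le_rfl, h1.2.le⟩ ⟨h1.2.le, le_rfl⟩ h1.2.le]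

end IsSwitch

/-- With w = z₂ − z₁ one finds w' + g(x₂) w = G(x₂, z₁) − G(x₁, z₁), which is positive by `G_lt`.
The bounds are therefore needed for z₁ only. -/
theorem switch_compare (hM : M.Assumptions) {x₁ z₁ x₂ z₂ : ℝ → ℝ} {a b : ℝ}
    (h1 : M.IsSwitch x₁ z₁ a b) (h2 : M.IsSwitch x₂ z₂ a b)
    (hx : ∀ t ∈ Icc a b, x₁ t < x₂ t) (hz : ∀ t ∈ Icc a b, 0 ≤ z₁ t)
    (hzp : ∀ t ∈ Icc a b, z₁ t ≤ M.p * x₁ t - M.c) (ha : z₁ a < z₂ a) {t : ℝ}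
    (ht : t ∈ Icc a b) : z₁ t < z₂ t := by
  have := lin_pos (w := fun s => z₂ s - z₁ s) (h2.g_cont hM)
    (fun u hu => (h2.deriv u hu).sub (h1.deriv u hu))
    (fun u hu => by
      have hu' := Ioo_subset_Icc_self hu
      have := hM.G_lt (h1.mem u hu').1 (hx u hu') (h2.mem u hu').2 (hz u hu') (hzp u hu')
      rw [G_sub (x₂ u) (z₂ u) (z₁ u)]
      linarith) (by linarith) ht
  linarith

theorem IsSwitch.eqOn (hM : M.Assumptions) {x₁ z₁ x₂ z₂ : ℝ → ℝ} {a b : ℝ}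
    (h1 : M.IsSwitch x₁ z₁ a b) (h2 : M.IsSwitch x₂ z₂ a b)
    (hx : ∀ t ∈ Icc a b, x₁ t = x₂ t) (ha : z₁ a = z₂ a) {t : ℝ}
    (ht : t ∈ Icc a b) : z₁ t = z₂ t := by
  have := lin_zero (w := fun s => z₂ s - z₁ s) (h2.g_cont hM)
    (fun u hu => (h2.deriv u hu).sub (h1.deriv u hu))
    (fun u hu => by
      rw [hx u (Ioo_subset_Icc_self hu), G_sub (x₂ u) (z₂ u) (z₁ u)]
      ring) (by linarith) ht
  linarith

end Fishery

namespace Fishery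
variable {M : Fishery}

/-- The stock has no interior maximum: from an interior point it either ascends up to the right end
or has descended from the left one. -/
theorem IsFull.lt_of_le_of_le (hM : M.Assumptions) {K₁ a b : ℝ} {x : ℝ → ℝ} (hK : 0 < K₁)
    (h : M.IsFull K₁ x a b) {t y : ℝ} (ht : t ∈ Ioo a b) (ha : x a ≤ y) (hb : x b ≤ y) :
    x t < y := by
  rcases le_total (M.phi (x t)) (M.cap K₁ t) with h1 | h1
  · exact (h.lt_of_ascending hM hK ht.1.le h1 ⟨ht.2, le_rfl⟩).trans_le hb
  · exact (h.lt_of_descending hM hK ht.2.le h1 ⟨le_rfl, ht.1⟩).trans_le ha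

theorem IsFull.le_of_le_of_le (hM : M.Assumptions) {K₁ a b : ℝ} {x : ℝ → ℝ} (hK : 0 < K₁)
    (h : M.IsFull K₁ x a b) {t y : ℝ} (ht : t ∈ Icc a b) (ha : x a ≤ y) (hb : x b ≤ y) :
    x t ≤ y := by
  rcases ht.1.eq_or_lt with h1 | h1
  · rwa [← h1]
  rcases ht.2.eq_or_lt with h2 | h2
  · rwa [h2]
  exact (h.lt_of_le_of_le hM hK ⟨h1, h2⟩ ha hb).le

/-- At a zero of `z` on the line `x = xtil`, the stock is ascending. -/
theorem IsFull.phi_xtil_le_cap (hM : M.Assumptions) {K₁ σ : ℝ} {x z : ℝ → ℝ} (hK : 0 < K₁)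
    (h : M.IsFull K₁ x 0 σ) (hs : M.IsSwitch x z 0 σ) (hσ : 0 < σ) (h0 : 0 ≤ z 0)
    (hz : z σ = 0) (hx : x σ = M.xtil) :
    M.phi M.xtil ≤ M.cap K₁ σ := by
  -- On the descending part G < 0, whereas G(xtil, 0) = ψ(xtil) = 0.
  by_contra hc
  have := hs.G_neg_of_descending hM hK h hσ (by rw [hx]; exact (not_le.1 hc).le) hz.ge
    (by rw [hz, hx]; linarith [hM.c_lt])
    (by rw [hz]; exact h0)
  rw [hz, hx, IsSwitch.G_zero, hM.ψ_xtil] at this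
  exact lt_irrefl _ this

/-! ### The backward trajectories ending on `Σ^*` -/

namespace IsBackward

variable {K₁ T : ℝ} {x z l : ℝ → ℝ}

theorem isFull (h : M.IsBackward K₁ T x z l) : M.IsFull K₁ x 0 T := ⟨h.x_mem, h.x_deriv⟩

theorem isSwitch (h : M.IsBackward K₁ T x z l) : M.IsSwitch x z 0 T :=
  ⟨h.x_mem, h.isFull.cont, fun t ht => (h.z_deriv t ht).congr_deriv (by rw [G_eq_ψstar]; ring)⟩

theorem l_deriv' (h : M.IsBackward K₁ T x z l) {t : ℝ} (ht : t ∈ Icc 0 T) :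
    HasDerivWithinAt l (z t - M.κ * l t) (Icc 0 T) t :=
  (h.l_deriv t ht).congr_deriv (by rw [r']; ring)

theorem mono (h : M.IsBackward K₁ T x z l) {T' : ℝ} (hT : T' ≤ T) : M.IsBackward K₁ T' x z l :=
  ⟨h.x_zero, h.z_zero, h.l_zero, fun t ht => h.x_mem t ⟨ht.1, ht.2.trans hT⟩,
    fun t ht => (h.x_deriv t ⟨ht.1, ht.2.trans hT⟩).mono (Icc_subset_Icc_right hT),
    fun t ht => (h.z_deriv t ⟨ht.1, ht.2.trans hT⟩).mono (Icc_subset_Icc_right hT),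
    fun t ht => (h.l_deriv t ⟨ht.1, ht.2.trans hT⟩).mono (Icc_subset_Icc_right hT)⟩

theorem zero_lt_profit (hM : M.Assumptions) (h : M.IsBackward K₁ T x z l) :
    z 0 < M.p * x 0 - M.c := by
  rw [h.z_zero, h.x_zero]
  have := hM.cstar_lt
  rw [cstar] at this
  linarith

theorem lt_profit (hM : M.Assumptions) (hK : 0 < K₁) (h : M.IsBackward K₁ T x z l) {t : ℝ}
    (ht : t ∈ Icc 0 T) : z t < M.p * x t - M.c :=
  h.isSwitch.lt_profit hM hK h.isFull (h.zero_lt_profit hM) ht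

theorem lt_xstar (hM : M.Assumptions) (hK : 0 < K₁) (h : M.IsBackward K₁ T x z l) {s t : ℝ}
    (hs : s ∈ Ioo 0 t) (ht : t ≤ T) (hx : x t ≤ M.xstar) : x s < M.xstar :=
  (h.isFull.mono le_rfl ht).lt_of_le_of_le hM hK hs h.x_zero.le hx

/-- On its descending part the stock lies below its starting value x^*. -/
theorem phi_le_cap (hM : M.Assumptions) (hK : 0 < K₁) (h : M.IsBackward K₁ T x z l) {t : ℝ}
    (ht : t ∈ Ioc 0 T) (hx : M.xstar ≤ x t) : M.phi (x t) ≤ M.cap K₁ t := by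
  by_contra hc
  have := h.isFull.lt_of_descending hM hK ht.2 (not_le.1 hc).le (t := 0) ⟨le_rfl, ht.1⟩
  rw [h.x_zero] at this
  exact absurd hx (not_le.2 this)

theorem lt_of_xstar_lt (hM : M.Assumptions) (hK : 0 < K₁) (h : M.IsBackward K₁ T x z l) {s t : ℝ}
    (hs : s ∈ Ico 0 t) (ht : t ≤ T) (hx : M.xstar < x t) : x s < x t := by
  rcases hs.1.eq_or_lt with h0 | h0
  · rw [← h0, h.x_zero]; exact hx
  rcases le_total (M.phi (x s)) (M.cap K₁ s) with h1 | h1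
  · exact h.isFull.lt_of_ascending hM hK hs.1 h1 ⟨hs.2, ht⟩
  · have := h.isFull.lt_of_descending hM hK (hs.2.le.trans ht) h1 (t := 0) ⟨le_rfl, h0⟩
    rw [h.x_zero] at this
    exact this.trans hx

theorem eqOn (hM : M.Assumptions) (hK : 0 < K₁) {T' : ℝ} {x' z' l' : ℝ → ℝ}
    (h : M.IsBackward K₁ T x z l) (h' : M.IsBackward K₁ T' x' z' l') {t : ℝ} (h0 : 0 ≤ t)
    (ht : t ≤ T) (ht' : t ≤ T') : x t = x' t ∧ z t = z' t := by
  have hx : ∀ s ∈ Icc 0 t, x s = x' s := fun s hs =>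
    (h.mono ht).isFull.eqOn hM hK.le (h'.mono ht').isFull (by rw [h.x_zero, h'.x_zero]) hs
  exact ⟨hx t ⟨h0, le_rfl⟩, (h.mono ht).isSwitch.eqOn hM (h'.mono ht').isSwitch hx
    (by rw [h.z_zero, h'.z_zero]) ⟨h0, le_rfl⟩⟩

end IsBackward

/-! ### Structure of the trajectories satisfying the maximum principle -/

/-- A trajectory, backwards in time, along which no investment occurs and the effort is determined
by the sign of `z`. -/
structure IsExtremal (M : Fishery) (K₁ T : ℝ) (x z l : ℝ → ℝ) : Prop where
  K_pos : 0 < K₁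
  T_pos : 0 < T
  isSwitch : M.IsSwitch x z 0 T
  l_deriv : ∀ t ∈ Icc 0 T, HasDerivWithinAt l (max (z t) 0 - M.κ * l t) (Icc 0 T) t
  full : ∀ a b, 0 ≤ a → b ≤ T → (∀ t ∈ Ioo a b, 0 < z t) → M.IsFull K₁ x a b
  idle : ∀ a b, 0 ≤ a → b ≤ T → (∀ t ∈ Ioo a b, z t < 0) →
    ∀ t ∈ Icc a b, HasDerivWithinAt x (-M.F (x t)) (Icc a b) t
  x_zero : x 0 ≤ M.xstar
  z_zero : z 0 = M.r'
  l_zero : l 0 = M.r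

theorem idle_strictAntiOn (hM : M.Assumptions) {x : ℝ → ℝ} {a b : ℝ}
    (hx : ∀ t ∈ Icc a b, x t ∈ Ioc 0 M.xbar)
    (h : ∀ t ∈ Icc a b, HasDerivWithinAt x (-M.F (x t)) (Icc a b) t) (ha : x a < M.xbar) :
    StrictAntiOn x (Icc a b) := by
  have hc : ContinuousOn x (Icc a b) := fun t ht => (h t ht).continuousWithinAt
  have hd : ∀ t ∈ Ioo a b, HasDerivAt x (-M.F (x t)) t := fun t ht =>
    (h t (Ioo_subset_Icc_self ht)).hasDerivAt (Icc_mem_nhds ht.1 ht.2)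
  have hF : ∀ t ∈ Ioo a b, 0 ≤ M.F (x t) := fun t ht => by
    have := hx t (Ioo_subset_Icc_self ht)
    rw [F_eq this.1.ne']
    exact mul_nonneg this.1.le (hM.phi_nonneg this)
  have hanti : AntitoneOn x (Icc a b) := by
    refine antitoneOn_of_deriv_nonpos (convex_Icc _ _) hc ?_ ?_ <;> rw [interior_Icc]
    · exact fun t ht => (hd t ht).differentiableAt.differentiableWithinAt
    · exact fun t ht => by rw [(hd t ht).deriv]; linarith [hF t ht]
  refine strictAntiOn_of_deriv_neg (convex_Icc _ _) hc ?_
  rw [interior_Icc]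
  intro t ht
  rw [(hd t ht).deriv, neg_lt_zero]
  have ht' := Ioo_subset_Icc_self ht
  exact hM.F_pos _ ⟨(hx t ht').1,
    (hanti ⟨le_rfl, ht'.1.trans ht'.2⟩ ht' ht'.1).trans_lt ha⟩

namespace IsExtremal

variable {K₁ T : ℝ} {x z l : ℝ → ℝ}

/-- While z < 0 no effort is exerted and the stock falls backwards in time; it stays in the range ψ
≤ 0, where z cannot return to zero. -/
theorem neg_of_neg (hM : M.Assumptions) (h : M.IsExtremal K₁ T x z l) {s b : ℝ} (hs : 0 ≤ s)
    (hsb : s < b) (hx : x s ≤ M.xtil) (hz : ∀ t ∈ Ioc s b, z t < 0) :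
    ∀ t ∈ Ioc s T, z t < 0 := by
  intro t ht
  by_contra hc
  have hbt : b ≤ t := by
    by_contra hbt
    exact hc (hz t ⟨ht.1, (not_le.1 hbt).le⟩)
  obtain ⟨σ, h1, h2, h3⟩ := exists_first_zero (f := fun u => - z u)
    ((h.isSwitch.z_cont.neg).mono (Icc_subset_Icc (hs.trans hsb.le) ht.2))
    (by linarith [hz b ⟨hsb, le_rfl⟩]) hbt (by linarith [not_lt.1 hc])
  have hneg : ∀ u ∈ Ioo s σ, z u < 0 := fun u hu => by
    rcases le_total u b with hub | hub
    · exact hz u ⟨hu.1, hub⟩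
    · linarith [h3 u ⟨hub, hu.2⟩]
  have hσ : σ ≤ T := h1.2.trans ht.2
  have hsσ := hsb.trans h1.1
  have hanti := idle_strictAntiOn hM
    (fun u hu => h.isSwitch.mem u ⟨hs.trans hu.1, hu.2.trans hσ⟩) (h.idle s σ hs hσ hneg)
    (hx.trans_lt hM.xtil_mem.2)
  have := (h.isSwitch.mono (hs.trans hsb.le) hσ).lt hM (ζ := 0) (t := σ) (fun u hu => by
    rw [IsSwitch.G_zero]
    refine hM.ψ_nonpos_of_le (h.isSwitch.mem u ⟨by linarith [hu.1], hu.2.le.trans hσ⟩).1 ?_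
    exact (hanti ⟨le_rfl, hsσ.le⟩ ⟨(hsb.trans hu.1).le, hu.2.le⟩ (hsb.trans hu.1)).le.trans hx)
    (hz b ⟨hsb, le_rfl⟩) ⟨h1.1.le, le_rfl⟩
  linarith

/-- While z > 0 there is full effort and the ascending stock stays in the range ψ ≥ 0, where z
cannot return to zero. -/
theorem pos_of_pos (hM : M.Assumptions) (h : M.IsExtremal K₁ T x z l) {s b : ℝ} (hs : 0 ≤ s)
    (hsb : s < b) (hx : M.xtil ≤ x s) (hc : M.phi (x s) ≤ M.cap K₁ s)
    (hz : ∀ t ∈ Ioc s b, 0 < z t) : ∀ t ∈ Ioc s T, 0 < z t := by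
  intro t ht
  by_contra hc'
  have hbt : b ≤ t := by
    by_contra hbt
    exact hc' (hz t ⟨ht.1, (not_le.1 hbt).le⟩)
  obtain ⟨σ, h1, h2, h3⟩ := exists_first_zero
    (h.isSwitch.z_cont.mono (Icc_subset_Icc (hs.trans hsb.le) ht.2))
    (hz b ⟨hsb, le_rfl⟩) hbt (not_lt.1 hc')
  have hneg : ∀ u ∈ Ioo s σ, 0 < z u := fun u hu => by
    rcases le_total u b with hub | hub
    · exact hz u ⟨hu.1, hub⟩
    · exact h3 u ⟨hub, hu.2⟩
  have hσ : σ ≤ T := h1.2.trans ht.2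
  have hf := h.full s σ hs hσ hneg
  have := (h.isSwitch.mono (hs.trans hsb.le) hσ).gt hM (ζ := 0) (t := σ) (fun u hu => by
    rw [IsSwitch.G_zero]
    refine hM.ψ_nonneg_of_le ?_ (h.isSwitch.mem u ⟨by linarith [hu.1], hu.2.le.trans hσ⟩).2
    exact hx.trans (hf.lt_of_ascending hM h.K_pos le_rfl hc ⟨hsb.trans hu.1, hu.2.le⟩).le)
    (hz b ⟨hsb, le_rfl⟩) ⟨h1.1.le, le_rfl⟩
  linarith

/-- After a zero of `z`, the switch variable keeps its sign once it is different from zero. -/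
theorem sign_after_zero (hM : M.Assumptions) (h : M.IsExtremal K₁ T x z l) {σ s : ℝ}
    (hσ : 0 ≤ σ) (hzσ : z σ = 0) (hcap : M.phi M.xtil ≤ M.cap K₁ σ) (hs : s ∈ Ioc σ T)
    (hzs : z s ≠ 0) :
    ∃ a ∈ Ico σ s, z a = 0 ∧ ((∀ t ∈ Ioc a T, z t < 0) ∨ (∀ t ∈ Ioc a T, 0 < z t)) := by
  have hcont := h.isSwitch.z_cont.mono (Icc_subset_Icc hσ hs.2)
  have hd : ∀ a ∈ Ico σ s, HasDerivWithinAt z (M.G (x a) (z a)) (Icc a s) a := fun a ha =>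
    ((h.isSwitch.mono (hσ.trans ha.1) hs.2).deriv a ⟨le_rfl, ha.2.le⟩)
  rcases hzs.lt_or_gt with hlt | hgt
  · obtain ⟨a, h1, h2, h3⟩ := exists_last_zero (f := fun u => - z u) hcont.neg
      (by linarith) hs.1.le (by linarith)
    have h2 : z a = 0 := by linarith
    have hneg : ∀ t ∈ Ioc a s, z t < 0 := fun t ht => by linarith [h3 t ht]
    have hG := nonpos_of_hasDerivWithinAt_right h1.2 (hd a h1)
      fun t ht => by rw [h2]; exact (hneg t ⟨ht.1, ht.2.le⟩).le
    rw [h2, IsSwitch.G_zero] at hG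
    have ha : a ∈ Icc 0 T := ⟨hσ.trans h1.1, h1.2.le.trans hs.2⟩
    exact ⟨a, h1, h2, .inl (h.neg_of_neg hM ha.1 h1.2
      (hM.le_xtil_of_ψ_nonpos (h.isSwitch.mem a ha).2 hG) hneg)⟩
  · obtain ⟨a, h1, h2, h3⟩ := exists_last_zero hcont hgt hs.1.le hzσ.le
    have hG := nonneg_of_hasDerivWithinAt_right h1.2 (hd a h1)
      fun t ht => by rw [h2]; exact (h3 t ⟨ht.1, ht.2.le⟩).le
    rw [h2, IsSwitch.G_zero] at hG
    have ha : a ∈ Icc 0 T := ⟨hσ.trans h1.1, h1.2.le.trans hs.2⟩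
    have hx := hM.xtil_le_of_ψ_nonneg (h.isSwitch.mem a ha).1 hG
    -- The stock is ascending at a, because φ(x a) ≤ φ(xtil) ≤ cap σ ≤ cap a.
    refine ⟨a, h1, h2, .inr (h.pos_of_pos hM ha.1 h1.2 hx ?_ h3)⟩
    exact (hM.phi_le hM.xtil_mem.1 hx (h.isSwitch.mem a ha).2).trans
      (hcap.trans (hM.cap_le h.K_pos h1.1))

/-- The behaviour after the first zero `σ` of `z`. -/
def AfterZero (M : Fishery) (K₁ T : ℝ) (x z : ℝ → ℝ) (σ : ℝ) : Prop :=
  (x σ < M.xtil ∧ ∀ t ∈ Ioc σ T, z t < 0) ∨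
  (x σ = M.xtil ∧ M.phi M.xtil ≤ M.cap K₁ σ ∧ ∃ σ₂ ∈ Icc σ T,
    (∀ t ∈ Icc σ σ₂, x t = M.xtil ∧ z t = 0) ∧
    ((∀ t ∈ Ioc σ₂ T, z t < 0) ∨ (∀ t ∈ Ioc σ₂ T, 0 < z t)))

/-- Where z vanishes identically so does its derivative ψ(x), and xtil is the only zero of ψ. -/
theorem x_eq_xtil (hM : M.Assumptions) (h : M.IsExtremal K₁ T x z l) {a b : ℝ} (ha : 0 ≤ a)
    (hb : b ≤ T) (hab : a < b) (hz : ∀ t ∈ Icc a b, z t = 0) {t : ℝ} (ht : t ∈ Icc a b) :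
    x t = M.xtil := by
  have hd := (h.isSwitch.mono ha hb).deriv t ht
  have hu : UniqueDiffWithinAt ℝ (Icc a b) t := uniqueDiffOn_Icc hab t ht
  have h1 : HasDerivWithinAt z 0 (Icc a b) t :=
    (hasDerivWithinAt_const t (Icc a b) (0 : ℝ)).congr hz (hz t ht)
  have h2 := (hd.derivWithin hu).symm.trans (h1.derivWithin hu)
  rw [hz t ht, IsSwitch.G_zero] at h2
  have hm := h.isSwitch.mem t ⟨ha.trans ht.1, ht.2.trans hb⟩
  exact le_antisymm (hM.le_xtil_of_ψ_nonpos hm.2 h2.le) (hM.xtil_le_of_ψ_nonneg hm.1 h2.ge)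

theorem cases (hM : M.Assumptions) (h : M.IsExtremal K₁ T x z l) :
    (∀ t ∈ Icc 0 T, 0 < z t) ∨ ∃ σ ∈ Ioc 0 T, z σ = 0 ∧ (∀ t ∈ Ico 0 σ, 0 < z t) ∧
      AfterZero M K₁ T x z σ := by
  by_cases hB : ∀ t ∈ Icc 0 T, 0 < z t
  · exact .inl hB
  right
  push Not at hB
  obtain ⟨t₀, ht₀, hz₀⟩ := hB
  have h0 : 0 < z 0 := by rw [h.z_zero]; exact hM.r'_pos
  obtain ⟨σ, h1, h2, h3⟩ := exists_first_zero
    (h.isSwitch.z_cont.mono (Icc_subset_Icc_right ht₀.2)) h0 ht₀.1 hz₀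
  have hσ : σ ∈ Ioc 0 T := ⟨h1.1, h1.2.trans ht₀.2⟩
  refine ⟨σ, hσ, h2, h3, ?_⟩
  have hmem := h.isSwitch.mem σ ⟨hσ.1.le, hσ.2⟩
  -- z comes down to zero, so its derivative ψ(x σ) is nonpositive there and x σ ≤ xtil.
  have hG := nonpos_of_hasDerivWithinAt_left hσ.1
    ((h.isSwitch.mono le_rfl hσ.2).deriv σ ⟨hσ.1.le, le_rfl⟩)
    fun t ht => by rw [h2]; exact (h3 t ⟨ht.1.le, ht.2⟩).le
  rw [h2, IsSwitch.G_zero] at hG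
  rcases (hM.le_xtil_of_ψ_nonpos hmem.2 hG).lt_or_eq with hx | hx
  · refine .inl ⟨hx, ?_⟩
    rcases hσ.2.eq_or_lt with hT | hT
    · intro t ht; rw [hT] at ht; exact absurd ht.1 (not_lt.2 ht.2)
    have hc := h.isSwitch.cont σ ⟨hσ.1.le, hσ.2⟩
    have hev : ∀ᶠ t in 𝓝[Icc σ T] σ, x t < M.xtil :=
      (hc.mono (Icc_subset_Icc_left hσ.1.le)).eventually (Iio_mem_nhds hx)
    rw [nhdsWithin_Icc_eq_nhdsGE hT] at hev
    obtain ⟨b, hb, hb'⟩ := mem_nhdsGE_iff_exists_Icc_subset.1 hev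
    have hbT : min b T ≤ T := min_le_right _ _
    have hσb : σ < min b T := lt_min hb hT
    refine h.neg_of_neg hM hσ.1.le hσb hx.le fun t ht => ?_
    refine (h.isSwitch.mono hσ.1.le hbT).lt_of_strict hM (fun u hu => ?_) h2.le ht
    rw [IsSwitch.G_zero]
    exact hM.ψ_neg_of_lt (h.isSwitch.mem u ⟨hσ.1.le.trans hu.1.le, hu.2.le.trans hbT⟩).1
      (hb' ⟨hu.1.le, hu.2.le.trans (min_le_left _ _)⟩)
  · have hcap := (h.full 0 σ le_rfl hσ.2 fun t ht => h3 t ⟨ht.1.le, ht.2⟩).phi_xtil_le_cap hM h.K_pos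
      (h.isSwitch.mono le_rfl hσ.2) hσ.1 h0.le h2 hx
    refine .inr ⟨hx, hcap, ?_⟩
    by_cases hall : ∀ s ∈ Ioc σ T, z s = 0
    · refine ⟨T, ⟨hσ.2, le_rfl⟩, fun t ht => ?_, .inl fun t ht => absurd ht.1 (not_lt.2 ht.2)⟩
      rcases ht.1.eq_or_lt with h4 | h4
      · rw [← h4]; exact ⟨hx, h2⟩
      · refine ⟨h.x_eq_xtil hM hσ.1.le le_rfl (h4.trans_le ht.2) (fun s hs => ?_) ht,
          hall t ⟨h4, ht.2⟩⟩
        rcases hs.1.eq_or_lt with h5 | h5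
        · rw [← h5, h2]
        · exact hall s ⟨h5, hs.2⟩
    · push Not at hall
      obtain ⟨s, hs, hzs⟩ := hall
      obtain ⟨a, ha, hza, hsgn⟩ := h.sign_after_zero hM hσ.1.le h2 hcap hs hzs
      have haT : a ≤ T := ha.2.le.trans hs.2
      refine ⟨a, ⟨ha.1, haT⟩, ?_, hsgn⟩
      -- A nonzero value between σ and a would fix the sign of z from some earlier zero on, in
      -- particular at a, where z vanishes.
      have hz : ∀ t ∈ Icc σ a, z t = 0 := by
        intro t ht
        rcases ht.1.eq_or_lt with h4 | h4
        · rw [← h4, h2]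
        rcases ht.2.eq_or_lt with h5 | h5
        · rw [h5, hza]
        by_contra hzt
        obtain ⟨a', ha', -, hsgn'⟩ := h.sign_after_zero hM hσ.1.le h2 hcap
          ⟨h4, ht.2.trans haT⟩ hzt
        have ha2 : a ∈ Ioc a' T := ⟨ha'.2.trans h5, haT⟩
        rcases hsgn' with h6 | h6
        · linarith [h6 a ha2]
        · linarith [h6 a ha2]
      intro t ht
      refine ⟨?_, hz t ht⟩
      rcases ha.1.eq_or_lt with h4 | h4
      · rw [← h4] at ht
        rw [le_antisymm ht.2 ht.1, hx]
      · exact h.x_eq_xtil hM hσ.1.le haT h4 hz ht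

end IsExtremal
end Fishery

namespace Fishery
variable {M : Fishery}

/-! ### Comparison of trajectories at equal capital -/

/-- The average growth rate, extended by zero to the right of `xbar`. -/
def phihat (M : Fishery) (x : ℝ) : ℝ := M.phi (min x M.xbar)

theorem phihat_eq {x : ℝ} (hx : x ≤ M.xbar) : M.phihat x = M.phi x := by
  rw [phihat, min_eq_left hx]

theorem Assumptions.continuousOn_phihat (hM : M.Assumptions) : ContinuousOn M.phihat (Ioi 0) :=
  hM.continuousOn_phi.comp (by fun_prop) fun _ hx => lt_min hx hM.xbar_pos

theorem Assumptions.phihat_anti (hM : M.Assumptions) {x y : ℝ} (hx : 0 < x) (hxy : x ≤ y) :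
    M.phihat y ≤ M.phihat x :=
  hM.phi_le (lt_min hx hM.xbar_pos) (min_le_min_right _ hxy) (min_le_right _ _)

/-- The stock grows, backwards in time, at most as fast as with full effort. -/
structure IsSub (M : Fishery) (K₁ : ℝ) (x : ℝ → ℝ) (a b : ℝ) : Prop where
  pos : ∀ t ∈ Icc a b, 0 < x t
  cont : ContinuousOn x (Icc a b)
  le : ∀ s t, a ≤ s → s ≤ t → t ≤ b →
    Real.log (x t) - Real.log (x s) ≤ ∫ u in s..t, (M.cap K₁ u - M.phihat (x u))

/-- The stock grows, backwards in time, at least as fast as with full effort. -/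
structure IsSuper (M : Fishery) (K₁ : ℝ) (x : ℝ → ℝ) (a b : ℝ) : Prop where
  pos : ∀ t ∈ Icc a b, 0 < x t
  cont : ContinuousOn x (Icc a b)
  ge : ∀ s t, a ≤ s → s ≤ t → t ≤ b →
    (∫ u in s..t, (M.cap K₁ u - M.phihat (x u))) ≤ Real.log (x t) - Real.log (x s)

theorem Assumptions.continuousOn_excess (hM : M.Assumptions) {K₁ a b : ℝ} {x : ℝ → ℝ}
    (hp : ∀ t ∈ Icc a b, 0 < x t) (hc : ContinuousOn x (Icc a b)) :
    ContinuousOn (fun u => M.cap K₁ u - M.phihat (x u)) (Icc a b) :=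
  (continuous_cap K₁).continuousOn.sub (hM.continuousOn_phihat.comp hc hp)

theorem isSub_of_deriv_le (hM : M.Assumptions) {K₁ a b : ℝ} {x x' : ℝ → ℝ}
    (hm : ∀ t ∈ Icc a b, x t ∈ Ioc 0 M.xbar)
    (hd : ∀ t ∈ Icc a b, HasDerivWithinAt x (x' t) (Icc a b) t)
    (hle : ∀ t ∈ Icc a b, x' t ≤ x t * (M.cap K₁ t - M.phi (x t))) : M.IsSub K₁ x a b := by
  have hc : ContinuousOn x (Icc a b) := fun t ht => (hd t ht).continuousWithinAt
  refine ⟨fun t ht => (hm t ht).1, hc, fun s t hs hst ht => ?_⟩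
  have hsub : Icc s t ⊆ Icc a b := Icc_subset_Icc hs ht
  refine intervalIntegral.sub_le_integral_of_hasDeriv_right_of_le hst
    (g := fun u => Real.log (x u)) (g' := fun u => x' u / x u)
    (ContinuousOn.log (hc.mono hsub) fun u hu => (hm u (hsub hu)).1.ne') (fun u hu => ?_)
    (((hM.continuousOn_excess (fun t ht => (hm t ht).1) hc).mono hsub).integrableOn_Icc)
    (fun u hu => ?_)
  · have hu' : u ∈ Icc a b := hsub ⟨hu.1.le, hu.2.le⟩
    refine (((hd u hu').log (hm u hu').1.ne').mono_of_mem_nhdsWithin ?_)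
    exact mem_of_superset (Ioo_mem_nhdsGT (hu.2.trans_le ht))
      fun v hv => ⟨hu'.1.trans hv.1.le, hv.2.le⟩
  · have hu' : u ∈ Icc a b := hsub ⟨hu.1.le, hu.2.le⟩
    rw [phihat_eq (hm u hu').2, div_le_iff₀' (hm u hu').1]
    exact hle u hu'

theorem isSuper_of_deriv_ge (hM : M.Assumptions) {K₁ a b : ℝ} {x x' : ℝ → ℝ}
    (hm : ∀ t ∈ Icc a b, 0 < x t)
    (hd : ∀ t ∈ Icc a b, HasDerivWithinAt x (x' t) (Icc a b) t)
    (hle : ∀ t ∈ Icc a b, x t * (M.cap K₁ t - M.phihat (x t)) ≤ x' t) : M.IsSuper K₁ x a b := by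
  have hc : ContinuousOn x (Icc a b) := fun t ht => (hd t ht).continuousWithinAt
  refine ⟨hm, hc, fun s t hs hst ht => ?_⟩
  have hsub : Icc s t ⊆ Icc a b := Icc_subset_Icc hs ht
  refine intervalIntegral.integral_le_sub_of_hasDeriv_right_of_le hst
    (g := fun u => Real.log (x u)) (g' := fun u => x' u / x u)
    (ContinuousOn.log (hc.mono hsub) fun u hu => (hm u (hsub hu)).ne') (fun u hu => ?_)
    (((hM.continuousOn_excess hm hc).mono hsub).integrableOn_Icc)
    (fun u hu => ?_)
  · have hu' : u ∈ Icc a b := hsub ⟨hu.1.le, hu.2.le⟩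
    refine (((hd u hu').log (hm u hu').ne').mono_of_mem_nhdsWithin ?_)
    exact mem_of_superset (Ioo_mem_nhdsGT (hu.2.trans_le ht))
      fun v hv => ⟨hu'.1.trans hv.1.le, hv.2.le⟩
  · have hu' : u ∈ Icc a b := hsub ⟨hu.1.le, hu.2.le⟩
    rw [le_div_iff₀' (hm u hu')]
    exact hle u hu'

theorem IsFull.deriv' {K₁ a b : ℝ} {x : ℝ → ℝ} (h : M.IsFull K₁ x a b) {t : ℝ}
    (ht : t ∈ Icc a b) :
    HasDerivWithinAt x (x t * (M.cap K₁ t - M.phi (x t))) (Icc a b) t :=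
  (h.deriv t ht).congr_deriv (by rw [F_eq (h.mem t ht).1.ne']; ring)

theorem IsFull.isSub (hM : M.Assumptions) {K₁ a b : ℝ} {x : ℝ → ℝ} (h : M.IsFull K₁ x a b) :
    M.IsSub K₁ x a b :=
  isSub_of_deriv_le hM h.mem (fun _ ht => h.deriv' ht) fun _ _ => le_rfl

theorem IsFull.isSuper (hM : M.Assumptions) {K₁ a b : ℝ} {x : ℝ → ℝ} (h : M.IsFull K₁ x a b) :
    M.IsSuper K₁ x a b :=
  isSuper_of_deriv_ge hM (fun t ht => (h.mem t ht).1) (fun _ ht => h.deriv' ht) fun t ht => by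
    rw [phihat_eq (h.mem t ht).2]

theorem IsSub.mono {K₁ a b a' b' : ℝ} {x : ℝ → ℝ} (h : M.IsSub K₁ x a b) (ha : a ≤ a')
    (hb : b' ≤ b) : M.IsSub K₁ x a' b' :=
  ⟨fun t ht => h.pos t ⟨ha.trans ht.1, ht.2.trans hb⟩, h.cont.mono (Icc_subset_Icc ha hb),
    fun s t hs hst ht => h.le s t (ha.trans hs) hst (ht.trans hb)⟩

theorem IsSuper.mono {K₁ a b a' b' : ℝ} {x : ℝ → ℝ} (h : M.IsSuper K₁ x a b) (ha : a ≤ a')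
    (hb : b' ≤ b) : M.IsSuper K₁ x a' b' :=
  ⟨fun t ht => h.pos t ⟨ha.trans ht.1, ht.2.trans hb⟩, h.cont.mono (Icc_subset_Icc ha hb),
    fun s t hs hst ht => h.ge s t (ha.trans hs) hst (ht.trans hb)⟩

theorem IsSub.shift {K₁ a b d : ℝ} {x : ℝ → ℝ} (h : M.IsSub K₁ x (d + a) (d + b)) :
    M.IsSub (M.cap K₁ d) (fun s => x (d + s)) a b := by
  refine ⟨fun t ht => h.pos _ ⟨by linarith [ht.1], by linarith [ht.2]⟩,
    h.cont.comp (by fun_prop) fun t ht => ⟨by linarith [ht.1], by linarith [ht.2]⟩,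
    fun s t hs hst ht => ?_⟩
  have h1 := h.le (d + s) (d + t) (by linarith) (by linarith) (by linarith)
  rw [← intervalIntegral.integral_comp_add_left] at h1
  simpa only [cap_add] using h1

/-- The integrated logarithmic form is what permits concatenation: x need not be differentiable
where full effort, rest and idleness meet. -/
theorem IsSub.append (hM : M.Assumptions) {K₁ a b c : ℝ} {x : ℝ → ℝ} (h1 : M.IsSub K₁ x a b)
    (h2 : M.IsSub K₁ x b c) (hab : a ≤ b) (hbc : b ≤ c) : M.IsSub K₁ x a c := by
  have hp : ∀ t ∈ Icc a c, 0 < x t := fun t ht => by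
    rcases le_total t b with h | h
    · exact h1.pos t ⟨ht.1, h⟩
    · exact h2.pos t ⟨h, ht.2⟩
  have hc : ContinuousOn x (Icc a c) := by
    rw [← Icc_union_Icc_eq_Icc hab hbc]
    exact h1.cont.union_of_isClosed h2.cont isClosed_Icc isClosed_Icc
  refine ⟨hp, hc, fun s t hs hst ht => ?_⟩
  rcases le_total t b with htb | htb
  · exact h1.le s t hs hst htb
  rcases le_total s b with hsb | hsb
  · have hi := hM.continuousOn_excess (K₁ := K₁) hp hc
    rw [← intervalIntegral.integral_add_adjacent_intervals (b := b)
      ((hi.mono (Icc_subset_Icc hs hbc)).intervalIntegrable_of_Icc hsb)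
      ((hi.mono (Icc_subset_Icc hab ht)).intervalIntegrable_of_Icc htb)]
    linarith [h1.le s b hs hsb le_rfl, h2.le b t le_rfl htb ht]
  · exact h2.le s t hsb hst ht

/-- While log y ≥ log x, the monotonicity of `phihat` keeps log y − log x at least at its initial
value; `barrier` removes the proviso. -/
theorem IsSub.lt_super (hM : M.Assumptions) {K₁ a b : ℝ} {x y : ℝ → ℝ} (h1 : M.IsSub K₁ x a b)
    (h2 : M.IsSuper K₁ y a b) (ha : x a < y a) {t : ℝ} (ht : t ∈ Icc a b) : x t < y t := by
  have ha0 : a ∈ Icc a b := ⟨le_rfl, ht.1.trans ht.2⟩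
  have hc : ContinuousOn (fun u => Real.log (y u) - Real.log (x u)) (Icc a b) :=
    (ContinuousOn.log h2.cont fun u hu => (h2.pos u hu).ne').sub
      (ContinuousOn.log h1.cont fun u hu => (h1.pos u hu).ne')
  have h0 : 0 < Real.log (y a) - Real.log (x a) :=
    sub_pos.2 (Real.log_lt_log (h1.pos a ha0) ha)
  have := barrier hc h0 (fun t ht hD => ?_) ht
  · exact (Real.log_lt_log_iff (h1.pos t ht) (h2.pos t ht)).1 (by linarith)
  · have h3 := h1.le a t le_rfl ht.1 ht.2
    have h4 := h2.ge a t le_rfl ht.1 ht.2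
    have hsub : Icc a t ⊆ Icc a b := Icc_subset_Icc_right ht.2
    have h5 : (∫ u in a..t, (M.cap K₁ u - M.phihat (x u))) ≤
        ∫ u in a..t, (M.cap K₁ u - M.phihat (y u)) := by
      refine intervalIntegral.integral_mono_on ht.1
        (((hM.continuousOn_excess h1.pos h1.cont).mono hsub).intervalIntegrable_of_Icc ht.1)
        (((hM.continuousOn_excess h2.pos h2.cont).mono hsub).intervalIntegrable_of_Icc ht.1)
        fun u hu => ?_
      have hu' := hsub hu
      have := (Real.log_le_log_iff (h1.pos u hu') (h2.pos u hu')).1 (by linarith [hD u hu])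
      linarith [hM.phihat_anti (h1.pos u hu') this]
    linarith

/-- As long as the capital is below `K^*`, a trajectory starting on `Σ^*` is to its left. -/
theorem IsSub.lt_xstar (hM : M.Assumptions) {K₁ t : ℝ} {x : ℝ → ℝ} (hK : 0 < K₁)
    (h : M.IsSub K₁ x 0 t) (hx0 : x 0 = M.xstar) (ht : 0 < t) (hcap : M.cap K₁ t ≤ M.Kstar) :
    x t < M.xstar := by
  have hexc := hM.continuousOn_excess (K₁ := K₁) h.pos h.cont
  have hst : M.phihat M.xstar = M.Kstar := phihat_eq hM.xstar_mem.2.le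
  have hle : ∀ s ∈ Icc 0 t, x s ≤ M.xstar := by
    intro s hs
    by_contra hc
    obtain ⟨m, h1, h2, h3⟩ := exists_last_zero (f := fun s => x s - M.xstar)
      ((h.cont.mono (Icc_subset_Icc_right hs.2)).sub continuousOn_const)
      (sub_pos.2 (not_le.1 hc)) hs.1 (by linarith)
    have hm : m ∈ Icc 0 t := ⟨h1.1, h1.2.le.trans hs.2⟩
    -- At the last time m on the line x = x^* the growth rate is cap − K^* < 0, so log x must drop
    -- right after m, although x > x^* there.
    have hneg : M.cap K₁ m - M.phihat (x m) < 0 := by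
      rw [sub_eq_zero.1 h2, hst]
      linarith [hM.cap_lt hK (h1.2.trans_le hs.2)]
    have hev := (hexc m hm).eventually (Iio_mem_nhds hneg)
    have hmt : m < t := h1.2.trans_le hs.2
    have hev' := (nhdsWithin_mono m (Icc_subset_Icc_left (b := t) h1.1)) hev
    rw [nhdsWithin_Icc_eq_nhdsGE hmt] at hev'
    obtain ⟨b, hb, hb'⟩ := mem_nhdsGE_iff_exists_Icc_subset.1 hev'
    have hmb : m < min b s := lt_min hb h1.2
    have h4 := h.le m (min b s) h1.1 hmb.le ((min_le_right _ _).trans hs.2)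
    have h5 : (∫ u in m..min b s, (M.cap K₁ u - M.phihat (x u))) ≤ 0 := by
      rw [← neg_nonneg, ← intervalIntegral.integral_neg]
      refine intervalIntegral.integral_nonneg hmb.le fun u hu => ?_
      have : M.cap K₁ u - M.phihat (x u) < 0 := hb' ⟨hu.1, hu.2.trans (min_le_left _ _)⟩
      linarith
    have h6 := h3 (min b s) ⟨hmb, min_le_right _ _⟩
    have h7 := Real.log_lt_log (h.pos m hm) (show x m < x (min b s) by linarith)
    linarith
  have hbd : ∀ s ∈ Icc 0 t, M.Kstar ≤ M.phihat (x s) := fun s hs => by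
    rw [← hst]; exact hM.phihat_anti (h.pos s hs) (hle s hs)
  have hint : ∀ a b, 0 ≤ a → a ≤ b → b ≤ t →
      (∫ u in a..b, (M.cap K₁ u - M.phihat (x u))) ≤ (M.cap K₁ b - M.Kstar) * (b - a) := by
    intro a b ha hab hb
    have := intervalIntegral.integral_mono_on hab
      ((hexc.mono (Icc_subset_Icc ha hb)).intervalIntegrable_of_Icc hab)
      (intervalIntegrable_const (μ := volume) (c := M.cap K₁ b - M.Kstar))
      fun u hu => by linarith [hbd u ⟨ha.trans hu.1, hu.2.trans hb⟩, hM.cap_le hK hu.2]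
    rw [intervalIntegral.integral_const, smul_eq_mul, mul_comm] at this
    exact this
  -- Splitting at t / 2 gives strictness: cap may equal K^* at t, but it is smaller at t / 2.
  have h1 := (h.le 0 (t / 2) le_rfl (by linarith) (by linarith)).trans
    (hint 0 (t / 2) le_rfl (by linarith) (by linarith))
  have h2 := (h.le (t / 2) t (by linarith) (by linarith) le_rfl).trans
    (hint (t / 2) t (by linarith) (by linarith) le_rfl)
  have h3 : (M.cap K₁ (t / 2) - M.Kstar) * (t / 2 - 0) < 0 :=
    mul_neg_of_neg_of_pos (by linarith [hM.cap_lt hK (show t / 2 < t by linarith)]) (by linarith)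
  have h4 : (M.cap K₁ t - M.Kstar) * (t - t / 2) ≤ 0 :=
    mul_nonpos_of_nonpos_of_nonneg (by linarith) (by linarith)
  rw [← hx0]
  exact (Real.log_lt_log_iff (h.pos t ⟨ht.le, le_rfl⟩) (h.pos 0 ⟨le_rfl, ht.le⟩)).1 (by linarith)

/-- At equal capital, the stock increases with the initial capital of the backward trajectory. -/
theorem IsSub.lt_of_cap (hM : M.Assumptions) {K₁ K₂ d s : ℝ} {x y : ℝ → ℝ} (hK : 0 < K₁)
    (hK' : K₁ < K₂) (hK₂ : K₂ ≤ M.Kstar) (hd : M.cap K₁ d = K₂) (hs : 0 ≤ s)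
    (h1 : M.IsSub K₁ x 0 (d + s)) (hx : x 0 = M.xstar)
    (h2 : M.IsSuper K₂ y 0 s) (hy : y 0 = M.xstar) : x (d + s) < y s := by
  have hd0 : 0 < d := by
    rw [← hM.cap_lt_iff hK, cap_zero, hd]; exact hK'
  subst hd
  -- When the capital K₁ has grown to K₂, at the time d, the stock is already below x^*; from then
  -- on both trajectories carry the same capital.
  refine IsSub.lt_super hM (x := fun s => x (d + s)) (h1.mono (by linarith) le_rfl).shift h2 ?_
    ⟨hs, le_rfl⟩
  rw [hy, add_zero]
  exact (h1.mono le_rfl (by linarith)).lt_xstar hM hK hx hd0 hK₂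

/-! ### Comparison of the switch variables at equal capital -/

/-- A trajectory ending on `Σ^*` whose stock grows at most as fast as with full effort and whose
switch variable `z` is nonnegative. -/
structure IsSubpath (M : Fishery) (K₁ T : ℝ) (x z l : ℝ → ℝ) : Prop where
  isSub : M.IsSub K₁ x 0 T
  isSwitch : M.IsSwitch x z 0 T
  l_deriv : ∀ t ∈ Icc 0 T, HasDerivWithinAt l (z t - M.κ * l t) (Icc 0 T) t
  z_nonneg : ∀ t ∈ Icc 0 T, 0 ≤ z t
  z_le : ∀ t ∈ Icc 0 T, z t ≤ M.p * x t - M.c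
  x_zero : x 0 = M.xstar
  z_zero : z 0 = M.r'
  l_zero : l 0 = M.r

theorem IsBackward.isSubpath (hM : M.Assumptions) {K₁ T : ℝ} {x z l : ℝ → ℝ} (hK : 0 < K₁)
    (h : M.IsBackward K₁ T x z l) (hz : ∀ t ∈ Icc 0 T, 0 ≤ z t) : M.IsSubpath K₁ T x z l :=
  ⟨h.isFull.isSub hM, h.isSwitch, fun _ ht => h.l_deriv' ht, hz,
    fun _ ht => (h.lt_profit hM hK ht).le, h.x_zero, h.z_zero, h.l_zero⟩

theorem IsSubpath.mono {K₁ T T' : ℝ} {x z l : ℝ → ℝ} (h : M.IsSubpath K₁ T x z l) (hT : T' ≤ T) :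
    M.IsSubpath K₁ T' x z l :=
  ⟨h.isSub.mono le_rfl hT, h.isSwitch.mono le_rfl hT,
    fun t ht => (h.l_deriv t ⟨ht.1, ht.2.trans hT⟩).mono (Icc_subset_Icc_right hT),
    fun t ht => h.z_nonneg t ⟨ht.1, ht.2.trans hT⟩, fun t ht => h.z_le t ⟨ht.1, ht.2.trans hT⟩,
    h.x_zero, h.z_zero, h.l_zero⟩

/-- Since κ r = r', the level r is a strict upper barrier for λ as long as ζ < r'. -/
theorem l_lt_r {a b : ℝ} {l ζ : ℝ → ℝ}
    (hl : ∀ t ∈ Icc a b, HasDerivWithinAt l (ζ t - M.κ * l t) (Icc a b) t)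
    (hz : ∀ t ∈ Ioo a b, ζ t < M.r') (ha : l a ≤ M.r) (hab : a < b) : l b < M.r := by
  have := lin_pos_of_strict (w := fun s => M.r - l s) (k := fun _ => M.κ) continuousOn_const
    (fun u hu => (hl u hu).const_sub M.r)
    (fun u hu => by have := hz u hu; rw [r'] at this; linarith) (by linarith) ⟨hab, le_rfl⟩
  linarith

/-- During the time d in which K₁ grows to K₂ the first path moves left of x^*, so that z falls
below r' and λ below r. Afterwards both paths carry the same capital, and the strict inequality for
x passes on to z by `switch_compare`, and from z to λ by the linear equation. -/
theorem IsSubpath.lt_of_cap (hM : M.Assumptions) {K₁ K₂ d T₁ T₂ s : ℝ}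
    {x₁ z₁ l₁ x₂ z₂ l₂ : ℝ → ℝ} (hK : 0 < K₁)
    (hK' : K₁ < K₂) (hK₂ : K₂ ≤ M.Kstar) (hd : M.cap K₁ d = K₂)
    (h1 : M.IsSubpath K₁ T₁ x₁ z₁ l₁) (h2 : M.IsBackward K₂ T₂ x₂ z₂ l₂) (hs : 0 ≤ s)
    (hs1 : d + s ≤ T₁) (hs2 : s ≤ T₂) :
    x₁ (d + s) < x₂ s ∧ z₁ (d + s) < z₂ s ∧ l₁ (d + s) < l₂ s := by
  have hd0 : 0 < d := by
    rw [← hM.cap_lt_iff hK, cap_zero, hd]; exact hK'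
  have h1' := h1.mono hs1
  have h2' := h2.mono hs2
  have hx : ∀ u ∈ Icc 0 s, x₁ (d + u) < x₂ u := fun u hu =>
    IsSub.lt_of_cap hM hK hK' hK₂ hd hu.1 (h1'.isSub.mono le_rfl (by linarith [hu.2])) h1.x_zero
      ((h2'.isFull.mono le_rfl hu.2).isSuper hM) h2.x_zero
  have hxs : ∀ u ∈ Ioc 0 d, x₁ u < M.xstar := fun u hu =>
    (h1'.isSub.mono le_rfl (by linarith [hu.2])).lt_xstar hM hK h1.x_zero hu.1
      ((hM.cap_le hK hu.2).trans (hd.le.trans hK₂))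
  have hzs : ∀ u ∈ Ioc 0 d, z₁ u < M.r' := fun u hu =>
    (h1'.isSwitch.mono le_rfl (by linarith [hu.2])).lt_r' hM hu.1 h1.z_zero.le
      fun v hv => hxs v ⟨hv.1, hv.2.le.trans hu.2⟩
  have hls : l₁ d < M.r := l_lt_r
    (fun t ht => (h1'.l_deriv t ⟨ht.1, by linarith [ht.2]⟩).mono
      (Icc_subset_Icc_right (by linarith)))
    (fun t ht => hzs t ⟨ht.1, ht.2.le⟩) h1.l_zero.le hd0
  have hz : ∀ u ∈ Icc 0 s, z₁ (d + u) < z₂ u := fun u hu =>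
    switch_compare hM (x₁ := fun u => x₁ (d + u)) (z₁ := fun u => z₁ (d + u))
      (h1'.isSwitch.mono (by linarith) le_rfl).shift h2'.isSwitch hx
      (fun t ht => h1'.z_nonneg _ ⟨by linarith [ht.1], by linarith [ht.2]⟩)
      (fun t ht => h1'.z_le _ ⟨by linarith [ht.1], by linarith [ht.2]⟩)
      (by rw [h2.z_zero, add_zero]; exact hzs d ⟨hd0, le_rfl⟩) hu
  refine ⟨hx s ⟨hs, le_rfl⟩, hz s ⟨hs, le_rfl⟩, ?_⟩
  have := lin_pos (w := fun u => l₂ u - l₁ (d + u)) (k := fun _ => M.κ) (a := 0) (b := s)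
    continuousOn_const
    (fun u hu => (h2'.l_deriv' hu).sub ((h1'.l_deriv (d + u)
      ⟨by linarith [hu.1], by linarith [hu.2]⟩).shift (by linarith) le_rfl))
    (fun u hu => by linarith [hz u (Ioo_subset_Icc_self hu)])
    (by rw [h2.l_zero, add_zero]; linarith) ⟨hs, le_rfl⟩
  linarith

end Fishery

/-! ### Change of time between increasing functions. -/

theorem lin_pos_Ioo {k w w' : ℝ → ℝ} {a b : ℝ} (hk : ContinuousOn k (Icc a b))
    (hc : ContinuousOn w (Icc a b)) (hw : ∀ t ∈ Ioo a b, HasDerivAt w (w' t) t)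
    (h : ∀ t ∈ Ioo a b, 0 ≤ w' t + k t * w t) (ha : 0 < w a) {t : ℝ} (ht : t ∈ Icc a b) :
    0 < w t := by
  obtain ⟨E, hE, hE'⟩ := exists_integrating_factor (ht.1.trans ht.2) hk
  have hd : ∀ t ∈ Ioo a b, HasDerivAt (fun t => w t * E t) ((w' t + k t * w t) * E t) t :=
    fun t ht => ((hw t ht).mul (hE' t (Ioo_subset_Icc_self ht))).congr_deriv (by ring)
  have hm : MonotoneOn (fun t => w t * E t) (Icc a b) := by
    refine monotoneOn_of_deriv_nonneg (convex_Icc _ _)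
      (hc.mul fun t ht => (hE' t ht).continuousAt.continuousWithinAt) ?_ ?_ <;> rw [interior_Icc]
    · exact fun t ht => (hd t ht).differentiableAt.differentiableWithinAt
    · intro t ht
      rw [(hd t ht).deriv]
      exact mul_nonneg (h t ht) (hE t).le
  have h1 := hm ⟨le_rfl, ht.1.trans ht.2⟩ ht ht.1
  exact pos_of_mul_pos_left ((mul_pos ha (hE a)).trans_le h1) (hE t).le

/-- The slope of θ is the quotient of the slopes of h = f ∘ θ and of f; the two punctured conditions
keep it from being 0/0. -/
theorem hasDerivAt_of_comp {f θ h : ℝ → ℝ} {s d e : ℝ} (hθ : ContinuousAt θ s)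
    (hinj : ∀ᶠ t in 𝓝[≠] s, θ t ≠ θ s) (hf : HasDerivAt f d (θ s)) (hd : d ≠ 0)
    (hh : HasDerivAt h e s) (hfh : ∀ᶠ t in 𝓝 s, f (θ t) = h t)
    (hne : ∀ᶠ t in 𝓝[≠] s, h t ≠ h s) : HasDerivAt θ (e / d) s := by
  rw [hasDerivAt_iff_tendsto_slope] at hf hh ⊢
  have h1 : Tendsto θ (𝓝[≠] s) (𝓝[≠] (θ s)) :=
    tendsto_nhdsWithin_iff.2 ⟨hθ.tendsto.mono_left nhdsWithin_le_nhds, hinj⟩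
  refine (hh.div (hf.comp h1) hd).congr' ?_
  filter_upwards [hinj, hne, hfh.filter_mono nhdsWithin_le_nhds, self_mem_nhdsWithin]
    with t h2 h3 h4 h5
  have h6 := hfh.self_of_nhds
  simp only [Function.comp, slope_def_field, h4, h6, Pi.div_apply]
  have := sub_ne_zero.2 h2
  have := sub_ne_zero.2 h3
  have : t - s ≠ 0 := sub_ne_zero.2 h5
  field_simp

/-- Two increasing parametrizations of the same interval differ by a change of time. -/
theorem exists_time_change {f h f' h' : ℝ → ℝ} {a b c d : ℝ} (hab : a ≤ b)
    (hf : StrictMonoOn f (Icc a b)) (hfc : ContinuousOn f (Icc a b))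
    (hh : StrictMonoOn h (Icc c d)) (hhc : ContinuousOn h (Icc c d))
    (hfd : ∀ t ∈ Ioo a b, HasDerivAt f (f' t) t) (hf0 : ∀ t ∈ Ioo a b, f' t ≠ 0)
    (hhd : ∀ t ∈ Ioo c d, HasDerivAt h (h' t) t) (hac : f a = h c) (hbd : f b = h d) :
    ∃ θ : ℝ → ℝ, (∀ s ∈ Icc c d, θ s ∈ Icc a b ∧ f (θ s) = h s) ∧
      (∀ s ∈ Ioo c d, θ s ∈ Ioo a b) ∧ ContinuousOn θ (Icc c d) ∧
      ∀ s ∈ Ioo c d, HasDerivAt θ (h' s / f' (θ s)) s := by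
  have hex : ∀ s : ℝ, ∃ t, s ∈ Icc c d → t ∈ Icc a b ∧ f t = h s := by
    intro s
    by_cases hs : s ∈ Icc c d
    · have hcd : c ≤ d := hs.1.trans hs.2
      obtain ⟨t, ht, hts⟩ := intermediate_value_Icc hab hfc (show h s ∈ Icc (f a) (f b) from
        ⟨by rw [hac]; exact hh.monotoneOn ⟨le_rfl, hcd⟩ hs hs.1,
          by rw [hbd]; exact hh.monotoneOn hs ⟨hcd, le_rfl⟩ hs.2⟩)
      exact ⟨t, fun _ => ⟨ht, hts⟩⟩
    · exact ⟨0, fun h => absurd h hs⟩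
  choose θ hθ using hex
  have hθc : ContinuousOn θ (Icc c d) := by
    -- On the compact interval f is an embedding, so the continuity of θ can be read off from that
    -- of f ∘ θ = h.
    have hcl : Topology.IsClosedEmbedding ((Icc a b).domRestrict f) :=
      hfc.domRestrict.isClosedEmbedding fun u v huv => Subtype.ext (hf.injOn u.2 v.2 huv)
    have hcont : Continuous (fun s : Icc c d => (⟨θ s, (hθ s s.2).1⟩ : Icc a b)) := by
      rw [hcl.isEmbedding.continuous_iff]
      have : (Icc a b).domRestrict f ∘ (fun s : Icc c d => (⟨θ s, (hθ s s.2).1⟩ : Icc a b)) =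
          (Icc c d).domRestrict h := funext fun s => (hθ s s.2).2
      rw [this]
      exact hhc.domRestrict
    exact continuousOn_iff_continuous_domRestrict.2 (continuous_subtype_val.comp hcont)
  have hint : ∀ s ∈ Ioo c d, θ s ∈ Ioo a b := by
    intro s hs
    have hs' := Ioo_subset_Icc_self hs
    have hcd : c ≤ d := hs'.1.trans hs'.2
    obtain ⟨h1, h2⟩ := hθ s hs'
    refine ⟨h1.1.lt_of_ne fun he => ?_, h1.2.lt_of_ne fun he => ?_⟩
    · rw [← he, hac] at h2
      exact (hh ⟨le_rfl, hcd⟩ hs' hs.1).ne h2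
    · rw [he, hbd] at h2
      exact (hh hs' ⟨hcd, le_rfl⟩ hs.2).ne' h2
  refine ⟨θ, fun s hs => hθ s hs, hint, hθc, fun s hs => ?_⟩
  have hs' := Ioo_subset_Icc_self hs
  have hnh := Ioo_mem_nhds hs.1 hs.2
  have hne : ∀ᶠ t in 𝓝[≠] s, h t ≠ h s := by
    filter_upwards [mem_nhdsWithin_of_mem_nhds hnh, self_mem_nhdsWithin] with t ht hts he
    exact hts (hh.injOn (Ioo_subset_Icc_self ht) hs' he)
  refine hasDerivAt_of_comp (hθc.continuousAt (Icc_mem_nhds hs.1 hs.2)) ?_ (hfd _ (hint s hs))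
    (hf0 _ (hint s hs)) (hhd s hs) ?_ hne
  · filter_upwards [hne, mem_nhdsWithin_of_mem_nhds hnh] with t h1 ht he
    rw [← (hθ t (Ioo_subset_Icc_self ht)).2, ← (hθ s hs').2, he] at h1
    exact h1 rfl
  · filter_upwards [hnh] with t ht
    exact (hθ t (Ioo_subset_Icc_self ht)).2

/-! ### Comparison of λ at equal stock. -/

namespace Fishery
variable {M : Fishery}

/-- No upper bound on ζ is needed, in contrast to `G_lt`: for ζ > p x − c both terms of `G_eq` are
nonpositive anyway. -/
theorem Assumptions.G_nonpos (hM : M.Assumptions) {x y ζ : ℝ} (hx : 0 < x) (hxy : x ≤ y)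
    (hy : y ≤ M.xbar) (hζ : 0 ≤ ζ) (h : M.G y ζ ≤ 0) : M.G x ζ ≤ 0 := by
  rcases le_or_gt ζ (M.p * x - M.c) with h1 | h1
  · rcases hxy.eq_or_lt with h2 | h2
    · rwa [h2]
    · exact (hM.G_lt hx h2 hy hζ h1).le.trans h
  · have hm : x ∈ Ioc 0 M.xbar := ⟨hx, hxy.trans hy⟩
    rw [G_eq]
    have h2 := mul_nonneg (add_nonneg hM.c_pos.le hζ) (hM.phi_nonneg hm)
    have h3 := mul_neg_of_neg_of_pos (show M.p * x - M.c - ζ < 0 by linarith)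
      (sub_pos.2 (hM.deriv_lt_δ hm))
    linarith

theorem Assumptions.xtil_lt_of_G_eq_zero (hM : M.Assumptions) {x z : ℝ} (hx : x ∈ Ioc 0 M.xbar)
    (hz : 0 < z) (h : M.G x z = 0) : M.xtil < x := by
  by_contra hc
  have h1 := hM.ψ_nonpos_of_le hx.1 (not_lt.1 hc)
  have h2 := mul_pos hz (hM.g_pos hx)
  rw [G] at h
  linarith

/-- The sign of `z'` along a trajectory reaching a point to the right of `x = x^*`. -/
theorem IsBackward.exists_turning_point (hM : M.Assumptions) {K₂ T₂ : ℝ} {x₂ z₂ l₂ : ℝ → ℝ}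
    (hK : 0 < K₂) (hK₂ : K₂ < M.Kstar) (h2 : M.IsBackward K₂ T₂ x₂ z₂ l₂) (hT₂ : 0 < T₂)
    (hz : ∀ t ∈ Icc 0 T₂, 0 ≤ z₂ t) (hx : M.xstar < x₂ T₂) :
    ∃ b ∈ Ioc 0 T₂, M.G (x₂ b) (z₂ b) = 0 ∧ M.phi (x₂ b) < M.cap K₂ b ∧
      (∀ t ∈ Ioo 0 b, M.G (x₂ t) (z₂ t) ≤ 0) ∧ ∀ t ∈ Icc b T₂, 0 ≤ M.G (x₂ t) (z₂ t) := by
  have hf := h2.isFull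
  have hs := h2.isSwitch
  have hzp : ∀ t ∈ Icc 0 T₂, z₂ t ≤ M.p * x₂ t - M.c := fun t ht => (h2.lt_profit hM hK ht).le
  -- While the stock falls it is below x^*, hence z < r' = z 0, and `G_neg_of_descending` applies.
  have hdesc : ∀ t ∈ Ioc 0 T₂, M.cap K₂ t ≤ M.phi (x₂ t) → M.G (x₂ t) (z₂ t) < 0 := by
    intro t ht hc
    have hxt : ∀ u ∈ Ioo 0 t, x₂ u < M.xstar := fun u hu => by
      refine h2.lt_xstar hM hK hu ht.2 ?_
      rw [← h2.x_zero]
      exact (hf.lt_of_descending hM hK ht.2 hc ⟨le_rfl, ht.1⟩).le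
    have h3 := (hs.mono le_rfl ht.2).lt_r' hM ht.1 h2.z_zero.le hxt
    exact (hs.mono le_rfl ht.2).G_neg_of_descending hM hK (hf.mono le_rfl ht.2) ht.1 hc
      (hz t ⟨ht.1.le, ht.2⟩) (hzp t ⟨ht.1.le, ht.2⟩) (by rw [h2.z_zero]; exact h3.le)
  have hasc : ∀ t ∈ Icc 0 T₂, M.phi (x₂ t) ≤ M.cap K₂ t → 0 ≤ M.G (x₂ t) (z₂ t) →
      ∀ u ∈ Icc t T₂, 0 ≤ M.G (x₂ u) (z₂ u) := fun t ht hc hG u hu =>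
    (hs.mono ht.1 le_rfl).G_nonneg hM ((hf.mono ht.1 le_rfl).strictMonoOn hM hK hc)
      (fun v hv => hz v ⟨ht.1.trans hv.1, hv.2⟩) (fun v hv => hzp v ⟨ht.1.trans hv.1, hv.2⟩) hG hu
  -- K₂ < K^* makes the excess negative at time 0, hence for a short while.
  obtain ⟨s₀, hs₀, hs₀'⟩ : ∃ s ∈ Ioo 0 T₂, M.cap K₂ s < M.phi (x₂ s) := by
    have hc : ContinuousOn (fun t => M.phi (x₂ t) - M.cap K₂ t) (Icc 0 T₂) :=
      (hM.continuousOn_phi.comp hf.cont hs.maps).sub (continuous_cap K₂).continuousOn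
    have h0 : 0 < M.phi (x₂ 0) - M.cap K₂ 0 := by
      rw [cap_zero, h2.x_zero]; exact sub_pos.2 hK₂
    have hev := ((hc 0 ⟨le_rfl, hT₂.le⟩).eventually (Ioi_mem_nhds h0)).filter_mono
      (nhdsWithin_mono 0 Ioo_subset_Icc_self)
    have hne : (𝓝[Ioo 0 T₂] (0 : ℝ)).NeBot := by
      rw [nhdsWithin_Ioo_eq_nhdsGT hT₂]; infer_instance
    obtain ⟨s, h3, h4⟩ := (hev.and self_mem_nhdsWithin).exists
    exact ⟨s, h4, sub_pos.1 h3⟩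
  have hd₀ : ∀ t ∈ Ioc 0 s₀, M.cap K₂ t < M.phi (x₂ t) := by
    intro t ht
    by_contra hc
    rcases ht.2.eq_or_lt with h | h
    · rw [h] at hc; exact hc hs₀'
    · exact absurd (hf.excess_pos hM hK ht.1.le (not_lt.1 hc) ⟨h, hs₀.2.le⟩) (not_lt.2 hs₀'.le)
  have hG₀ := hdesc s₀ ⟨hs₀.1, hs₀.2.le⟩ hs₀'.le
  have hxs₀ : x₂ s₀ < M.xstar := by
    rw [← h2.x_zero]
    exact hf.lt_of_descending hM hK hs₀.2.le hs₀'.le ⟨le_rfl, hs₀.1⟩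
  -- At the last time e on the line x = x^* the stock is ascending and z < r', so G(x^*, z) = (r' −
  -- z) g > 0; this sign persists.
  have hGT : 0 ≤ M.G (x₂ T₂) (z₂ T₂) := by
    obtain ⟨e, h3, h4, -⟩ := exists_last_zero (f := fun t => x₂ t - M.xstar)
      ((hf.cont.mono (Icc_subset_Icc_left hs₀.1.le)).sub continuousOn_const) (by linarith)
      hs₀.2.le (by linarith)
    have h4 : x₂ e = M.xstar := sub_eq_zero.1 h4
    have he : e ∈ Ioc 0 T₂ := ⟨hs₀.1.trans_le h3.1, h3.2.le⟩
    have he' : e ∈ Icc 0 T₂ := Ioc_subset_Icc_self he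
    refine hasc e he' (h2.phi_le_cap hM hK he h4.ge) ?_ T₂ ⟨he.2, le_rfl⟩
    have h5 := (hs.mono le_rfl he.2).lt_r' hM he.1 h2.z_zero.le
      fun u hu => h2.lt_xstar hM hK hu he.2 h4.le
    rw [G_eq_ψstar, h4, hM.ψstar_xstar]
    have := mul_pos (sub_pos.2 h5) (hM.g_pos (x := M.xstar) ⟨hM.xstar_mem.1, hM.xstar_mem.2.le⟩)
    linarith
  have hGneg : ∃ b ∈ Ioc s₀ T₂, - M.G (x₂ b) (z₂ b) = 0 ∧
      ∀ t ∈ Ico s₀ b, 0 < - M.G (x₂ t) (z₂ t) :=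
    exists_first_zero (((hs.G_cont hM).neg).mono (Icc_subset_Icc_left hs₀.1.le)) (by linarith)
      hs₀.2.le (by linarith)
  obtain ⟨b, hb, hb0, hb1⟩ := hGneg
  have hb0 : M.G (x₂ b) (z₂ b) = 0 := by linarith
  have hb' : b ∈ Ioc 0 T₂ := ⟨hs₀.1.trans hb.1, hb.2⟩
  have hcb : M.phi (x₂ b) < M.cap K₂ b := by
    by_contra hc
    linarith [hdesc b hb' (not_lt.1 hc)]
  refine ⟨b, hb', hb0, hcb, fun t ht => ?_, hasc b (Ioc_subset_Icc_self hb') hcb.le hb0.ge⟩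
  rcases le_total t s₀ with h3 | h3
  · exact (hdesc t ⟨ht.1, ht.2.le.trans hb.2⟩ (hd₀ t ⟨ht.1, h3⟩).le).le
  · linarith [hb1 t ⟨h3, ht.2⟩]

end Fishery

namespace Fishery
variable {M : Fishery}

/-- Full effort is exerted as soon as the stock exceeds `xtil`, before the minimum of the stock or
after it. -/
def FullBeyond (M : Fishery) (K₁ T : ℝ) (x : ℝ → ℝ) : Prop :=
  ∀ m ∈ Icc 0 T, M.xtil < x m →
    (M.phi (x m) ≤ M.cap K₁ m → M.IsFull K₁ x m T) ∧
    (M.cap K₁ m < M.phi (x m) → M.IsFull K₁ x 0 m)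

theorem IsFull.fullBeyond {K₁ T : ℝ} {x : ℝ → ℝ} (h : M.IsFull K₁ x 0 T) :
    M.FullBeyond K₁ T x :=
  fun _ hm _ => ⟨fun _ => h.mono hm.1 le_rfl, fun _ => h.mono le_rfl hm.2⟩

/-- A nontrivial interior maximum of `z` is on the ascending part and is not exceeded from below
later. -/
theorem IsSubpath.le_of_isMax (hM : M.Assumptions) {K₁ T m : ℝ} {x z l : ℝ → ℝ} (hK : 0 < K₁)
    (h : M.IsSubpath K₁ T x z l) (hQ : M.FullBeyond K₁ T x) (hm : m ∈ Ioc 0 T)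
    (hG : M.G (x m) (z m) = 0) (hz : 0 < z m) {t : ℝ} (ht : t ∈ Icc m T) : z m ≤ z t := by
  have hm' : m ∈ Icc 0 T := Ioc_subset_Icc_self hm
  have hx := hM.xtil_lt_of_G_eq_zero (h.isSwitch.mem m hm') hz hG
  obtain ⟨h1, h2⟩ := hQ m hm' hx
  -- On the ascending part the later stocks are larger, so that z m is a lower barrier; on the
  -- descending part G < 0, contrary to G = 0.
  rcases le_or_gt (M.phi (x m)) (M.cap K₁ m) with hc | hc
  · have hf := h1 hc
    refine (h.isSwitch.mono hm.1.le le_rfl).ge hM (fun s hs => ?_) le_rfl ht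
    rw [← hG]
    exact (hM.G_lt (h.isSwitch.mem m hm').1
      (hf.lt_of_ascending hM hK le_rfl hc ⟨hs.1, hs.2.le⟩) (hf.mem s (Ioo_subset_Icc_self hs)).2
      hz.le (h.z_le m hm')).le
  · have hf := h2 hc
    have hs := h.isSwitch.mono (le_refl 0) hm.2
    have hzr := hs.lt_r' hM hm.1 h.z_zero.le fun t ht => by
      refine hf.lt_of_le_of_le hM hK ht h.x_zero.le ?_
      rw [← h.x_zero]
      exact (hf.lt_of_descending hM hK le_rfl hc.le ⟨le_rfl, hm.1⟩).le
    have := hs.G_neg_of_descending hM hK hf hm.1 hc.le hz.le (h.z_le m hm')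
      (by rw [h.z_zero]; exact hzr.le)
    linarith

/-- Comparison of `λ` at equal stock to the right of `x = x^*`. -/
theorem IsSubpath.l_lt_of_x_eq (hM : M.Assumptions) {K₁ K₂ T₁ T₂ : ℝ} {x₁ z₁ l₁ x₂ z₂ l₂ : ℝ → ℝ}
    (hK : 0 < K₁) (hK' : K₁ < K₂) (hK₂ : K₂ < M.Kstar) (hT₁ : 0 ≤ T₁) (hT₂ : 0 < T₂)
    (h1 : M.IsSubpath K₁ T₁ x₁ z₁ l₁) (h2 : M.IsBackward K₂ T₂ x₂ z₂ l₂)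
    (hQ : M.FullBeyond K₁ T₁ x₁) (hx : x₁ T₁ = x₂ T₂) (hX : M.xstar < x₂ T₂) :
    l₁ T₁ < l₂ T₂ := by
  obtain ⟨d, -, hd⟩ := hM.exists_cap_eq hK hK'.le
  have hd0 : 0 < d := by
    rw [← hM.cap_lt_iff hK, cap_zero, hd]; exact hK'
  have hK2 : 0 < K₂ := hK.trans hK'
  have hcc : ∀ s, 0 ≤ s → s ≤ T₂ → d + s ≤ T₁ →
      x₁ (d + s) < x₂ s ∧ z₁ (d + s) < z₂ s ∧ l₁ (d + s) < l₂ s :=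
    fun s hs hs2 hs1 => h1.lt_of_cap hM hK hK' hK₂.le hd h2 hs hs1 hs2
  -- Even after the shift by d the first path takes longer: at equal capital it has less stock than
  -- the second, which does not reach its end value before T₂.
  have hdT : d + T₂ < T₁ := by
    by_contra hc
    rcases le_or_gt T₁ d with h | h
    · rcases hT₁.eq_or_lt with h0 | h0
      · rw [← h0, h1.x_zero] at hx; linarith
      · have := h1.isSub.lt_xstar hM hK h1.x_zero h0 ((hM.cap_le hK h).trans (hd.le.trans hK₂.le))
        linarith
    · have h3 := (hcc (T₁ - d) (by linarith) (by linarith) (by linarith)).1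
      rw [add_sub_cancel] at h3
      rcases (show T₁ - d ≤ T₂ by linarith).eq_or_lt with h4 | h4
      · rw [h4] at h3; linarith
      · linarith [h2.lt_of_xstar_lt hM hK2 ⟨by linarith, h4⟩ le_rfl hX]
  have hcc : ∀ s ∈ Icc 0 T₂, x₁ (d + s) < x₂ s ∧ z₁ (d + s) < z₂ s ∧ l₁ (d + s) < l₂ s :=
    fun s hs => hcc s hs.1 hs.2 (by linarith [hs.2])
  have hz₂ : ∀ s ∈ Icc 0 T₂, 0 < z₂ s := fun s hs =>
    (h1.z_nonneg (d + s) ⟨by linarith [hs.1], by linarith [hs.2]⟩).trans_lt (hcc s hs).2.1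
  have hf2 := h2.isFull
  have hs2 := h2.isSwitch
  obtain ⟨b, hb, hb0, hcb, hGb, hGb'⟩ := h2.exists_turning_point hM hK2 hK₂ hT₂
    (fun t ht => (hz₂ t ht).le) hX
  have hb' : b ∈ Icc 0 T₂ := Ioc_subset_Icc_self hb
  have hξ := hM.xtil_lt_of_G_eq_zero (hs2.mem b hb') (hz₂ b hb') hb0
  have hmono2 := (hf2.mono hb.1.le le_rfl).strictMonoOn hM hK2 hcb.le
  have hexc2 : ∀ s ∈ Icc b T₂, M.phi (x₂ s) < M.cap K₂ s := fun s hs => by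
    rcases hs.1.eq_or_lt with h | h
    · rwa [← h]
    · exact hf2.excess_pos hM hK2 hb.1.le hcb.le ⟨h, hs.2⟩
  -- the first time at which the first trajectory reaches the same stock
  obtain ⟨τ, hτ, hτ0, hτ1⟩ := exists_first_zero (f := fun t => x₂ b - x₁ t) (a := d + b) (t := T₁)
    (continuousOn_const.sub (h1.isSub.cont.mono (Icc_subset_Icc_left (by linarith [hb.1]))))
    (sub_pos.2 (hcc b hb').1) (by linarith [hb.2]) (by
      have := hmono2.monotoneOn ⟨le_rfl, hb.2⟩ ⟨hb.2, le_rfl⟩ hb.2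
      linarith)
  have hτ0 : x₁ τ = x₂ b := by linarith
  have hτ' : τ ∈ Icc 0 T₁ := ⟨by linarith [hτ.1, hb.1], hτ.2⟩
  have hcap : ∀ s, M.cap K₁ (d + s) = M.cap K₂ s := fun s => by rw [cap_add, hd]
  have hcτ : M.phi (x₁ τ) < M.cap K₁ τ := by
    rw [hτ0]
    refine hcb.trans ?_
    rw [← hcap]
    exact hM.cap_lt hK hτ.1
  have hf1 := (hQ τ hτ' (by rw [hτ0]; exact hξ)).1 hcτ.le
  have hmono1 := hf1.strictMonoOn hM hK hcτ.le
  have hexc1 : ∀ s ∈ Icc τ T₁, M.phi (x₁ s) < M.cap K₁ s := fun s hs => by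
    rcases hs.1.eq_or_lt with h | h
    · rwa [← h]
    · exact hf1.excess_pos hM hK le_rfl hcτ.le ⟨h, hs.2⟩
  have hpos1 : ∀ t ∈ Ioo τ T₁, 0 < x₁ t * (M.cap K₁ t - M.phi (x₁ t)) := fun t ht =>
    mul_pos (hf1.mem t (Ioo_subset_Icc_self ht)).1
      (sub_pos.2 (hexc1 t (Ioo_subset_Icc_self ht)))
  obtain ⟨θ, hθ, hθ', hθc, hθd⟩ := exists_time_change hτ.2 hmono1 hf1.cont hmono2
    (hf2.cont.mono (Icc_subset_Icc_left hb.1.le)) (fun t ht => hf1.hasDerivAt ht)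
    (fun t ht => (hpos1 t ht).ne')
    (fun t ht => hf2.hasDerivAt ⟨hb.1.trans ht.1, ht.2⟩) hτ0 hx
  have hbT : ∀ s ∈ Icc b T₂, s ∈ Icc 0 T₂ := fun s hs => ⟨hb.1.le.trans hs.1, hs.2⟩
  -- Being behind at equal capital, the first path attains a given stock later, and hence with more
  -- capital.
  have hθlt : ∀ s ∈ Icc b T₂, d + s < θ s := by
    intro s hs
    by_contra hc
    obtain ⟨h3, h4⟩ := hθ s hs
    have h5 : d + s ∈ Icc τ T₁ := ⟨h3.1.trans (not_lt.1 hc), by linarith [hs.2]⟩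
    have := hmono1.monotoneOn h3 h5 (not_lt.1 hc)
    linarith [(hcc s (hbT s hs)).1]
  -- This will be θ', the ratio of the growth rates at the common stock. It is below 1, because the
  -- first path carries more capital there.
  set ρ : ℝ → ℝ := fun s => (M.cap K₂ s - M.phi (x₂ s)) / (M.cap K₁ (θ s) - M.phi (x₂ s)) with hρ
  have hden : ∀ s ∈ Icc b T₂, M.cap K₂ s - M.phi (x₂ s) < M.cap K₁ (θ s) - M.phi (x₂ s) :=
    fun s hs => by
      have := hM.cap_lt hK (hθlt s hs)
      rw [hcap] at this
      linarith
  have hρ0 : ∀ s ∈ Icc b T₂, 0 < ρ s := fun s hs =>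
    div_pos (sub_pos.2 (hexc2 s hs)) ((sub_pos.2 (hexc2 s hs)).trans (hden s hs))
  have hρ1 : ∀ s ∈ Icc b T₂, ρ s < 1 := fun s hs =>
    (div_lt_one ((sub_pos.2 (hexc2 s hs)).trans (hden s hs))).2 (hden s hs)
  have hsub2 : Icc b T₂ ⊆ Icc 0 T₂ := Icc_subset_Icc_left hb.1.le
  have hφc : ContinuousOn (fun s => M.phi (x₂ s)) (Icc b T₂) :=
    (hM.continuousOn_phi.comp hf2.cont hs2.maps).mono hsub2
  have hρc : ContinuousOn ρ (Icc b T₂) := by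
    refine ContinuousOn.div ((continuous_cap K₂).continuousOn.sub hφc)
      (((continuous_cap K₁).comp_continuousOn hθc).sub hφc) fun s hs => ?_
    exact ((sub_pos.2 (hexc2 s hs)).trans (hden s hs)).ne'
  have hθρ : ∀ s ∈ Ioo b T₂, HasDerivAt θ (ρ s) s := fun s hs => by
    refine (hθd s hs).congr_deriv ?_
    have h3 := hθ s (Ioo_subset_Icc_self hs)
    have h4 := (hs2.mem s (hbT s (Ioo_subset_Icc_self hs))).1.ne'
    rw [h3.2, hρ, mul_div_mul_left _ _ h4]
  have hmaps : MapsTo θ (Icc b T₂) (Icc 0 T₁) := fun s hs =>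
    ⟨hτ'.1.trans (hθ s hs).1.1, (hθ s hs).1.2⟩
  have hz1d : ∀ s ∈ Ioo b T₂,
      HasDerivAt (fun s => z₁ (θ s)) (M.G (x₂ s) (z₁ (θ s)) * ρ s) s := fun s hs => by
    have h3 := hθ' s hs
    have h4 := (h1.isSwitch.deriv (θ s) (hmaps (Ioo_subset_Icc_self hs))).hasDerivAt
      (Icc_mem_nhds (hτ'.1.trans_lt h3.1) h3.2)
    rw [(hθ s (Ioo_subset_Icc_self hs)).2] at h4
    exact h4.comp s (hθρ s hs)
  have hl1d : ∀ s ∈ Ioo b T₂,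
      HasDerivAt (fun s => l₁ (θ s)) ((z₁ (θ s) - M.κ * l₁ (θ s)) * ρ s) s := fun s hs => by
    have h3 := hθ' s hs
    exact ((h1.l_deriv (θ s) (hmaps (Ioo_subset_Icc_self hs))).hasDerivAt
      (Icc_mem_nhds (hτ'.1.trans_lt h3.1) h3.2)).comp s (hθρ s hs)
  have hl1c : ContinuousOn l₁ (Icc 0 T₁) := fun t ht => (h1.l_deriv t ht).continuousWithinAt
  have hl2c : ContinuousOn l₂ (Icc 0 T₂) := fun t ht => (h2.l_deriv' ht).continuousWithinAt
  have hθb : θ b = τ := by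
    have h3 := hθ b ⟨le_rfl, hb.2⟩
    exact hmono1.injOn h3.1 ⟨le_rfl, hτ.2⟩ (h3.2.trans hτ0.symm)
  have hθT : θ T₂ = T₁ := by
    have h3 := hθ T₂ ⟨hb.2, le_rfl⟩
    exact hmono1.injOn h3.1 ⟨hτ.2, le_rfl⟩ (h3.2.trans hx.symm)
  -- comparison of `z` at equal stock
  have hzb : z₁ τ < z₂ b := by
    refine (h1.isSwitch.mono (by linarith [hb.1]) hτ.2).lt hM (a := d + b) (fun t ht => ?_)
      (hcc b hb').2.1 ⟨hτ.1.le, le_rfl⟩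
    exact hM.G_nonpos (h1.isSub.pos t ⟨by linarith [ht.1, hb.1], ht.2.le.trans hτ.2⟩)
      (by linarith [hτ1 t ⟨ht.1.le, ht.2⟩]) (hs2.mem b hb').2 (hz₂ b hb').le hb0.le
  have hzlt : ∀ s ∈ Icc b T₂, z₁ (θ s) < z₂ s := by
    intro s hs
    -- Here w' + ρ g w = (1 − ρ) G(x₂, z₂), which is nonnegative after the turning point b.
    have := lin_pos_Ioo (w := fun s => z₂ s - z₁ (θ s)) (k := fun s => ρ s * M.g (x₂ s))
      (hρc.mul ((hs2.g_cont hM).mono hsub2))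
      ((hs2.z_cont.mono hsub2).sub (h1.isSwitch.z_cont.comp hθc hmaps))
      (fun t ht => ((hs2.deriv t (hbT t (Ioo_subset_Icc_self ht))).hasDerivAt
        (Icc_mem_nhds (hb.1.trans ht.1) ht.2)).sub (hz1d t ht))
      (fun t ht => by
        have ht' := Ioo_subset_Icc_self ht
        have h3 := mul_nonneg (sub_nonneg.2 (hρ1 t ht').le) (hGb' t ht')
        rw [G_sub _ (z₁ (θ t)) (z₂ t)]
        linarith) (by rw [hθb]; linarith) hs
    linarith
  -- the last time at which `λ` of the second trajectory is not increasing
  obtain ⟨a, ha, ha0, ha1⟩ : ∃ a ∈ Icc b T₂, z₂ a - M.κ * l₂ a ≤ 0 ∧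
      ∀ t ∈ Ioc a T₂, 0 ≤ z₂ t - M.κ * l₂ t := by
    rcases le_or_gt (z₂ T₂ - M.κ * l₂ T₂) 0 with h3 | h3
    · exact ⟨T₂, ⟨hb.2, le_rfl⟩, h3, fun t ht => absurd ht.1 (not_lt.2 ht.2)⟩
    -- v = z₂ − κ l₂ starts at r' − κ r = 0 and satisfies v' + κ v = G ≤ 0 up to b.
    · have hnb : z₂ b - M.κ * l₂ b ≤ 0 := by
        have := lin_nonneg (w := fun s => -(z₂ s - M.κ * l₂ s)) (k := fun _ => M.κ) (a := 0) (b := b)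
          continuousOn_const
          (fun u hu => (((hs2.mono le_rfl hb.2).deriv u hu).sub
            (((h2.mono hb.2).l_deriv' hu).const_mul M.κ)).neg)
          (fun u hu => by linarith [hGb u hu])
          (by simp only [h2.z_zero, h2.l_zero, r']; linarith) ⟨hb.1.le, le_rfl⟩
        linarith
      obtain ⟨a, ha, ha0, ha1⟩ := exists_last_zero (f := fun s => z₂ s - M.κ * l₂ s)
        ((hs2.z_cont.sub (continuousOn_const.mul hl2c)).mono hsub2) h3 hb.2 hnb
      exact ⟨a, Ico_subset_Icc_self ha, ha0.le, fun t ht => (ha1 t ht).le⟩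
  have ha' := hbT a ha
  have hdθ := hθlt a ha
  -- Both end values of z₁ are below z₂ a, so a larger value would yield an interior maximum; by
  -- `le_of_isMax` z₁ would not come down from it by the time θ a.
  have hzle : ∀ m ∈ Icc (d + a) (θ a), z₁ m ≤ z₂ a := by
    by_contra hc
    push Not at hc
    obtain ⟨m₀, hm₀, hm₀'⟩ := hc
    have hsub1 : Icc (d + a) (θ a) ⊆ Icc 0 T₁ :=
      Icc_subset_Icc (by linarith [ha'.1]) (hmaps ha).2
    obtain ⟨m, hm, hmax⟩ := isCompact_Icc.exists_isMaxOn ⟨m₀, hm₀⟩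
      (h1.isSwitch.z_cont.mono hsub1)
    have hmz : z₂ a < z₁ m := hm₀'.trans_le (hmax hm₀)
    have hml : d + a < m := hm.1.lt_of_ne fun he => by
      rw [← he] at hmz; linarith [(hcc a ha').2.1]
    have hmr : m < θ a := hm.2.lt_of_ne fun he => by
      rw [he] at hmz; linarith [hzlt a ha]
    have hm' := hsub1 hm
    have hG := (hmax.isLocalMax (Icc_mem_nhds hml hmr)).hasDerivAt_eq_zero
      ((h1.isSwitch.deriv m hm').hasDerivAt (Icc_mem_nhds (by linarith [ha'.1])
        (hmr.trans_le (hmaps ha).2)))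
    have := h1.le_of_isMax hM hK hQ (m := m) ⟨by linarith [ha'.1], hm'.2⟩ hG
      ((hz₂ a ha').trans hmz) (t := θ a) ⟨hmr.le, (hmaps ha).2⟩
    linarith [hzlt a ha]
  -- The constant l₂ a is an upper barrier for l₁ on this interval, as z₁ ≤ z₂ a ≤ κ l₂ a.
  have hla : l₁ (θ a) < l₂ a := by
    have hsub1 : Icc (d + a) (θ a) ⊆ Icc 0 T₁ :=
      Icc_subset_Icc (by linarith [ha'.1]) (hmaps ha).2
    have := lin_pos (w := fun s => l₂ a - l₁ s) (k := fun _ => M.κ) (a := d + a) (b := θ a)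
      continuousOn_const (fun u hu => ((h1.l_deriv u (hsub1 hu)).mono hsub1).const_sub (l₂ a))
      (fun u hu => by linarith [hzle u (Ioo_subset_Icc_self hu)])
      (by linarith [(hcc a ha').2.2]) ⟨hdθ.le, le_rfl⟩
    linarith
  have hsuba : Icc a T₂ ⊆ Icc b T₂ := Icc_subset_Icc_left ha.1
  -- Here w' + ρ κ w = (1 − ρ)(z₂ − κ l₂) + ρ (z₂ − z₁ ∘ θ), and both terms are nonnegative after a.
  have := lin_pos_Ioo (w := fun s => l₂ s - l₁ (θ s)) (k := fun s => ρ s * M.κ) (a := a) (b := T₂)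
    ((hρc.mono hsuba).mul continuousOn_const)
    ((hl2c.mono (hsuba.trans hsub2)).sub (hl1c.comp (hθc.mono hsuba) (hmaps.mono_left hsuba)))
    (fun t ht => by
      have ht2 : t ∈ Ioo b T₂ := ⟨ha.1.trans_lt ht.1, ht.2⟩
      exact ((h2.l_deriv' (hbT t (Ioo_subset_Icc_self ht2))).hasDerivAt
        (Icc_mem_nhds (hb.1.trans ht2.1) ht.2)).sub (hl1d t ht2))
    (fun t ht => by
      have ht2 : t ∈ Icc b T₂ := ⟨ha.1.trans ht.1.le, ht.2.le⟩
      have h3 := mul_nonneg (sub_nonneg.2 (hρ1 t ht2).le) (ha1 t ⟨ht.1, ht.2.le⟩)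
      have h4 := mul_pos (hρ0 t ht2) (sub_pos.2 (hzlt t ht2))
      linarith) (by linarith) (t := T₂) ⟨ha.2, le_rfl⟩
  rw [hθT] at this
  linarith

end Fishery

namespace Fishery
variable {M : Fishery}

/-! ### The threshold trajectory -/

/-- The backward trajectory on which the first zero of `z` is a double zero. -/
structure IsThresholdPath (M : Fishery) (Kt Kc σ : ℝ) (x z l : ℝ → ℝ) : Prop where
  K_pos : 0 < Kt
  K_lt : Kt < M.Kstar
  σ_pos : 0 < σ
  path : M.IsBackward Kt σ x z l
  z_pos : ∀ t ∈ Ico 0 σ, 0 < z t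
  z_eq : z σ = 0
  x_eq : x σ = M.xtil
  cap_eq : M.cap Kt σ = Kc

theorem IsThreshold.exists_path {Kt Kc : ℝ} (h : M.IsThreshold Kt Kc) :
    ∃ σ x z l, M.IsThresholdPath Kt Kc σ x z l := by
  obtain ⟨h1, σ, x, z, l, hσ, hb, -, hz, hz0, hP⟩ := h
  exact ⟨σ, x, z, l, h1.1, h1.2, hσ, hb, hz, hz0, (congrArg Prod.fst hP).symm,
    (congrArg Prod.snd hP).symm⟩

theorem IsBackward.switchPoint (hM : M.Assumptions) {K₁ σ : ℝ} {x z l : ℝ → ℝ} (hK : 0 < K₁)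
    (hσ : 0 < σ) (h : M.IsBackward K₁ σ x z l) (hz : ∀ t ∈ Ico 0 σ, 0 < z t) (hz0 : z σ = 0)
    (hx : x σ ≤ M.xtil) : M.IsSwitchPoint K₁ (x σ, M.cap K₁ σ) := by
  refine ⟨σ, x, z, l, hσ, h, fun t ht => ?_, hz, hz0, rfl⟩
  have hx' := hx.trans_lt hM.xtil_lt_xstar
  rcases ht.2.eq_or_lt with h1 | h1
  · rwa [h1]
  · exact h.lt_xstar hM hK ⟨ht.1, h1⟩ le_rfl hx'.le

namespace IsThresholdPath

variable {Kt Kc σ : ℝ} {x z l : ℝ → ℝ}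

theorem phi_le (hM : M.Assumptions) (h : M.IsThresholdPath Kt Kc σ x z l) :
    M.phi M.xtil ≤ Kc := by
  rw [← h.cap_eq]
  exact h.path.isFull.phi_xtil_le_cap hM h.K_pos h.path.isSwitch h.σ_pos
    (by rw [h.path.z_zero]; exact hM.r'_pos.le) h.z_eq h.x_eq

theorem Kstar_lt (hM : M.Assumptions) (h : M.IsThresholdPath Kt Kc σ x z l) : M.Kstar < Kc :=
  hM.Kstar_lt.trans_le (h.phi_le hM)

theorem Kc_pos (hM : M.Assumptions) (h : M.IsThresholdPath Kt Kc σ x z l) : 0 < Kc :=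
  hM.Kstar_pos.trans (h.Kstar_lt hM)

theorem z_nonneg (h : M.IsThresholdPath Kt Kc σ x z l) {t : ℝ} (ht : t ∈ Icc 0 σ) : 0 ≤ z t := by
  rcases ht.2.eq_or_lt with h1 | h1
  · rw [h1, h.z_eq]
  · exact (h.z_pos t ⟨ht.1, h1⟩).le

theorem isSubpath (hM : M.Assumptions) (h : M.IsThresholdPath Kt Kc σ x z l) :
    M.IsSubpath Kt σ x z l := h.path.isSubpath hM h.K_pos fun _ ht => h.z_nonneg ht

variable {K₁ T : ℝ} {X Z L : ℝ → ℝ}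

/-- At and after the clock `Kc`, a trajectory with larger initial capital is to the right of the
line `x = xtil`. -/
theorem xtil_lt (hM : M.Assumptions) (h : M.IsThresholdPath Kt Kc σ x z l) (hK : Kt < K₁)
    (hK' : K₁ < M.Kstar) (h2 : M.IsBackward K₁ T X Z L) :
    ∃ s, 0 ≤ s ∧ M.cap K₁ s = Kc ∧ (∀ t ∈ Icc 0 T, t ≤ s → 0 < Z t) ∧
      ∀ t ∈ Icc s T, M.xtil < X t := by
  have hK1 := h.K_pos.trans hK
  obtain ⟨d, -, hd⟩ := hM.exists_cap_eq h.K_pos hK.le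
  have hdσ : d < σ := by
    rw [← hM.cap_lt_iff h.K_pos, hd, h.cap_eq]
    exact hK'.trans (h.Kstar_lt hM)
  have hs : M.cap K₁ (σ - d) = Kc := by
    rw [← hd, ← cap_add, add_sub_cancel, h.cap_eq]
  refine ⟨σ - d, by linarith, hs, fun t ht hts => ?_, ?_⟩
  · have := ((h.isSubpath hM).lt_of_cap hM h.K_pos hK hK'.le hd h2 ht.1 (by linarith) ht.2).2.1
    have hd0 : 0 < d := by rw [← hM.cap_lt_iff h.K_pos, cap_zero, hd]; exact hK
    exact (h.z_nonneg ⟨by linarith [ht.1], by linarith⟩).trans_lt this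
  · intro t ht
    have hsT := ht.1.trans ht.2
    have h3 := ((h.isSubpath hM).lt_of_cap hM h.K_pos hK hK'.le hd h2 (s := σ - d) (by linarith)
      (by linarith) hsT).1
    rw [add_sub_cancel, h.x_eq] at h3
    rcases ht.1.eq_or_lt with h4 | h4
    · rwa [← h4]
    · refine h3.trans (h2.isFull.lt_of_ascending hM hK1 (by linarith) ?_ ⟨h4, ht.2⟩)
      rw [hs]
      exact (hM.phi_le hM.xtil_mem.1 h3.le (h2.x_mem _ ⟨by linarith, hsT⟩).2).trans (h.phi_le hM)

/-- Until the capital is Kc, comparison with the threshold path keeps Z positive; afterwards X >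
xtil, where ψ > 0 prevents a zero. -/
theorem z_pos_of_lt (hM : M.Assumptions) (h : M.IsThresholdPath Kt Kc σ x z l) (hK : Kt < K₁)
    (hK' : K₁ < M.Kstar) (h2 : M.IsBackward K₁ T X Z L) {t : ℝ} (ht : t ∈ Icc 0 T) : 0 < Z t := by
  obtain ⟨s, hs0, hs, h3, h4⟩ := h.xtil_lt hM hK hK' h2
  rcases le_total t s with h5 | h5
  · exact h3 t ht h5
  · have hsT := h5.trans ht.2
    refine (h2.isSwitch.mono hs0 le_rfl).gt hM (fun u hu => ?_) (h3 s ⟨hs0, hsT⟩ le_rfl) ⟨h5, ht.2⟩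
    rw [IsSwitch.G_zero]
    exact (hM.ψ_pos' (h4 u ⟨hu.1.le, hu.2.le⟩) (h2.x_mem u ⟨hs0.trans hu.1.le, hu.2.le⟩).2).le

/-- Otherwise the path would pass the capital Kc, at which the threshold path has z = 0, and its own
Z would be negative there. -/
theorem cap_lt_of_lt (hM : M.Assumptions) (h : M.IsThresholdPath Kt Kc σ x z l) (hK : 0 < K₁)
    (hK' : K₁ < Kt) (h2 : M.IsSubpath K₁ T X Z L) : M.cap K₁ T < Kc := by
  by_contra hc
  obtain ⟨d, hd0, hd⟩ := hM.exists_cap_eq hK hK'.le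
  have hdσ : d + σ ≤ T := by
    by_contra hc'
    have := hM.cap_lt hK (not_le.1 hc')
    rw [cap_add, hd, h.cap_eq] at this
    exact hc this
  have h3 := (h2.lt_of_cap hM hK hK' h.K_lt.le hd h.path h.σ_pos.le hdσ le_rfl).2.1
  rw [h.z_eq] at h3
  linarith [h2.z_nonneg (d + σ) ⟨by linarith [h.σ_pos], hdσ⟩]

theorem eq_of_first_zero (hM : M.Assumptions) (h : M.IsThresholdPath Kt Kc σ x z l) {s : ℝ}
    (hs : 0 < s) (h2 : M.IsBackward Kt s X Z L) (hz : ∀ t ∈ Ico 0 s, 0 < Z t) (hz0 : Z s = 0) :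
    s = σ ∧ X s = M.xtil := by
  rcases lt_trichotomy s σ with h3 | h3 | h3
  · have := (h.path.eqOn hM h.K_pos h2 hs.le h3.le le_rfl).2
    linarith [h.z_pos s ⟨hs.le, h3⟩]
  · subst h3
    exact ⟨rfl, by rw [← (h.path.eqOn hM h.K_pos h2 hs.le le_rfl le_rfl).1, h.x_eq]⟩
  · have := (h.path.eqOn hM h.K_pos h2 h.σ_pos.le le_rfl h3.le).2
    linarith [hz σ ⟨h.σ_pos.le, h3⟩, h.z_eq]

theorem not_lt (hM : M.Assumptions) {Kt' Kc' σ' : ℝ} {x' z' l' : ℝ → ℝ}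
    (h : M.IsThresholdPath Kt Kc σ x z l) (h' : M.IsThresholdPath Kt' Kc' σ' x' z' l') :
    ¬ Kt < Kt' := fun hlt => by
  have := h.z_pos_of_lt hM hlt h'.K_lt h'.path (t := σ') ⟨h'.σ_pos.le, le_rfl⟩
  exact this.ne' h'.z_eq

/-- A larger initial capital keeps z positive, so of two thresholds neither can exceed the other.
Thus `Γ₃`, `Γ₄` and `Σ_s` all refer to the same end point of `Σ₀`. -/
theorem unique (hM : M.Assumptions) {Kt' Kc' σ' : ℝ} {x' z' l' : ℝ → ℝ}
    (h : M.IsThresholdPath Kt Kc σ x z l) (h' : M.IsThresholdPath Kt' Kc' σ' x' z' l') :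
    Kt = Kt' ∧ Kc = Kc' ∧ σ = σ' := by
  have h1 : Kt = Kt' := le_antisymm (_root_.not_lt.1 (h'.not_lt hM h)) (_root_.not_lt.1 (h.not_lt hM h'))
  subst h1
  have h2 := (h.eq_of_first_zero hM h'.σ_pos h'.path h'.z_pos h'.z_eq).1
  subst h2
  exact ⟨rfl, by rw [← h.cap_eq, h'.cap_eq], rfl⟩

theorem lt_of_first_zero (hM : M.Assumptions) (h : M.IsThresholdPath Kt Kc σ x z l) {s : ℝ}
    (hK : 0 < K₁) (hK' : K₁ < M.Kstar) (hs : 0 < s) (h2 : M.IsBackward K₁ s X Z L)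
    (hz : ∀ t ∈ Ico 0 s, 0 < Z t) (hz0 : Z s = 0) (hx : X s < M.xtil) :
    K₁ < Kt ∧ M.cap K₁ s < Kc := by
  rcases lt_trichotomy K₁ Kt with h3 | h3 | h3
  · refine ⟨h3, h.cap_lt_of_lt hM hK h3 (h2.isSubpath hM hK fun t ht => ?_)⟩
    rcases ht.2.eq_or_lt with h4 | h4
    · rw [h4, hz0]
    · exact (hz t ⟨ht.1, h4⟩).le
  · subst h3
    exact absurd (h.eq_of_first_zero hM hs h2 hz hz0).2 hx.ne
  · exact absurd hz0 (h.z_pos_of_lt hM h3 hK' h2 ⟨hs.le, le_rfl⟩).ne'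

theorem cap_lt_of_pos (hM : M.Assumptions) (h : M.IsThresholdPath Kt Kc σ x z l) (hK : 0 < K₁)
    (hK' : K₁ ≤ Kt) (h2 : M.IsBackward K₁ T X Z L) (hz : ∀ t ∈ Icc 0 T, 0 < Z t) :
    M.cap K₁ T < Kc := by
  rcases hK'.eq_or_lt with h3 | h3
  · subst h3
    rw [← h.cap_eq, hM.cap_lt_iff hK]
    by_contra hc
    have := (h.path.eqOn hM h.K_pos h2 h.σ_pos.le le_rfl (_root_.not_lt.1 hc)).2
    linarith [hz σ ⟨h.σ_pos.le, _root_.not_lt.1 hc⟩, h.z_eq]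
  · exact h.cap_lt_of_lt hM hK h3 (h2.isSubpath hM hK fun t ht => (hz t ht).le)

end IsThresholdPath

/-! ### The curves `Σ_s`, `Γ₃`, `Γ₄` -/

theorem exists_of_mem_Gamma3 (hM : M.Assumptions) {P : ℝ × ℝ} (h : P ∈ M.Gamma3) :
    ∃ Kt Kc T y, M.IsThreshold Kt Kc ∧ 0 ≤ T ∧ M.IsFull Kc y 0 T ∧ y 0 = M.xtil ∧
      P = (y T, M.cap Kc T) := by
  obtain ⟨Kt, Kc, T, y, h1, h2, h3, h4, h5, h6⟩ := h
  exact ⟨Kt, Kc, T, y, h1, h2, ⟨fun t ht => ⟨hM.xtil_mem.1.trans_le (h4 t ht).1, (h4 t ht).2⟩, h5⟩,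
    h3, h6⟩

theorem isFull_zero {y : ℝ → ℝ} {a b : ℝ} (hm : ∀ t ∈ Icc a b, y t ∈ Ioc 0 M.xbar)
    (h : ∀ t ∈ Icc a b, HasDerivWithinAt y (-M.F (y t)) (Icc a b) t) : M.IsFull 0 y a b :=
  ⟨hm, fun t ht => (h t ht).congr_deriv (by simp [cap])⟩

theorem exists_of_mem_Gamma4 (hM : M.Assumptions) {P : ℝ × ℝ} (h : P ∈ M.Gamma4) :
    ∃ Kt Kc T y, M.IsThreshold Kt Kc ∧ 0 ≤ T ∧ M.IsFull 0 y 0 T ∧ StrictAntiOn y (Icc 0 T) ∧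
      y 0 = M.xtil ∧ P = (y T, M.cap Kc T) := by
  obtain ⟨Kt, Kc, T, y, h1, h2, h3, h4, h5, h6⟩ := h
  have hm : ∀ t ∈ Icc 0 T, y t ∈ Ioc 0 M.xbar := fun t ht =>
    ⟨(h4 t ht).1, (h4 t ht).2.trans hM.xtil_mem.2.le⟩
  exact ⟨Kt, Kc, T, y, h1, h2, isFull_zero hm h5,
    idle_strictAntiOn hM hm h5 (by rw [h3]; exact hM.xtil_mem.2), h3, h6⟩

/-- The point is the strict inequality Kt < K₁: beyond (xtil, Kc) the threshold path runs along
`Γ₃`, so K₁ = Kt would give a common point of `Σ_s` and `Γ₃` with x < xbar. -/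
theorem exists_of_mem_SigmaS (hM : M.Assumptions) (hno : M.NoIntersection) {ξ h : ℝ}
    (hmem : (ξ, h) ∈ M.SigmaS) (h1 : M.xstar < ξ) (h2 : ξ < M.xbar) :
    ∃ Kt Kc σ xt zt lt K₁ τ x z l, M.IsThresholdPath Kt Kc σ xt zt lt ∧ Kt < K₁ ∧ K₁ < M.Kstar ∧
      0 < τ ∧ M.IsBackward K₁ τ x z l ∧ l τ = M.r ∧ x τ = ξ ∧ h = M.cap K₁ τ := by
  have hmem' := hmem
  rcases hmem with h3 | ⟨Kt, Kc, K₁, τ, x, z, l, hth, hK, hτ, hb, -, hl, hP⟩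
  · exact absurd (congrArg Prod.fst h3) h1.ne'
  have hx : x τ = ξ := (congrArg Prod.fst hP).symm
  have hcap : h = M.cap K₁ τ := congrArg Prod.snd hP
  obtain ⟨σ, xt, zt, lt, ht⟩ := hth.exists_path
  refine ⟨Kt, Kc, σ, xt, zt, lt, K₁, τ, x, z, l, ht, ?_, hK.2, hτ, hb, hl, hx, hcap⟩
  refine hK.1.lt_of_ne fun he => ?_
  subst he
  have hστ : σ < τ := by
    by_contra hc
    have h3 := (ht.path.eqOn hM ht.K_pos hb hτ.le (not_lt.1 hc) le_rfl).1
    have h4 : xt τ ≤ M.xstar := ht.path.isFull.le_of_le_of_le hM ht.K_pos ⟨hτ.le, not_lt.1 hc⟩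
      ht.path.x_zero.le (by rw [ht.x_eq]; exact hM.xtil_lt_xstar.le)
    linarith
  have hxσ := (ht.path.eqOn hM ht.K_pos hb ht.σ_pos.le le_rfl hστ.le).1
  rw [ht.x_eq] at hxσ
  refine hno (ξ, h) ⟨hmem', Kt, Kc, τ - σ, fun s => x (σ + s), hth, by linarith, by simp [← hxσ],
    fun t htt => ?_, fun t htt => ?_, ?_⟩ h2
  · refine ⟨?_, (hb.x_mem _ ⟨by linarith [ht.σ_pos, htt.1], by linarith [htt.2]⟩).2⟩
    rcases htt.1.eq_or_lt with h5 | h5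
    · simp only [← h5, add_zero, hxσ, le_refl]
    · change M.xtil ≤ x (σ + t)
      rw [hxσ]
      refine (hb.isFull.lt_of_ascending hM ht.K_pos ht.σ_pos.le ?_
        ⟨by linarith, by linarith [htt.2]⟩).le
      rw [← hxσ, ht.cap_eq]
      exact ht.phi_le hM
  · have := ((hb.isFull.mono (a' := σ + 0) (by linarith [ht.σ_pos]) (b' := σ + (τ - σ)) (by linarith)).shift
      (a := 0) (d := σ) (K₁ := Kt)) |>.deriv t htt
    rw [ht.cap_eq] at this
    exact this
  · simp only [add_sub_cancel, hx, hcap]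
    congr 1
    change M.cap Kt τ = M.cap Kc (τ - σ)
    rw [← ht.cap_eq, ← cap_add, add_sub_cancel]

/-- A larger initial capital leads to a smaller capital at a given stock to the right of
`x = x^*`. -/
theorem IsSub.cap_lt_cap (hM : M.Assumptions) {K₁ K₂ T₁ T₂ : ℝ} {x₁ x₂ z₂ l₂ : ℝ → ℝ}
    (hK : 0 < K₁) (hK' : K₁ < K₂) (hK₂ : K₂ ≤ M.Kstar) (hT₁ : 0 ≤ T₁)
    (h1 : M.IsSub K₁ x₁ 0 T₁) (hx1 : x₁ 0 = M.xstar) (h2 : M.IsBackward K₂ T₂ x₂ z₂ l₂)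
    (hx : x₁ T₁ = x₂ T₂) (hX : M.xstar < x₂ T₂) : M.cap K₂ T₂ < M.cap K₁ T₁ := by
  obtain ⟨d, -, hd⟩ := hM.exists_cap_eq hK hK'.le
  have hd0 : 0 < d := by
    rw [← hM.cap_lt_iff hK, cap_zero, hd]; exact hK'
  rw [← hd, ← cap_add, hM.cap_lt_iff hK]
  by_contra hc
  rcases le_or_gt T₁ d with h | h
  · rcases hT₁.eq_or_lt with h0 | h0
    · rw [← h0, hx1] at hx; linarith
    · have := h1.lt_xstar hM hK hx1 h0 ((hM.cap_le hK h).trans (hd.le.trans hK₂))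
      linarith
  · have h3 := IsSub.lt_of_cap hM hK hK' hK₂ hd (s := T₁ - d) (by linarith)
      (by rwa [add_sub_cancel]) hx1 ((h2.isFull.mono le_rfl (by linarith)).isSuper hM) h2.x_zero
    rw [add_sub_cancel] at h3
    rcases (show T₁ - d ≤ T₂ by linarith).eq_or_lt with h4 | h4
    · rw [h4] at h3; linarith
    · linarith [h2.lt_of_xstar_lt hM (hK.trans hK') ⟨by linarith, h4⟩ le_rfl hX]

end Fishery

namespace Fishery
variable {M : Fishery}

/-! ### Trajectories reaching `Σ^*` from a given state -/

namespace IsExtremal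

variable {K₁ T : ℝ} {x z l : ℝ → ℝ}

theorem isBackward (h : M.IsExtremal K₁ T x z l) (hx : x 0 = M.xstar) {σ : ℝ} (hσ : σ ≤ T)
    (hz : ∀ t ∈ Ioo 0 σ, 0 < z t) (hz' : ∀ t ∈ Icc 0 σ, 0 ≤ z t) : M.IsBackward K₁ σ x z l := by
  have hf := h.full 0 σ le_rfl hσ hz
  have hs := h.isSwitch.mono (le_refl 0) hσ
  refine ⟨hx, h.z_zero, h.l_zero, hf.mem, hf.deriv, fun t ht => (hs.deriv t ht).congr_deriv (by
    rw [G_eq_ψstar]; ring), fun t ht => ?_⟩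
  refine ((h.l_deriv t ⟨ht.1, ht.2.trans hσ⟩).mono (Icc_subset_Icc_right hσ)).congr_deriv ?_
  rw [max_eq_left (hz' t ht), r']
  ring

theorem idle_isSub (hM : M.Assumptions) (h : M.IsExtremal K₁ T x z l) {a b : ℝ} (ha : 0 ≤ a)
    (hb : b ≤ T) (hz : ∀ t ∈ Ioo a b, z t < 0) : M.IsSub K₁ x a b := by
  have hm : ∀ t ∈ Icc a b, x t ∈ Ioc 0 M.xbar := fun t ht =>
    h.isSwitch.mem t ⟨ha.trans ht.1, ht.2.trans hb⟩
  refine isSub_of_deriv_le hM hm (h.idle a b ha hb hz) fun t ht => ?_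
  rw [F_eq (hm t ht).1.ne']
  linarith [mul_pos (hm t ht).1 (cap_pos (M := M) h.K_pos t)]

theorem idle_anti (hM : M.Assumptions) (h : M.IsExtremal K₁ T x z l) {a b : ℝ} (ha : 0 ≤ a)
    (hb : b ≤ T) (hz : ∀ t ∈ Ioo a b, z t < 0) (hx : x a ≤ M.xtil) : StrictAntiOn x (Icc a b) :=
  idle_strictAntiOn hM (fun t ht => h.isSwitch.mem t ⟨ha.trans ht.1, ht.2.trans hb⟩)
    (h.idle a b ha hb hz) (hx.trans_lt hM.xtil_mem.2)

theorem const_isSub (hM : M.Assumptions) (h : M.IsExtremal K₁ T x z l) {a b : ℝ}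
    (hx : ∀ t ∈ Icc a b, x t = M.xtil) (hcap : M.phi M.xtil ≤ M.cap K₁ a) : M.IsSub K₁ x a b := by
  refine isSub_of_deriv_le hM (x' := fun _ => 0) (fun t ht => ?_)
    (fun t ht => (hasDerivWithinAt_const t _ M.xtil).congr hx (hx t ht)) fun t ht => ?_
  · rw [hx t ht]; exact ⟨hM.xtil_mem.1, hM.xtil_mem.2.le⟩
  · rw [hx t ht]
    exact mul_nonneg hM.xtil_mem.1.le (by linarith [hM.cap_le h.K_pos ht.1])

/-- Each phase, whether of full effort, rest or idleness, keeps the stock below x^*, because the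
values at its ends do not exceed x^*. -/
theorem lt_xstar (hM : M.Assumptions) (h : M.IsExtremal K₁ T x z l) (hx : x T ≤ M.xstar)
    {t : ℝ} (ht : t ∈ Ioo 0 T) : x t < M.xstar := by
  have hK := h.K_pos
  rcases h.cases hM with h1 | ⟨σ, hσ, -, hz, hafter⟩
  · exact (h.full 0 T le_rfl le_rfl fun t ht => h1 t (Ioo_subset_Icc_self ht)).lt_of_le_of_le hM hK
      ht h.x_zero hx
  have hts := hM.xtil_lt_xstar
  have hσ0 := hσ.1.le
  rcases lt_or_ge t σ with htσ | htσ
  · refine (h.full 0 σ le_rfl hσ.2 fun t ht => hz t ⟨ht.1.le, ht.2⟩).lt_of_le_of_le hM hK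
      ⟨ht.1, htσ⟩ h.x_zero ?_
    rcases hafter with h1 | h1
    · exact (h1.1.trans hts).le
    · exact h1.1.le.trans hts.le
  have hidle : ∀ a, 0 ≤ a → x a ≤ M.xtil → a ≤ t → (∀ t ∈ Ioc a T, z t < 0) → x t < M.xstar :=
    fun a ha hxa hat hz => (((h.idle_anti hM ha le_rfl
      (fun t ht => hz t ⟨ht.1, ht.2.le⟩) hxa).antitoneOn ⟨le_rfl, hat.trans ht.2.le⟩
        ⟨hat, ht.2.le⟩ hat).trans hxa).trans_lt hts
  rcases hafter with ⟨h1, h2⟩ | ⟨-, h2, σ₂, h3, h4, h5⟩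
  · exact hidle σ hσ0 h1.le htσ h2
  · rcases le_total t σ₂ with h6 | h6
    · rw [(h4 t ⟨htσ, h6⟩).1]; exact hts
    have hxσ₂ := (h4 σ₂ ⟨h3.1, le_rfl⟩).1
    rcases h5 with h5 | h5
    · exact hidle σ₂ (hσ0.trans h3.1) hxσ₂.le h6 h5
    · rcases h6.eq_or_lt with h7 | h7
      · rw [← h7, hxσ₂]; exact hts
      exact (h.full σ₂ T (hσ0.trans h3.1) le_rfl
        fun t ht => h5 t ⟨ht.1, ht.2.le⟩).lt_of_le_of_le hM hK ⟨h7, ht.2⟩ (by rw [hxσ₂]; exact hts.le)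
          hx

/-- To the left of x^* one has ψ_* < 0, which keeps z below r' and thereby λ below r. So an initial
jump is possible only to the right of x^*. -/
theorem l_lt_of_le (hM : M.Assumptions) (h : M.IsExtremal K₁ T x z l) (hx : x T ≤ M.xstar) :
    l T < M.r := by
  refine l_lt_r h.l_deriv (fun t ht => max_lt ?_ hM.r'_pos) h.l_zero.le h.T_pos
  exact (h.isSwitch.mono le_rfl ht.2.le).lt_r' hM ht.1 h.z_zero.le
    fun u hu => h.lt_xstar hM hx ⟨hu.1, hu.2.trans ht.2⟩

end IsExtremal

/-- Backwards in time from its arrival on `Σ^*`, the part of an optimal process which joins the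
initial state `(x₀, K₀)` to `Σ^*`. -/
structure IsApproach (M : Fishery) (x₀ K₀ K₁ τ : ℝ) (x z l : ℝ → ℝ) : Prop where
  ext : M.IsExtremal K₁ τ x z l
  K_lt : K₁ < M.Kstar
  x_zero : x 0 = M.xstar
  l_le : l τ ≤ M.r
  x_end : x τ = x₀
  K_le : K₀ ≤ M.cap K₁ τ
  K_eq : l τ < M.r → M.cap K₁ τ = K₀

/-- The trajectory has a first zero `σ` of `z`. -/
structure IsDelayed (M : Fishery) (K₁ τ σ : ℝ) (x z l : ℝ → ℝ) : Prop where
  σ_pos : 0 < σ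
  σ_le : σ ≤ τ
  z_eq : z σ = 0
  z_pos : ∀ t ∈ Ico 0 σ, 0 < z t
  back : M.IsBackward K₁ σ x z l
  after : IsExtremal.AfterZero M K₁ τ x z σ

namespace IsDelayed

variable {K₁ τ σ : ℝ} {x z l : ℝ → ℝ}

theorem z_nonneg (h : M.IsDelayed K₁ τ σ x z l) {t : ℝ} (ht : t ∈ Icc 0 σ) : 0 ≤ z t := by
  rcases ht.2.eq_or_lt with h1 | h1
  · rw [h1, h.z_eq]
  · exact (h.z_pos t ⟨ht.1, h1⟩).le

theorem x_le (h : M.IsDelayed K₁ τ σ x z l) : x σ ≤ M.xtil := by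
  rcases h.after with h1 | h1
  · exact h1.1.le
  · exact h1.1.le

theorem switchPoint (hM : M.Assumptions) (hK : 0 < K₁) (h : M.IsDelayed K₁ τ σ x z l) :
    M.IsSwitchPoint K₁ (x σ, M.cap K₁ σ) :=
  h.back.switchPoint hM hK h.σ_pos h.z_pos h.z_eq h.x_le

end IsDelayed

namespace IsApproach

variable {x₀ K₀ K₁ τ σ : ℝ} {x z l : ℝ → ℝ}

theorem cases (hM : M.Assumptions) (h : M.IsApproach x₀ K₀ K₁ τ x z l) :
    (M.IsBackward K₁ τ x z l ∧ ∀ t ∈ Icc 0 τ, 0 < z t) ∨ ∃ σ, M.IsDelayed K₁ τ σ x z l := by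
  rcases h.ext.cases hM with h1 | ⟨σ, h1, h2, h3, h4⟩
  · exact .inl ⟨h.ext.isBackward h.x_zero le_rfl (fun t ht => h1 t (Ioo_subset_Icc_self ht))
      fun t ht => (h1 t ht).le, h1⟩
  · refine .inr ⟨σ, h1.1, h1.2, h2, h3, h.ext.isBackward h.x_zero h1.2
      (fun t ht => h3 t ⟨ht.1.le, ht.2⟩) (fun t ht => ?_), h4⟩
    rcases ht.2.eq_or_lt with h5 | h5
    · rw [h5, h2]
    · exact (h3 t ⟨ht.1, h5⟩).le

/-- The three possible continuations after the first zero of `z`. -/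
theorem isSub (hM : M.Assumptions) (h : M.IsApproach x₀ K₀ K₁ τ x z l)
    (hd : M.IsDelayed K₁ τ σ x z l) : M.IsSub K₁ x 0 τ := by
  refine (hd.back.isFull.isSub hM).append hM ?_ hd.σ_pos.le hd.σ_le
  rcases hd.after with ⟨-, h2⟩ | ⟨-, h2, σ₂, h3, h4, h5⟩
  · exact h.ext.idle_isSub hM hd.σ_pos.le le_rfl fun t ht => h2 t ⟨ht.1, ht.2.le⟩
  · refine (h.ext.const_isSub hM (fun t ht => (h4 t ht).1) h2).append hM ?_ h3.1 h3.2
    have hσ₂ := hd.σ_pos.le.trans h3.1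
    rcases h5 with h5 | h5
    · exact h.ext.idle_isSub hM hσ₂ le_rfl fun t ht => h5 t ⟨ht.1, ht.2.le⟩
    · exact (h.ext.full σ₂ τ hσ₂ le_rfl fun t ht => h5 t ⟨ht.1, ht.2.le⟩).isSub hM

theorem l_lt_of_le (hM : M.Assumptions) (h : M.IsApproach x₀ K₀ K₁ τ x z l)
    (hx : x₀ ≤ M.xstar) : l τ < M.r := h.ext.l_lt_of_le hM (h.x_end.le.trans hx)

/-- The trajectory leaves the line `x = xtil` to the right. -/
theorem isSubpath (hM : M.Assumptions) (h : M.IsApproach x₀ K₀ K₁ τ x z l)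
    (hd : M.IsDelayed K₁ τ σ x z l) (hx : M.xtil < x₀) :
    x σ = M.xtil ∧ ∃ σ₂ ∈ Ico σ τ, (∀ t ∈ Icc σ σ₂, x t = M.xtil) ∧
      (∀ t ∈ Ioc σ₂ τ, 0 < z t) ∧ M.IsFull K₁ x σ₂ τ ∧
      M.IsSubpath K₁ τ x z l ∧ M.FullBeyond K₁ τ x := by
  have hσ0 := hd.σ_pos.le
  have hK := h.ext.K_pos
  -- A final phase without effort would end at a stock at most xtil.
  have hidle : ∀ a, 0 ≤ a → a ≤ τ → x a ≤ M.xtil → (∀ t ∈ Ioc a τ, z t < 0) → False := by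
    intro a ha haτ hxa hz
    have := ((h.ext.idle_anti hM ha le_rfl (fun t ht => hz t ⟨ht.1, ht.2.le⟩) hxa).antitoneOn
      ⟨le_rfl, haτ⟩ ⟨haτ, le_rfl⟩ haτ).trans hxa
    rw [h.x_end] at this
    exact absurd this (not_le.2 hx)
  rcases hd.after with ⟨h1, h2⟩ | ⟨h1, h2, σ₂, h3, h4, h5⟩
  · exact (hidle σ hσ0 hd.σ_le h1.le h2).elim
  refine ⟨h1, ?_⟩
  have hxσ₂ := (h4 σ₂ ⟨h3.1, le_rfl⟩).1
  have hσ₂ := hσ0.trans h3.1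
  rcases h5 with h5 | h5
  · exact (hidle σ₂ hσ₂ h3.2 hxσ₂.le h5).elim
  have hlt : σ₂ < τ := h3.2.lt_of_ne fun he => by
    rw [he, h.x_end] at hxσ₂
    exact hx.ne' hxσ₂
  have hfull := h.ext.full σ₂ τ hσ₂ le_rfl fun t ht => h5 t ⟨ht.1, ht.2.le⟩
  have hcapσ₂ : M.phi (x σ₂) ≤ M.cap K₁ σ₂ := by
    rw [hxσ₂]; exact h2.trans (hM.cap_le hK h3.1)
  have hz : ∀ t ∈ Icc 0 τ, 0 ≤ z t := fun t ht => by
    rcases le_total t σ with h6 | h6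
    · exact hd.z_nonneg ⟨ht.1, h6⟩
    rcases le_or_gt t σ₂ with h7 | h7
    · rw [(h4 t ⟨h6, h7⟩).2]
    · exact (h5 t ⟨h7, ht.2⟩).le
  have hp : 0 < M.p * M.xtil - M.c := by
    have := hd.back.lt_profit hM hK (t := σ) ⟨hσ0, le_rfl⟩
    rwa [hd.z_eq, h1] at this
  refine ⟨σ₂, ⟨h3.1, hlt⟩, fun t ht => (h4 t ht).1, h5, hfull, ⟨h.isSub hM hd, h.ext.isSwitch,
    fun t ht => ?_, hz, fun t ht => ?_, h.x_zero, h.ext.z_zero, h.ext.l_zero⟩, fun m hm hxm => ?_⟩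
  · have := h.ext.l_deriv t ht
    rwa [max_eq_left (hz t ht)] at this
  · rcases le_total t σ with h6 | h6
    · exact (hd.back.lt_profit hM hK ⟨ht.1, h6⟩).le
    rcases le_total t σ₂ with h7 | h7
    · rw [(h4 t ⟨h6, h7⟩).1, (h4 t ⟨h6, h7⟩).2]; exact hp.le
    · refine ((h.ext.isSwitch.mono hσ₂ le_rfl).lt_profit hM hK hfull ?_ ⟨h7, ht.2⟩).le
      rw [hxσ₂, (h4 σ₂ ⟨h3.1, le_rfl⟩).2]
      exact hp
  -- Before σ an ascending stock would be below x σ = xtil, so there only the descending alternative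
  -- occurs; after the rest on xtil the stock is always ascending.
  · rcases lt_or_ge m σ with h6 | h6
    · refine ⟨fun hc => ?_, fun _ => hd.back.isFull.mono le_rfl h6.le⟩
      have := hd.back.isFull.lt_of_ascending hM hK hm.1 hc ⟨h6, le_rfl⟩
      rw [h1] at this
      exact absurd hxm (not_lt.2 this.le)
    rcases le_or_gt m σ₂ with h7 | h7
    · rw [(h4 m ⟨h6, h7⟩).1] at hxm
      exact absurd hxm (lt_irrefl _)
    · refine ⟨fun _ => hfull.mono h7.le le_rfl, fun hc => ?_⟩
      exact absurd (hfull.excess_pos hM hK le_rfl hcapσ₂ ⟨h7, hm.2⟩) (not_lt.2 hc.le)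

/-- A trajectory with a zero of `z` on the line `x = xtil` is a threshold trajectory. -/
theorem isThresholdPath (h : M.IsApproach x₀ K₀ K₁ τ x z l)
    (hd : M.IsDelayed K₁ τ σ x z l) (hx : x σ = M.xtil) :
    M.IsThresholdPath K₁ (M.cap K₁ σ) σ x z l :=
  ⟨h.ext.K_pos, h.K_lt, hd.σ_pos, hd.back, hd.z_pos, hd.z_eq, hx, rfl⟩

/-- A path with a zero of z that ends to the right of x^* is the threshold path, prolonged after a
possible rest. Over the same stock `Σ_s` provides a path with larger initial capital and λ = r, and
the smaller initial capital has the smaller λ. -/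
theorem l_lt_of_delayed (hM : M.Assumptions) (hno : M.NoIntersection)
    (hreach : M.JumpCurveReaches) (h : M.IsApproach x₀ K₀ K₁ τ x z l)
    (hd : M.IsDelayed K₁ τ σ x z l) (hxb : x₀ < M.xbar) : l τ < M.r := by
  rcases le_or_gt x₀ M.xstar with h1 | h1
  · exact h.l_lt_of_le hM h1
  obtain ⟨hx, σ₂, h3, h4, h5, h6, h7, h8⟩ := h.isSubpath hM hd (hM.xtil_lt_xstar.trans h1)
  obtain ⟨η, -, hη⟩ := hreach
  obtain ⟨Kt, Kc, σt, xt, zt, lt, K₂, τ₂, x₂, z₂, l₂, ht, hK, hK₂, hτ₂, hb, hl, hx2, -⟩ :=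
    exists_of_mem_SigmaS hM hno (hη x₀ ⟨h1.le, hxb.le⟩) h1 hxb
  have := (h.isThresholdPath hd hx).unique hM ht
  have hlt := h7.l_lt_of_x_eq hM h.ext.K_pos (by rw [this.1]; exact hK) hK₂ h.ext.T_pos.le hτ₂ hb
    h8 (by rw [h.x_end, hx2]) (by rw [hx2]; exact h1)
  rwa [hl] at hlt

end IsApproach
end Fishery

/-! ### Flows depending continuously on a parameter. -/

/-- Solutions of `y' = k e(s) - H(y)` depending continuously on the parameter `k`. -/
theorem exists_flow {H e : ℝ → ℝ} {L : NNReal} (hL : LipschitzWith L H) {C : ℝ}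
    (hC : ∀ y, |H y| ≤ C) (he : Continuous e) (y₀ : ℝ) {k₁ S : ℝ} (hk : 0 ≤ k₁) (hS : 0 ≤ S) :
    ∃ A : ℝ → ℝ → ℝ, Continuous (fun q : ℝ × ℝ => A q.1 q.2) ∧ ∀ k ∈ Icc 0 k₁, A k 0 = y₀ ∧
      ∀ s ∈ Icc 0 S, HasDerivWithinAt (A k) (k * e s - H (A k s)) (Icc 0 S) s := by
  obtain ⟨B, hB⟩ := (isCompact_Icc (a := (0 : ℝ)) (b := S)).exists_bound_of_continuousOn
    he.continuousOn
  have hB0 : 0 ≤ B := (norm_nonneg _).trans (hB 0 ⟨le_rfl, hS⟩)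
  have hC0 : 0 ≤ C := (abs_nonneg _).trans (hC 0)
  -- The parameter becomes a second state variable with zero velocity, so that continuity in initial
  -- values gives continuity in k; projecting it to [0, k₁] keeps the field bounded.
  set f : ℝ → ℝ × ℝ → ℝ × ℝ := fun s q => ((projIcc 0 k₁ hk q.2 : ℝ) * e s - H q.1, 0) with hf
  have hproj : ∀ q, |(projIcc 0 k₁ hk q : ℝ)| ≤ k₁ := fun q => by
    rw [abs_of_nonneg (projIcc 0 k₁ hk q).2.1]; exact (projIcc 0 k₁ hk q).2.2
  have hpl : LipschitzWith 1 (fun q => (projIcc 0 k₁ hk q : ℝ)) :=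
    (LipschitzWith.projIcc hk)
  obtain ⟨N, hN⟩ : ∃ N : NNReal, (N : ℝ) = k₁ * B + C := ⟨⟨_, by positivity⟩, rfl⟩
  obtain ⟨R, hR⟩ : ∃ R : NNReal, (R : ℝ) = k₁ := ⟨⟨k₁, hk⟩, rfl⟩
  obtain ⟨D, hD⟩ : ∃ D : NNReal, (D : ℝ) = S := ⟨⟨S, hS⟩, rfl⟩
  obtain ⟨b, hb⟩ : ∃ b : NNReal, (b : ℝ) = B := ⟨⟨B, hB0⟩, rfl⟩
  -- Initial points range over a ball of radius R = k₁ and move by at most N D during the time D =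
  -- S.
  have key : IsPicardLindelof f (tmin := 0) (tmax := S) ⟨0, le_rfl, hS⟩ (y₀, 0)
      (R + N * D) R N (b + L) := by
    refine ⟨fun t ht => ?_, fun q _ => ?_, fun t ht q _ => ?_, ?_⟩
    · refine LipschitzOnWith.of_dist_le_mul fun q _ q' _ => ?_
      rw [Prod.dist_eq]
      refine max_le ?_ (by simp only [hf, dist_self]; positivity)
      simp only [hf]
      have h1 := hpl.dist_le_mul q.2 q'.2
      have h2 := hL.dist_le_mul q.1 q'.1
      have h3 := hB t ht
      rw [Real.dist_eq] at h1 h2 ⊢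
      have h4 : |(projIcc 0 k₁ hk q.2 : ℝ) - projIcc 0 k₁ hk q'.2| ≤ dist q q' := by
        refine h1.trans ?_
        rw [NNReal.coe_one, one_mul, Prod.dist_eq]
        exact le_max_right _ _
      have h5 : |H q.1 - H q'.1| ≤ L * dist q q' := by
        refine h2.trans (mul_le_mul_of_nonneg_left ?_ L.2)
        rw [Prod.dist_eq]
        exact le_max_left _ _
      calc |(projIcc 0 k₁ hk q.2 : ℝ) * e t - H q.1 - ((projIcc 0 k₁ hk q'.2 : ℝ) * e t - H q'.1)|
          = |((projIcc 0 k₁ hk q.2 : ℝ) - projIcc 0 k₁ hk q'.2) * e t - (H q.1 - H q'.1)| := by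
            congr 1; ring
        _ ≤ |((projIcc 0 k₁ hk q.2 : ℝ) - projIcc 0 k₁ hk q'.2) * e t| + |H q.1 - H q'.1| :=
            abs_sub _ _
        _ ≤ dist q q' * B + L * dist q q' := by
            rw [abs_mul]
            gcongr
            exact h3
        _ = _ := by push_cast; rw [hb]; ring
    · simp only [hf]
      fun_prop
    · rw [Prod.norm_def]
      refine max_le ?_ (by simp [hf])
      simp only [hf]
      calc |(projIcc 0 k₁ hk q.2 : ℝ) * e t - H q.1| ≤ |(projIcc 0 k₁ hk q.2 : ℝ) * e t| + |H q.1| :=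
            abs_sub _ _
        _ ≤ N := by
            rw [hN]
            rw [abs_mul]
            gcongr
            · exact hproj _
            · exact hB t ht
            · exact hC _
    · simp [hS, hD]
  obtain ⟨α, hα, hαc⟩ := key.exists_forall_mem_closedBall_eq_hasDerivWithinAt_continuousOn
  refine ⟨fun k s => (α ((y₀, (projIcc 0 k₁ hk k : ℝ)), (projIcc 0 S hS s : ℝ))).1, ?_, ?_⟩
  · refine continuous_fst.comp (hαc.comp_continuous (by fun_prop) fun q => ⟨?_, (projIcc 0 S hS q.2).2⟩)
    rw [Metric.mem_closedBall, Prod.dist_eq]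
    simp only [dist_self, Real.dist_eq, sub_zero, hR]
    exact max_le hk (hproj _)
  · intro k hkk
    have hmem : ((y₀, k) : ℝ × ℝ) ∈ Metric.closedBall ((y₀, 0) : ℝ × ℝ) R := by
      rw [Metric.mem_closedBall, Prod.dist_eq]
      simp only [dist_self, Real.dist_eq, sub_zero, abs_of_nonneg hkk.1]
      exact hR ▸ max_le hk hkk.2
    obtain ⟨h0, hd⟩ := hα _ hmem
    have hpk : (projIcc 0 k₁ hk k : ℝ) = k := by rw [projIcc_of_mem hk hkk]
    have hps : ∀ s ∈ Icc 0 S, (projIcc 0 S hS s : ℝ) = s := fun s hs => by rw [projIcc_of_mem hS hs]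
    have h2 : ∀ s ∈ Icc 0 S, (α ((y₀, k), s)).2 = k := by
      intro s hs
      have hd2 : ∀ t ∈ Icc 0 S, HasDerivWithinAt (fun s => (α ((y₀, k), s)).2) 0 (Icc 0 S) t :=
        fun t ht => (ContinuousLinearMap.snd ℝ ℝ ℝ).hasFDerivAt.comp_hasDerivWithinAt t (hd t ht)
      have := constant_of_has_deriv_right_zero (fun t ht => (hd2 t ht).continuousWithinAt)
        (fun t ht => (hd2 t ⟨ht.1, ht.2.le⟩).mono_of_mem_nhdsWithin
          (Icc_mem_nhdsGE_of_mem ht)) s hs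
      rw [this]
      exact congrArg Prod.snd h0
    simp only [hpk]
    refine ⟨?_, fun s hs => ?_⟩
    · rw [hps 0 ⟨le_rfl, hS⟩]
      exact congrArg Prod.fst h0
    · have h3 : HasDerivWithinAt (fun s => (α ((y₀, k), s)).1) (f s (α ((y₀, k), s))).1
          (Icc 0 S) s :=
        (ContinuousLinearMap.fst ℝ ℝ ℝ).hasFDerivAt.comp_hasDerivWithinAt s (hd s hs)
      refine (h3.congr (fun t ht => by rw [hps t ht]) (by rw [hps s hs])).congr_deriv ?_
      simp only [hf, h2 s hs, hpk, hps s hs]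

/-- Solutions of a scalar linear equation with coefficients depending continuously on a
parameter. -/
theorem exists_linear_flow {a b : ℝ → ℝ → ℝ} (ha : Continuous (fun q : ℝ × ℝ => a q.1 q.2))
    (hb : Continuous (fun q : ℝ × ℝ => b q.1 q.2)) (ζ : ℝ) :
    ∃ Z : ℝ → ℝ → ℝ, Continuous (fun q : ℝ × ℝ => Z q.1 q.2) ∧
      ∀ k, Z k 0 = ζ ∧ ∀ s, HasDerivAt (Z k) (b k s - a k s * Z k s) s := by
  set E : ℝ → ℝ → ℝ := fun k s => Real.exp (∫ u in (0 : ℝ)..s, a k u) with hE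
  have hEc : Continuous (fun q : ℝ × ℝ => E q.1 q.2) :=
    Real.continuous_exp.comp (intervalIntegral.continuous_parametric_intervalIntegral_of_continuous
      (f := fun (q : ℝ × ℝ) u => a q.1 u)
      (ha.comp (by fun_prop : Continuous fun w : (ℝ × ℝ) × ℝ => (w.1.1, w.2))) continuous_snd)
  have hIc : Continuous (fun q : ℝ × ℝ => ζ + ∫ u in (0 : ℝ)..q.2, b q.1 u * E q.1 u) :=
    continuous_const.add (intervalIntegral.continuous_parametric_intervalIntegral_of_continuous
      (f := fun (q : ℝ × ℝ) u => b q.1 u * E q.1 u)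
      ((hb.mul hEc).comp (by fun_prop : Continuous fun w : (ℝ × ℝ) × ℝ => (w.1.1, w.2)))
      continuous_snd)
  refine ⟨fun k s => (ζ + ∫ u in (0 : ℝ)..s, b k u * E k u) / E k s,
    hIc.div hEc fun q => (Real.exp_pos _).ne', fun k => ⟨by simp [hE], fun s => ?_⟩⟩
  have hak : Continuous (a k) := ha.comp (by fun_prop : Continuous fun u : ℝ => (k, u))
  have hbk : Continuous (b k) := hb.comp (by fun_prop : Continuous fun u : ℝ => (k, u))
  have hEk : Continuous (E k) := hEc.comp (by fun_prop : Continuous fun u : ℝ => (k, u))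
  have h1 : HasDerivAt (E k) (E k s * a k s) s :=
    (intervalIntegral.integral_hasDerivAt_right (hak.intervalIntegrable 0 s)
      (hak.stronglyMeasurableAtFilter _ _) hak.continuousAt).exp
  have h2 := (intervalIntegral.integral_hasDerivAt_right ((hbk.mul hEk).intervalIntegrable 0 s)
    ((hbk.mul hEk).stronglyMeasurableAtFilter _ _) (hbk.mul hEk).continuousAt).const_add ζ
  have hne : E k s ≠ 0 := (Real.exp_pos _).ne'
  refine (h2.div h1 hne).congr_deriv ?_
  simp only [Pi.mul_apply]
  field_simp

namespace Fishery
variable {M : Fishery}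

/-- For y = log x the backward equation is y' = cap − φhat(e^y), and this lemma makes it globally
solvable: φ(e^y) has the bounded derivative F' − φ up to xbar, and φhat is constant beyond. -/
theorem Assumptions.exists_lipschitz_phihat_exp (hM : M.Assumptions) :
    ∃ L : NNReal, LipschitzWith L (fun y => M.phihat (Real.exp y)) := by
  obtain ⟨C, hC⟩ := isCompact_Icc.exists_bound_of_continuousOn
    (hM.continuousOn_derivWithin.mono (show Icc 0 M.xbar ⊆ Ici 0 from Icc_subset_Ici_self))
  have hmem : ∀ y ∈ Iic (Real.log M.xbar), Real.exp y ∈ Ioc 0 M.xbar := fun y hy =>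
    ⟨Real.exp_pos y, (Real.le_log_iff_exp_le hM.xbar_pos).1 hy⟩
  have h1 : LipschitzOnWith (C + |derivWithin M.F (Ici 0) 0|).toNNReal
      (fun y => M.phi (Real.exp y)) (Iic (Real.log M.xbar)) := by
    refine (convex_Iic _).lipschitzOnWith_of_nnnorm_hasDerivWithin_le
      (f' := fun y => deriv M.F (Real.exp y) - M.phi (Real.exp y)) (fun y _ => ?_) fun y hy => ?_
    · refine ((hM.hasDerivAt_phi (Real.exp_pos y)).comp y
        (Real.hasDerivAt_exp y)).hasDerivWithinAt.congr_deriv ?_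
      have := Real.exp_pos y
      field_simp
    · have hm := hmem y hy
      rw [← norm_toNNReal]
      refine Real.toNNReal_le_toNNReal ((norm_sub_le _ _).trans (add_le_add ?_ ?_))
      · rw [← derivWithin_eq hm.1]
        exact hC _ (Ioc_subset_Icc_self hm)
      · rw [Real.norm_eq_abs, abs_of_nonneg (hM.phi_nonneg hm)]
        exact (hM.phi_le_deriv_zero hm).trans (le_abs_self _)
  have h2 : LipschitzWith 1 (fun y : ℝ => min y (Real.log M.xbar)) :=
    LipschitzWith.id.min_const _
  refine ⟨(C + |derivWithin M.F (Ici 0) 0|).toNNReal * 1, ?_⟩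
  have h3 := h1.comp (h2.lipschitzOnWith (s := univ)) (fun y _ => min_le_right y _)
  rw [lipschitzOnWith_univ] at h3
  convert h3 using 1
  funext y
  simp only [phihat, Function.comp]
  rw [Real.exp_monotone.map_min, Real.exp_log hM.xbar_pos]

theorem Assumptions.abs_phihat_exp_le (hM : M.Assumptions) (y : ℝ) :
    |M.phihat (Real.exp y)| ≤ derivWithin M.F (Ici 0) 0 := by
  have hm : min (Real.exp y) M.xbar ∈ Ioc 0 M.xbar :=
    ⟨lt_min (Real.exp_pos y) hM.xbar_pos, min_le_right _ _⟩
  rw [phihat, abs_of_nonneg (hM.phi_nonneg hm)]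
  exact hM.phi_le_deriv_zero hm

theorem Assumptions.strictMonoOn_ψ (hM : M.Assumptions) : StrictMonoOn M.ψ (Ioo 0 M.xtil) := by
  refine strictMonoOn_of_deriv_pos (convex_Ioo _ _)
    (hM.continuousOn_ψ.mono fun x hx => hx.1) fun x hx => ?_
  rw [interior_Ioo] at hx
  exact hM.ψ_deriv_pos x hx

theorem Assumptions.continuous_comp_exp (hM : M.Assumptions) {f : ℝ → ℝ}
    (hf : ContinuousOn f (Ioi 0)) : Continuous fun y => f (min (Real.exp y) M.xbar) :=
  hf.comp_continuous (by fun_prop) fun y => lt_min (Real.exp_pos y) hM.xbar_pos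

theorem isSub_and_isSuper_exp (hM : M.Assumptions) {k S : ℝ} {y : ℝ → ℝ}
    (h : ∀ s ∈ Icc 0 S,
      HasDerivWithinAt y (M.cap k s - M.phihat (Real.exp (y s))) (Icc 0 S) s) :
    M.IsSub k (fun s => Real.exp (y s)) 0 S ∧ M.IsSuper k (fun s => Real.exp (y s)) 0 S := by
  have hc : ContinuousOn y (Icc 0 S) := fun s hs => (h s hs).continuousWithinAt
  have hp : ∀ s ∈ Icc 0 S, 0 < Real.exp (y s) := fun s _ => Real.exp_pos _
  have hc' : ContinuousOn (fun s => Real.exp (y s)) (Icc 0 S) := Real.continuous_exp.comp_continuousOn hc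
  have key : ∀ s t, 0 ≤ s → s ≤ t → t ≤ S →
      (∫ u in s..t, (M.cap k u - M.phihat (Real.exp (y u)))) =
        Real.log (Real.exp (y t)) - Real.log (Real.exp (y s)) := by
    intro s t hs hst ht
    have hsub : Icc s t ⊆ Icc 0 S := Icc_subset_Icc hs ht
    rw [Real.log_exp, Real.log_exp]
    refine intervalIntegral.integral_eq_sub_of_hasDerivAt_of_le hst (hc.mono hsub) (fun u hu =>
      (h u (hsub (Ioo_subset_Icc_self hu))).hasDerivAt
        (Icc_mem_nhds (hs.trans_lt hu.1) (hu.2.trans_le ht))) ?_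
    exact ((hM.continuousOn_excess hp hc').mono hsub).intervalIntegrable_of_Icc hst
  exact ⟨⟨hp, hc', fun s t hs hst ht => (key s t hs hst ht).ge⟩,
    ⟨hp, hc', fun s t hs hst ht => (key s t hs hst ht).le⟩⟩

end Fishery

/-! ### Points of Σ₀ by continuity in the initial capital. -/

namespace Fishery
variable {M : Fishery}

/-- A point reached with `z > 0` to the left of the line `x = xtil` lies to the right of a point
of `Σ₀` with the same capital. -/
theorem IsBackward.exists_mem_Sigma0 (hM : M.Assumptions) {K₁ τ : ℝ} {x z l : ℝ → ℝ}
    (hK : 0 < K₁) (hK' : K₁ < M.Kstar) (hτ : 0 < τ) (h : M.IsBackward K₁ τ x z l)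
    (hz : 0 < z τ) (hx : x τ < M.xtil) : ∃ s, (s, M.cap K₁ τ) ∈ M.Sigma0 ∧ s < x τ := by
  have hts := hM.xtil_lt_xstar
  have htil := hM.xtil_mem
  have hKs := hM.Kstar_pos
  -- the smallest initial capital
  set xb := M.xtil / 2 with hxb
  have hxb0 : 0 < xb := half_pos htil.1
  have hxbt : xb < M.xtil := half_lt_self htil.1
  set η := - M.ψ xb with hη
  have hη0 : 0 < η := neg_pos.2 (hM.ψ_neg xb ⟨hxb0, hxbt⟩)
  -- While cap ≤ K^*/2 and x ≤ x^*, log x falls at least at the rate K^*/2; S₁ is the time this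
  -- takes from x^* to xtil/2.
  set S₁ := 2 / M.Kstar * Real.log (M.xstar / xb) with hS₁
  have hS₁0 : 0 < S₁ := mul_pos (by positivity)
    (Real.log_pos ((one_lt_div hxb0).2 (hxbt.trans hts)))
  -- After S₁ one has ψ(x) ≤ −η, so that z, at most r', comes down to zero within the time r'/η.
  set S₂ := S₁ + M.r' / η with hS₂
  have hS₁₂ : S₁ < S₂ := by rw [hS₂]; linarith [div_pos hM.r'_pos hη0]
  set m := min (M.Kstar / 2) K₁ with hm
  have hm0 : 0 < m := lt_min (by linarith) hK
  -- The capital is then m at time S₂: at most K^*/2, as needed up to S₂, and at most K₁, so that K₁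
  -- is not reached before S₂.
  set k₀ := m * Real.exp (-(M.γ * S₂)) with hk₀
  have hk₀0 : 0 < k₀ := mul_pos hm0 (Real.exp_pos _)
  have hcapm : M.cap k₀ S₂ = m := by
    rw [cap, hk₀, mul_assoc, ← Real.exp_add]; simp
  have hk₀K : k₀ < K₁ := by
    have h1 := hM.cap_lt hk₀0 (hS₁0.trans hS₁₂)
    rw [cap_zero, hcapm] at h1
    exact h1.trans_le (min_le_right _ _)
  -- the time at which the capital `K₁` is reached
  set D : ℝ → ℝ := fun k => Real.log (K₁ / k) / M.γ with hD
  have hcapD : ∀ k, 0 < k → M.cap k (D k) = K₁ := fun k hk => by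
    rw [hD, cap]
    simp only
    rw [mul_div_cancel₀ _ hM.γ_pos.ne', Real.exp_log (div_pos hK hk)]
    field_simp
  have hD0 : ∀ k ∈ Icc k₀ K₁, 0 ≤ D k := fun k hk =>
    div_nonneg (Real.log_nonneg ((one_le_div (hk₀0.trans_le hk.1)).2 hk.2)) hM.γ_pos.le
  have hDle : ∀ k ∈ Icc k₀ K₁, D k ≤ D k₀ := fun k hk => by
    have hk0 := hk₀0.trans_le hk.1
    refine div_le_div_of_nonneg_right (Real.log_le_log (div_pos hK hk0) ?_) hM.γ_pos.le
    exact div_le_div_of_nonneg_left hK.le hk₀0 hk.1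
  have hDK : D K₁ = 0 := by simp [hD, div_self hK.ne']
  have hcaps : ∀ k, 0 < k → M.cap k (D k + τ) = M.cap K₁ τ := fun k hk => by
    rw [cap_add, hcapD k hk]
  set S := D k₀ + τ with hS
  have hS₂D : S₂ ≤ D k₀ := by
    by_contra hc
    have h1 := hM.cap_lt hk₀0 (not_le.1 hc)
    rw [hcapD k₀ hk₀0, hcapm] at h1
    exact absurd (min_le_right _ _) (not_le.2 h1)
  have hk₀m : k₀ ∈ Icc k₀ K₁ := ⟨le_rfl, hk₀K.le⟩
  have hK₁m : K₁ ∈ Icc k₀ K₁ := ⟨hk₀K.le, le_rfl⟩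
  -- the family of trajectories
  obtain ⟨Λ, hΛ⟩ := hM.exists_lipschitz_phihat_exp
  obtain ⟨A, hAc, hA⟩ := exists_flow hΛ hM.abs_phihat_exp_le
    (e := fun s => Real.exp (M.γ * s)) (by fun_prop) (Real.log M.xstar) hK.le
    (show 0 ≤ S by linarith [hD0 k₀ hk₀m])
  have hA : ∀ k ∈ Icc k₀ K₁, A k 0 = Real.log M.xstar ∧ ∀ s ∈ Icc 0 S,
      HasDerivWithinAt (A k) (M.cap k s - M.phihat (Real.exp (A k s))) (Icc 0 S) s :=
    fun k hk => hA k ⟨hk₀0.le.trans hk.1, hk.2⟩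
  obtain ⟨Z, hZc, hZ⟩ := exists_linear_flow (a := fun k s => M.g (min (Real.exp (A k s)) M.xbar))
    (b := fun k s => M.ψ (min (Real.exp (A k s)) M.xbar))
    ((hM.continuous_comp_exp hM.continuousOn_g).comp hAc)
    ((hM.continuous_comp_exp hM.continuousOn_ψ).comp hAc) M.r'
  obtain ⟨Λ', -, hΛ'⟩ := exists_linear_flow (a := fun _ _ => M.κ) (b := Z) (by fun_prop) hZc M.r
  set X : ℝ → ℝ → ℝ := fun k s => Real.exp (A k s) with hX
  have hX0 : ∀ k ∈ Icc k₀ K₁, X k 0 = M.xstar := fun k hk => by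
    simp only [hX, (hA k hk).1, Real.exp_log hM.xstar_mem.1]
  have hsub : ∀ k ∈ Icc k₀ K₁, M.IsSub k (X k) 0 S ∧ M.IsSuper k (X k) 0 S := fun k hk =>
    isSub_and_isSuper_exp hM (hA k hk).2
  have hxK : ∀ s ∈ Icc 0 τ, X K₁ s = x s := by
    have hτS : τ ≤ S := by linarith [hD0 k₀ hk₀m]
    have h1 := ODE_solution_unique_of_mem_Icc_right (a := 0) (b := τ) (K := Λ) (s := fun _ => univ)
      (v := fun t y => M.cap K₁ t - M.phihat (Real.exp y)) (f := A K₁)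
      (g := fun s => Real.log (x s)) (fun t _ => ?_)
      (fun s hs => (((hA K₁ hK₁m).2 s ⟨hs.1, hs.2.trans hτS⟩).mono
        (Icc_subset_Icc_right hτS)).continuousWithinAt)
      (fun s hs => ((hA K₁ hK₁m).2 s ⟨hs.1, hs.2.le.trans hτS⟩).mono_of_mem_nhdsWithin
        (Icc_mem_nhdsGE_of_mem ⟨hs.1, hs.2.trans_le hτS⟩)) (fun _ _ => mem_univ _)
      (ContinuousOn.log h.isFull.cont fun s hs => (h.x_mem s hs).1.ne')
      (fun s hs => ?_) (fun _ _ => mem_univ _) (by rw [(hA K₁ hK₁m).1, h.x_zero])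
    · intro s hs
      simp only [hX, h1 hs]
      exact Real.exp_log (h.x_mem s hs).1
    · refine LipschitzOnWith.of_dist_le_mul fun y _ y' _ => ?_
      rw [dist_sub_left]
      exact hΛ.dist_le_mul y y'
    · have hs' := Ico_subset_Icc_self hs
      have hm := h.x_mem s hs'
      have h2 := ((h.isFull.deriv' hs').log hm.1.ne').mono_of_mem_nhdsWithin
        (Icc_mem_nhdsGE_of_mem hs)
      refine h2.congr_deriv ?_
      rw [Real.exp_log hm.1, phihat_eq hm.2, mul_div_cancel_left₀ _ hm.1.ne']
  have hback : ∀ k ∈ Icc k₀ K₁, M.IsBackward k (D k + τ) (X k) (Z k) (Λ' k) := by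
    intro k hk
    have hk0 := hk₀0.trans_le hk.1
    have hTS : D k + τ ≤ S := by linarith [hDle k hk]
    have hmem : ∀ s ∈ Icc 0 (D k + τ), X k s ∈ Ioc 0 M.xbar := by
      intro s hs
      refine ⟨Real.exp_pos _, ?_⟩
      -- The flow uses φhat, so x ≤ xbar has to be verified: until the capital is K₁ the stock is at
      -- most x^*, and afterwards it is below the given trajectory at equal capital.
      rcases hk.2.eq_or_lt with h1 | h1
      · subst h1
        rw [hDK, zero_add] at hs
        rw [hxK s hs]
        exact (h.x_mem s hs).2
      rcases le_total s (D k) with h2 | h2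
      · rcases hs.1.eq_or_lt with h3 | h3
        · rw [← h3, hX0 k hk]; exact hM.xstar_mem.2.le
        · refine (((hsub k hk).1.mono le_rfl (hs.2.trans hTS)).lt_xstar hM hk0 (hX0 k hk) h3
            ?_).le.trans hM.xstar_mem.2.le
          exact (hM.cap_le hk0 h2).trans ((hcapD k hk0).le.trans hK'.le)
      · have h3 := IsSub.lt_of_cap hM hk0 h1 hK'.le (hcapD k hk0) (s := s - D k) (by linarith)
          (by rw [add_sub_cancel]; exact (hsub k hk).1.mono le_rfl (hs.2.trans hTS)) (hX0 k hk)
          ((h.isFull.mono le_rfl (by linarith [hs.2])).isSuper hM) h.x_zero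
        rw [add_sub_cancel] at h3
        exact h3.le.trans (h.x_mem (s - D k) ⟨by linarith, by linarith [hs.2]⟩).2
    refine ⟨hX0 k hk, (hZ k).1, (hΛ' k).1, hmem, fun s hs => ?_, fun s hs => ?_, fun s hs => ?_⟩
    · refine (((hA k hk).2 s ⟨hs.1, hs.2.trans hTS⟩).mono
        (Icc_subset_Icc_right hTS)).exp.congr_deriv ?_
      change X k s * (M.cap k s - M.phihat (X k s)) = -M.F (X k s) + M.cap k s * X k s
      rw [phihat_eq (hmem s hs).2, F_eq (hmem s hs).1.ne']
      ring
    · refine ((hZ k).2 s).hasDerivWithinAt.congr_deriv ?_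
      change M.ψ (min (X k s) M.xbar) - M.g (min (X k s) M.xbar) * Z k s = _
      rw [min_eq_left (hmem s hs).2, ψstar_eq]
      ring
    · refine ((hΛ' k).2 s).hasDerivWithinAt.congr_deriv ?_
      rw [r']
      ring
  have hend : ∀ k ∈ Ico k₀ K₁, X k (D k + τ) < x τ := fun k hk => by
    have hk' := Ico_subset_Icc_self hk
    have hk0 := hk₀0.trans_le hk.1
    exact IsSub.lt_of_cap hM hk0 hk.2 hK'.le (hcapD k hk0) hτ.le
      ((hback k hk').isFull.isSub hM) (hX0 k hk') (h.isFull.isSuper hM) h.x_zero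
  -- the sign of `z` at both ends of the family
  have hf₁ : 0 < Z K₁ (D K₁ + τ) := by
    rw [hDK, zero_add]
    have h1 := hback K₁ hK₁m
    rw [hDK, zero_add] at h1
    rwa [h1.isSwitch.eqOn hM h.isSwitch hxK (by rw [h1.z_zero, h.z_zero]) ⟨hτ.le, le_rfl⟩]
  have hf₀ : Z k₀ (D k₀ + τ) < 0 := by
    have hb := hback k₀ hk₀m
    have hx2 : ∀ s ∈ Icc S₁ S₂, X k₀ s ≤ xb := by
      intro s hs
      have hs0 := hS₁0.le.trans hs.1
      have hsT : s ≤ D k₀ + τ := by linarith [hs.2]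
      have h1 := (hb.isFull.isSub hM).le 0 s le_rfl hs0 hsT
      have h2 : (∫ u in (0 : ℝ)..s, (M.cap k₀ u - M.phihat (X k₀ u))) ≤
          ∫ _ in (0 : ℝ)..s, -(M.Kstar / 2) := by
        refine intervalIntegral.integral_mono_on hs0
          (((hM.continuousOn_excess (hb.isFull.isSub hM).pos (hb.isFull.isSub hM).cont).mono
            (Icc_subset_Icc_right hsT)).intervalIntegrable_of_Icc hs0)
          intervalIntegrable_const fun u hu => ?_
        have h3 : M.cap k₀ u ≤ M.Kstar / 2 :=
          (hM.cap_le hk₀0 (hu.2.trans hs.2)).trans (hcapm.le.trans (min_le_left _ _))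
        have h4 : X k₀ u ≤ M.xstar := by
          rcases hu.1.eq_or_lt with h5 | h5
          · rw [← h5, hX0 k₀ hk₀m]
          · exact (((hb.isFull.isSub hM).mono le_rfl (hu.2.trans hsT)).lt_xstar hM hk₀0
              (hX0 k₀ hk₀m) h5 (by linarith)).le
        have h5 := hM.phihat_anti (Real.exp_pos (A k₀ u)) h4
        rw [phihat_eq hM.xstar_mem.2.le] at h5
        have h6 : M.phi M.xstar = M.Kstar := rfl
        linarith
      rw [intervalIntegral.integral_const, smul_eq_mul, sub_zero] at h2
      have h3 : S₁ * (M.Kstar / 2) = Real.log (M.xstar / xb) := by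
        rw [hS₁]; field_simp
      have h4 := mul_le_mul_of_nonneg_right hs.1 (show 0 ≤ M.Kstar / 2 by linarith)
      rw [hX0 k₀ hk₀m] at h1
      rw [Real.log_div hM.xstar_mem.1.ne' hxb0.ne'] at h3
      exact (Real.log_le_log_iff (Real.exp_pos _) hxb0).1 (by linarith)
    have hsw := hb.isSwitch
    have hS₂T : S₂ ≤ D k₀ + τ := by linarith
    have hz1 : Z k₀ S₁ ≤ M.r' := by
      refine (hsw.mono le_rfl (hS₁₂.le.trans hS₂T)).le_r' hM hb.z_zero.le (fun t ht => ?_)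
        ⟨hS₁0.le, le_rfl⟩
      exact (hb.lt_xstar hM hk₀0 ht (hS₁₂.le.trans hS₂T)
        ((hx2 S₁ ⟨le_rfl, hS₁₂.le⟩).trans (hxbt.trans hts).le)).le
    have hz2 : Z k₀ S₂ ≤ 0 := by
      have hs2 := hsw.mono hS₁0.le hS₂T
      have := lin_nonneg (w := fun s => M.r' - η * (s - S₁) - Z k₀ s) (a := S₁) (b := S₂)
        (hs2.g_cont hM)
        (fun u hu => ((((hasDerivWithinAt_id u _).sub_const S₁).const_mul η).const_sub
          M.r').sub (hs2.deriv u hu)) (fun u hu => by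
          have hu' := Ioo_subset_Icc_self hu
          have h1 : M.ψ (X k₀ u) ≤ - η := by
            rw [hη, neg_neg]
            exact hM.strictMonoOn_ψ.monotoneOn ⟨Real.exp_pos _, (hx2 u hu').trans_lt hxbt⟩
              ⟨hxb0, hxbt⟩ (hx2 u hu')
          have h2 := hM.g_pos (hs2.mem u hu')
          have h3 : 0 ≤ M.r' - η * (u - S₁) := by
            have : η * (S₂ - S₁) = M.r' := by rw [hS₂, add_sub_cancel_left]; field_simp
            linarith [mul_le_mul_of_nonneg_left (sub_le_sub_right hu'.2 S₁) hη0.le]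
          have h4 := mul_nonneg h2.le h3
          rw [G]
          linarith) (by simp only [sub_self, mul_zero, sub_zero]; linarith) (t := S₂)
          ⟨hS₁₂.le, le_rfl⟩
      have h5 : η * (S₂ - S₁) = M.r' := by rw [hS₂, add_sub_cancel_left]; field_simp
      linarith
    refine (hsw.mono (hS₁0.le.trans hS₁₂.le) le_rfl).lt_of_strict hM (fun t ht => ?_) hz2
      ⟨by linarith, le_rfl⟩
    rw [IsSwitch.G_zero]
    refine hM.ψ_neg_of_lt (Real.exp_pos _) ?_
    exact (hb.isFull.mono (hS₁0.le.trans hS₁₂.le) le_rfl).lt_of_le_of_le hM hk₀0 ht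
      ((hx2 S₂ ⟨hS₁₂.le, le_rfl⟩).trans hxbt.le)
      ((hend k₀ ⟨le_rfl, hk₀K⟩).trans hx).le
  -- the trajectory with `z = 0` at its end
  have hcont : ContinuousOn (fun k => Z k (D k + τ)) (Icc k₀ K₁) := by
    refine hZc.comp_continuousOn (continuousOn_id.prodMk ((ContinuousOn.div_const
      (ContinuousOn.log ?_ ?_) _).add continuousOn_const))
    · exact continuousOn_const.div continuousOn_id fun k hk => (hk₀0.trans_le hk.1).ne'
    · exact fun k hk => (div_pos hK (hk₀0.trans_le hk.1)).ne'
  obtain ⟨k, hk, hk0⟩ := intermediate_value_Icc hk₀K.le hcont ⟨hf₀.le, hf₁.le⟩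
  simp only at hk0
  have hkK : k < K₁ := hk.2.lt_of_ne fun he => by rw [he] at hk0; exact hf₁.ne' hk0
  have hkpos := hk₀0.trans_le hk.1
  have hb := hback k hk
  have hT0 : 0 < D k + τ := by linarith [hD0 k hk]
  have hxend := hend k ⟨hk.1, hkK⟩
  refine ⟨X k (D k + τ), ?_, hxend⟩
  rw [← hcaps k hkpos]
  refine ⟨k, ⟨hkpos.le, hkK.trans hK'⟩,
    hb.switchPoint hM hkpos hT0 (fun t ht => ?_) hk0 (hxend.trans hx).le⟩
  -- The zero at the end is the first one: at an earlier first zero x ≤ xtil, and from there to the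
  -- end x < xtil and ψ < 0, so that z would end negative.
  by_contra hc
  obtain ⟨θ, h1, h2, h3⟩ := exists_first_zero (hb.isSwitch.z_cont.mono
    (Icc_subset_Icc_right ht.2.le)) (by rw [hb.z_zero]; exact hM.r'_pos) ht.1 (not_lt.1 hc)
  have hθT : θ < D k + τ := h1.2.trans_lt ht.2
  have hmem := hb.x_mem θ ⟨h1.1.le, hθT.le⟩
  have hG := nonpos_of_hasDerivWithinAt_left h1.1
    ((hb.isSwitch.mono le_rfl hθT.le).deriv θ ⟨h1.1.le, le_rfl⟩)
    fun t ht => by rw [h2]; exact (h3 t ⟨ht.1.le, ht.2⟩).le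
  rw [h2, IsSwitch.G_zero] at hG
  have := (hb.isSwitch.mono h1.1.le le_rfl).lt_of_strict hM (ζ := 0) (fun u hu => by
    rw [IsSwitch.G_zero]
    exact hM.ψ_neg_of_lt (Real.exp_pos _) ((hb.isFull.mono h1.1.le le_rfl).lt_of_le_of_le hM
      hkpos hu (hM.le_xtil_of_ψ_nonpos hmem.2 hG) (hxend.trans hx).le)) h2.le (t := D k + τ)
    ⟨hθT, le_rfl⟩
  exact this.ne hk0

end Fishery

/-! ### Identification of the approach in each region. -/

namespace Fishery
variable {M : Fishery}

theorem cap_inj (hM : M.Assumptions) {K₁ s t : ℝ} (hK : 0 < K₁) (h : M.cap K₁ s = M.cap K₁ t) :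
    s = t := by
  rcases lt_trichotomy s t with h1 | h1 | h1
  · exact absurd h (hM.cap_lt hK h1).ne
  · exact h1
  · exact absurd h (hM.cap_lt hK h1).ne'

namespace IsApproach

variable {x₀ K₀ K₁ τ σ : ℝ} {x z l : ℝ → ℝ}

theorem x_end_le (hM : M.Assumptions) (h : M.IsApproach x₀ K₀ K₁ τ x z l) {a : ℝ} (ha : 0 ≤ a)
    (haτ : a ≤ τ) (hx : x a ≤ M.xtil) (hz : ∀ t ∈ Ioc a τ, z t < 0) : x₀ ≤ x a := by
  rw [← h.x_end]
  exact (h.ext.idle_anti hM ha le_rfl (fun t ht => hz t ⟨ht.1, ht.2.le⟩) hx).antitoneOn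
    ⟨le_rfl, haτ⟩ ⟨haτ, le_rfl⟩ haτ

/-- The last phase when the initial state is to the left of the line `x = xtil`. -/
theorem left_cases (hM : M.Assumptions) (h : M.IsApproach x₀ K₀ K₁ τ x z l)
    (hd : M.IsDelayed K₁ τ σ x z l) (hx : x₀ < M.xtil) :
    (x σ < M.xtil ∧ ∀ t ∈ Ioc σ τ, z t < 0) ∨
      (x σ = M.xtil ∧ ∃ σ₂ ∈ Ico σ τ, x σ₂ = M.xtil ∧ ∀ t ∈ Ioc σ₂ τ, z t < 0) := by
  rcases hd.after with h1 | ⟨h1, h2, σ₂, h3, h4, h5⟩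
  · exact .inl h1
  refine .inr ⟨h1, ?_⟩
  have hxσ₂ := (h4 σ₂ ⟨h3.1, le_rfl⟩).1
  have hlt : σ₂ < τ := h3.2.lt_of_ne fun he => by
    rw [he, h.x_end] at hxσ₂
    exact hx.ne hxσ₂
  refine ⟨σ₂, ⟨h3.1, hlt⟩, hxσ₂, ?_⟩
  rcases h5 with h5 | h5
  · exact h5
  have hf := h.ext.full σ₂ τ (hd.σ_pos.le.trans h3.1) le_rfl fun t ht => h5 t ⟨ht.1, ht.2.le⟩
  have := hf.lt_of_ascending hM h.ext.K_pos le_rfl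
    (by rw [hxσ₂]; exact h2.trans (hM.cap_le h.ext.K_pos h3.1)) ⟨hlt, le_rfl⟩
  rw [hxσ₂, h.x_end] at this
  exact absurd hx (not_lt.2 this.le)

/-- To the right of `x = x^*`, the trajectories with `λ = r` at their ends coincide. -/
theorem compare_SigmaS (hM : M.Assumptions) {h' K₂ τ₂ Kt Kc σt : ℝ}
    {x₂ z₂ l₂ xt zt lt : ℝ → ℝ} (h : M.IsApproach x₀ K₀ K₁ τ x z l)
    (hb : M.IsBackward K₁ τ x z l) (hz : ∀ t ∈ Icc 0 τ, 0 < z t) (hx : M.xstar < x₀)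
    (ht : M.IsThresholdPath Kt Kc σt xt zt lt) (hK : Kt < K₂) (hK₂ : K₂ < M.Kstar) (hτ₂ : 0 < τ₂)
    (h2 : M.IsBackward K₂ τ₂ x₂ z₂ l₂) (hl : l₂ τ₂ = M.r) (hx2 : x₂ τ₂ = x₀)
    (hh : h' = M.cap K₂ τ₂) :
    (l τ < M.r ∧ h' < M.cap K₁ τ) ∨ h' = M.cap K₁ τ := by
  have hK1 := h.ext.K_pos
  have hK2 := ht.K_pos.trans hK
  rcases lt_trichotomy K₁ K₂ with h3 | h3 | h3
  · left
    have h4 := (hb.isSubpath hM hK1 fun t ht => (hz t ht).le).l_lt_of_x_eq hM hK1 h3 hK₂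
      h.ext.T_pos.le hτ₂ h2 hb.isFull.fullBeyond (by rw [h.x_end, hx2]) (by rw [hx2]; exact hx)
    refine ⟨by rwa [hl] at h4, ?_⟩
    rw [hh]
    exact (hb.isFull.isSub hM).cap_lt_cap hM hK1 h3 hK₂.le h.ext.T_pos.le h.x_zero h2
      (by rw [h.x_end, hx2]) (by rw [hx2]; exact hx)
  · right
    subst h3
    rw [hh]
    congr 1
    rcases lt_trichotomy τ τ₂ with h4 | h4 | h4
    · have h5 := (hb.eqOn hM hK1 h2 h.ext.T_pos.le le_rfl h4.le).1
      have h6 := h2.lt_of_xstar_lt hM hK1 (s := τ) ⟨h.ext.T_pos.le, h4⟩ le_rfl (by rw [hx2]; exact hx)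
      rw [← h5, h.x_end, hx2] at h6
      exact absurd h6 (lt_irrefl _)
    · exact h4.symm
    · have h5 := (hb.eqOn hM hK1 h2 hτ₂.le h4.le le_rfl).1
      have h6 := hb.lt_of_xstar_lt hM hK1 (s := τ₂) ⟨hτ₂.le, h4⟩ le_rfl (by rw [h.x_end]; exact hx)
      rw [h5, h.x_end, hx2] at h6
      exact absurd h6 (lt_irrefl _)
  · exfalso
    have h4 := (h2.isSubpath hM hK2 fun t htt => (ht.z_pos_of_lt hM hK hK₂ h2 htt).le).l_lt_of_x_eq
      hM hK2 h3 h.K_lt hτ₂.le h.ext.T_pos hb h2.isFull.fullBeyond (by rw [h.x_end, hx2])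
      (by rw [h.x_end]; exact hx)
    rw [hl] at h4
    exact absurd h.l_le (not_le.2 h4)

/-- If z > 0 throughout and K₁ is below the parameter of the `Σ_s` point over x₀, then λ < r
excludes a jump, yet the capital K₀ would lie above `Σ_s`. So the two paths coincide and the capital
jumps up to `Σ_s`. A zero of z leads to the same contradiction, since the threshold is below that
parameter. -/
theorem of_mem_R1 (hM : M.Assumptions) (hno : M.NoIntersection) (hreach : M.JumpCurveReaches)
    (h : M.IsApproach x₀ K₀ K₁ τ x z l) (hlt : ∀ t ∈ Ioo 0 τ, l t < M.r)
    (hR : (x₀, K₀) ∈ M.R1) :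
    M.r' < z τ ∧ l τ = M.r ∧ (x₀, M.cap K₁ τ) ∈ M.SigmaS ∧ ∀ t ∈ Icc 0 τ, 0 < z t := by
  obtain ⟨hx, hxb, hK₀, h', hmem, hK₀h⟩ := hR
  simp only at hx hxb hK₀ hmem hK₀h
  have hK1 := h.ext.K_pos
  obtain ⟨Kt, Kc, σt, xt, zt, lt, K₂, τ₂, x₂, z₂, l₂, ht, hK, hK₂, hτ₂, h2, hl, hx2, hh⟩ :=
    exists_of_mem_SigmaS hM hno hmem hx hxb
  rcases h.cases hM with ⟨hb, hz⟩ | ⟨σ, hd⟩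
  · have hcap : h' = M.cap K₁ τ := by
      rcases h.compare_SigmaS hM hb hz hx ht hK hK₂ hτ₂ h2 hl hx2 hh with h3 | h3
      · have := h.K_eq h3.1
        linarith [h3.2]
      · exact h3
    have hlr : l τ = M.r := by
      refine h.l_le.eq_of_not_lt fun hc => ?_
      have := h.K_eq hc
      linarith
    refine ⟨?_, hlr, hcap ▸ hmem, hz⟩
    -- After the last crossing of x = x^* the stock is where ψ_* > 0, so that z ≥ r' at some time
    -- forces z > r' later. Thus z ≤ r' at τ means z < r' on this whole stretch, and λ would end
    -- below r.
    by_contra hc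
    obtain ⟨b, hb0, hb1, hb2⟩ : ∃ b, 0 ≤ b ∧ b < τ ∧ ∀ t ∈ Ioc b τ, M.xstar < x t := by
      obtain ⟨b, h3, h4, h5⟩ := exists_last_zero (f := fun s => x s - M.xstar)
        (hb.isFull.cont.sub continuousOn_const) (by rw [h.x_end]; linarith) h.ext.T_pos.le
        (by rw [h.x_zero]; linarith)
      exact ⟨b, h3.1, h3.2, fun t ht => by linarith [h5 t ht]⟩
    have hzlt : ∀ t ∈ Ioo b τ, z t < M.r' := by
      intro t ht
      by_contra hc'
      refine hc ((hb.isSwitch.mono (hb0.trans ht.1.le) le_rfl).gt_of_strict hM (fun u hu => ?_)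
        (not_lt.1 hc') ⟨ht.2, le_rfl⟩)
      rw [IsSwitch.G_r']
      exact hM.ψstar_pos' (hb2 u ⟨ht.1.trans hu.1, hu.2.le⟩)
        (hb.x_mem u ⟨hb0.trans (ht.1.trans hu.1).le, hu.2.le⟩).2
    have hlb : l b ≤ M.r := by
      rcases hb0.eq_or_lt with h3 | h3
      · rw [← h3, h.ext.l_zero]
      · exact (hlt b ⟨h3, hb1⟩).le
    have := l_lt_r (a := b) (b := τ) (fun t ht => (hb.l_deriv' ⟨hb0.trans ht.1, ht.2⟩).mono
      (Icc_subset_Icc_left hb0)) hzlt hlb hb1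
    exact this.ne hlr
  · exfalso
    have hxt := hM.xtil_lt_xstar.trans hx
    obtain ⟨h1, σ₂, h3, h4, h5, h6, h7, h8⟩ := h.isSubpath hM hd hxt
    have hlr := h.l_lt_of_delayed hM hno hreach hd hxb
    have hcap := h.K_eq hlr
    have hKt : K₁ < K₂ := by
      rw [((h.isThresholdPath hd h1).unique hM ht).1]; exact hK
    have := (h.isSub hM hd).cap_lt_cap hM hK1 hKt hK₂.le h.ext.T_pos.le h.x_zero h2
      (by rw [h.x_end, hx2]) (by rw [hx2]; exact hx)
    linarith

/-- The comparison with `Γ₃` of a trajectory which stays for some time on the line `x = xtil`. -/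
theorem lt_Gamma3 (hM : M.Assumptions) (h : M.IsApproach x₀ K₀ K₁ τ x z l)
    (hd : M.IsDelayed K₁ τ σ x z l) (hx : x σ = M.xtil) {T : ℝ} {y : ℝ → ℝ} (hy0 : y 0 = M.xtil)
    (hy : M.IsFull (M.cap K₁ σ) y 0 T) (hτ : τ - σ < T) : x₀ < y T := by
  have hK1 := h.ext.K_pos
  have hKc := cap_pos (M := M) hK1 σ
  have hσ0 := hd.σ_pos.le
  have hphi := (h.isThresholdPath hd hx).phi_le hM
  have hmono := hy.strictMonoOn hM hKc (by rw [hy0, cap_zero]; exact hphi)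
  have hsub := ((h.isSub hM hd).mono hσ0 le_rfl)
  have h0 : (0 : ℝ) ≤ τ - σ := by linarith [hd.σ_le]
  suffices hs : x₀ ≤ y (τ - σ) from hs.trans_lt (hmono ⟨h0, hτ.le⟩ ⟨h0.trans hτ.le, le_rfl⟩ hτ)
  have hytil : M.xtil ≤ y (τ - σ) := by
    rw [← hy0]
    exact hmono.monotoneOn ⟨le_rfl, h0.trans hτ.le⟩ ⟨h0, hτ.le⟩ h0
  rcases le_or_gt x₀ M.xtil with h1 | h1
  · exact h1.trans hytil
  obtain ⟨-, σ₂, h3, h4, h5, h6, -⟩ := h.isSubpath hM hd h1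
  have hx₂ := h4 σ₂ ⟨h3.1, le_rfl⟩
  -- Without a rest on xtil the path coincides with `Γ₃`; after a rest, `Γ₃` has already moved to
  -- the right and stays ahead at equal capital.
  rcases h3.1.eq_or_lt with h7 | h7
  · have h8 := ((h6.mono (a' := σ + 0) (by linarith) (b' := σ + (τ - σ)) (by linarith)).shift
      (d := σ)).eqOn hM hKc.le (hy.mono le_rfl hτ.le) (by rw [add_zero, hx, hy0]) ⟨h0, le_rfl⟩
    simp only [add_sub_cancel] at h8
    rw [← h8, h.x_end]
  · have h8 := IsSub.lt_super hM (x := fun s => x (σ + s)) (y := y) (K₁ := M.cap K₁ σ)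
      (a := σ₂ - σ) (b := τ - σ) (t := τ - σ)
      (hsub.mono (a' := σ + (σ₂ - σ)) (b' := σ + (τ - σ)) (by linarith) (by linarith)).shift
      ((hy.isSuper hM).mono (by linarith) hτ.le)
      (by
        simp only [add_sub_cancel]
        rw [hx₂, ← hy0]
        exact hmono ⟨le_rfl, h0.trans hτ.le⟩ ⟨by linarith, by linarith [h3.2]⟩ (by linarith))
      ⟨by linarith [h3.2], le_rfl⟩
    simp only [add_sub_cancel] at h8
    rw [h.x_end] at h8
    exact h8.le

/-- A zero of z is refuted at equal capital: to the left of xtil by the path through the given point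
of `Σ₀`, to the right by `Γ₃`, which a path leaving xtil cannot overtake. Lying above `Σ_s` then
excludes λ = r. -/
theorem of_mem_R2 (hM : M.Assumptions) (hno : M.NoIntersection) (hreach : M.JumpCurveReaches)
    (h : M.IsApproach x₀ K₀ K₁ τ x z l) (hR : (x₀, K₀) ∈ M.R2) :
    l τ < M.r ∧ ∀ t ∈ Icc 0 τ, 0 < z t := by
  have hK1 := h.ext.K_pos
  obtain ⟨hK₀, hR⟩ := hR
  simp only at hK₀ hR
  rcases hR with ⟨hx, s, ⟨K₂, hK₂, σ₂, x₂, z₂, l₂, hσ₂, h2, -, hz2, hz20, hP⟩, hsx⟩ |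
    ⟨hx, hxb, ⟨h', hG, hK₀h⟩, hS⟩
  · have hlr := h.l_lt_of_le hM (hx.trans hM.xtil_lt_xstar).le
    refine ⟨hlr, ?_⟩
    have hcap := h.K_eq hlr
    have hs : s = x₂ σ₂ := congrArg Prod.fst hP
    have hcap2 : K₀ = M.cap K₂ σ₂ := congrArg Prod.snd hP
    have hK2 : 0 < K₂ := hK₂.1.lt_of_ne fun he => by
      rw [hcap2, ← he, cap, zero_mul] at hK₀
      exact lt_irrefl _ hK₀
    rcases h.cases hM with ⟨-, hz⟩ | ⟨σ, hd⟩
    · exact hz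
    exfalso
    -- A smaller K₁ puts x₀ to the left of the point of `Σ₀`, an equal one puts it on that point,
    -- and a larger one makes z₂ negative no later than σ₂.
    rcases lt_trichotomy K₁ K₂ with h3 | h3 | h3
    · obtain ⟨d, -, hdd⟩ := hM.exists_cap_eq hK1 h3.le
      have hτ : d + σ₂ = τ := cap_inj hM hK1 (by rw [cap_add, hdd, ← hcap2, hcap])
      have := IsSub.lt_of_cap hM hK1 h3 hK₂.2.le hdd hσ₂.le (by rw [hτ]; exact h.isSub hM hd)
        h.x_zero (h2.isFull.isSuper hM) h2.x_zero
      rw [hτ, h.x_end] at this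
      linarith
    · subst h3
      have hτ : σ₂ = τ := cap_inj hM hK1 (by rw [← hcap2, hcap])
      subst hτ
      have hσ : σ = σ₂ := by
        refine hd.σ_le.eq_of_not_lt fun hlt => ?_
        have := (hd.back.eqOn hM hK1 h2 hd.σ_pos.le le_rfl hlt.le).2
        rw [hd.z_eq] at this
        linarith [hz2 σ ⟨hd.σ_pos.le, hlt⟩]
      have := (hd.back.eqOn hM hK1 h2 hd.σ_pos.le le_rfl hd.σ_le).1
      rw [hσ, h.x_end] at this
      linarith
    · obtain ⟨d, -, hdd⟩ := hM.exists_cap_eq hK2 h3.le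
      have hτ : d + τ = σ₂ := cap_inj hM hK2 (by rw [cap_add, hdd, ← hcap2, hcap])
      have h4 : M.IsSubpath K₂ σ₂ x₂ z₂ l₂ := h2.isSubpath hM hK2 fun t ht => by
        rcases ht.2.eq_or_lt with h5 | h5
        · rw [h5, hz20]
        · exact (hz2 t ⟨ht.1, h5⟩).le
      have hd0 : 0 < d := by rw [← hM.cap_lt_iff hK2, cap_zero, hdd]; exact h3
      have hdσ : d + σ ≤ σ₂ := by linarith [hd.σ_le]
      have h5 := (h4.lt_of_cap hM hK2 h3 h.K_lt.le hdd hd.back hd.σ_pos.le hdσ le_rfl).2.1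
      rw [hd.z_eq] at h5
      linarith [h4.z_nonneg (d + σ) ⟨by linarith [hd.σ_pos], hdσ⟩]
  · rcases h.cases hM with ⟨hb, hz⟩ | ⟨σ, hd⟩
    · refine ⟨?_, hz⟩
      rcases le_or_gt x₀ M.xstar with h1 | h1
      · exact h.l_lt_of_le hM h1
      obtain ⟨h'', hmem, hlt⟩ := hS h1.le
      obtain ⟨Kt, Kc, σt, xt, zt, lt, K₂, τ₂, x₂, z₂, l₂, ht, hK, hK₂, hτ₂, h2, hl, hx2, hh⟩ :=
        exists_of_mem_SigmaS hM hno hmem h1 hxb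
      rcases h.compare_SigmaS hM hb hz h1 ht hK hK₂ hτ₂ h2 hl hx2 hh with h3 | h3
      · exact h3.1
      · linarith [h.K_le]
    · exfalso
      have hxσ : x σ = M.xtil := by
        refine hd.x_le.eq_of_not_lt fun hlt => ?_
        rcases hd.after with h1 | h1
        · linarith [h.x_end_le hM hd.σ_pos.le hd.σ_le hlt.le h1.2]
        · exact hlt.ne h1.1
      obtain ⟨Kt, Kc, T, y, hth, hT, hy, hy0, hP⟩ := exists_of_mem_Gamma3 hM hG
      have hyT : x₀ = y T := congrArg Prod.fst hP
      have hh : h' = M.cap Kc T := congrArg Prod.snd hP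
      obtain ⟨σt, xt, zt, lt, ht⟩ := hth.exists_path
      have huniq := (h.isThresholdPath hd hxσ).unique hM ht
      have hcap := h.K_eq (h.l_lt_of_delayed hM hno hreach hd hxb)
      rw [← huniq.2.1] at hy hh
      have hτ : τ - σ < T := by
        rw [← hM.cap_lt_iff (cap_pos hK1 σ), ← cap_add, add_sub_cancel, hcap, ← hh]
        exact hK₀h
      exact (h.lt_Gamma3 hM hd hxσ hy0 hy hτ).ne hyT

/-- z > 0 up to the end would place a point of `Σ₀` to the left of x₀; a zero of z on xtil would
leave less idle time than `Γ₄` needs to bring the stock down to x₀. So the zero lies strictly left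
of xtil, on `Σ₀`. -/
theorem of_mem_R3 (hM : M.Assumptions) (h : M.IsApproach x₀ K₀ K₁ τ x z l)
    (hR : (x₀, K₀) ∈ M.R3) :
    l τ < M.r ∧ ∃ σ ∈ Ioo 0 τ, (x σ, M.cap K₁ σ) ∈ M.Sigma0 ∧ ∀ t ∈ Ioc σ τ, z t < 0 := by
  have hK1 := h.ext.K_pos
  obtain ⟨hx₀, hx, hK₀, ⟨h', hG, hK₀h⟩, hS⟩ := hR
  simp only at hx₀ hx hK₀ hG hK₀h hS
  have hlr := h.l_lt_of_le hM (hx.trans hM.xtil_lt_xstar).le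
  refine ⟨hlr, ?_⟩
  have hcap := h.K_eq hlr
  rcases h.cases hM with ⟨hb, hz⟩ | ⟨σ, hd⟩
  · obtain ⟨s, h1, h2⟩ := hb.exists_mem_Sigma0 hM hK1 h.K_lt h.ext.T_pos
      (hz τ ⟨h.ext.T_pos.le, le_rfl⟩) (by rw [h.x_end]; exact hx)
    rw [hcap] at h1
    rw [h.x_end] at h2
    exact absurd (hS s h1) (not_lt.2 h2.le)
  have hmem : (x σ, M.cap K₁ σ) ∈ M.Sigma0 := ⟨K₁, ⟨hK1.le, h.K_lt⟩, hd.switchPoint hM hK1⟩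
  rcases h.left_cases hM hd hx with ⟨h1, h2⟩ | ⟨h1, σ₂, h3, h4, h5⟩
  · refine ⟨σ, ⟨hd.σ_pos, hd.σ_le.lt_of_ne fun he => ?_⟩, hmem, h2⟩
    rw [he, hcap, h.x_end] at hmem
    exact lt_irrefl _ (hS _ hmem)
  · exfalso
    obtain ⟨Kt, Kc, T, y, hth, hT, hy, hya, hy0, hP⟩ := exists_of_mem_Gamma4 hM hG
    have hyT : x₀ = y T := congrArg Prod.fst hP
    have hh : h' = M.cap Kc T := congrArg Prod.snd hP
    obtain ⟨σt, xt, zt, lt, ht⟩ := hth.exists_path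
    have huniq := (h.isThresholdPath hd h1).unique hM ht
    have hσ₂ := hd.σ_pos.le.trans h3.1
    have hidle : M.IsFull 0 x σ₂ τ := isFull_zero
      (fun t ht => h.ext.isSwitch.mem t ⟨hσ₂.trans ht.1, ht.2⟩)
      (h.ext.idle σ₂ τ hσ₂ le_rfl fun t ht => h5 t ⟨ht.1, ht.2.le⟩)
    have hτ : τ - σ₂ < T := by
      have : τ - σ < T := by
        rw [← hM.cap_lt_iff (cap_pos hK1 σ), ← cap_add, add_sub_cancel, hcap]
        rw [huniq.2.1, ← hh]
        exact hK₀h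
      linarith [h3.1]
    have h0 : 0 < τ - σ₂ := by linarith [h3.2]
    have h6 := ((hidle.mono (a' := σ₂ + 0) (b' := σ₂ + (τ - σ₂)) (by linarith)
      (by linarith)).shift (d := σ₂))
    rw [show M.cap 0 σ₂ = 0 by simp [cap]] at h6
    have h7 := h6.eqOn hM le_rfl (hy.mono le_rfl hτ.le) (by rw [add_zero, h4, hy0])
      ⟨h0.le, le_rfl⟩
    simp only [add_sub_cancel] at h7
    have h8 := hya ⟨h0.le, hτ.le⟩ ⟨hT, le_rfl⟩ hτ
    rw [← h7, h.x_end] at h8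
    linarith

/-- The capital K₀ exceeds Kc. A path with z > 0 throughout has either less capital than Kc or a
stock beyond xtil; a path with its zero left of xtil has x < xtil when its capital is Kc, idles
longer than `Γ₄` and ends to the left of x₀. -/
theorem of_mem_R4 (hM : M.Assumptions) (h : M.IsApproach x₀ K₀ K₁ τ x z l)
    (hR : (x₀, K₀) ∈ M.R4) :
    l τ < M.r ∧ ∃ σ ∈ Ioo 0 τ, x σ = M.xtil ∧ ∀ t ∈ Ioc σ τ, z t < 0 := by
  have hK1 := h.ext.K_pos
  obtain ⟨hx₀, hx, h', hG, hK₀h⟩ := hR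
  simp only at hx₀ hx hG hK₀h
  have hlr := h.l_lt_of_le hM (hx.trans hM.xtil_lt_xstar).le
  refine ⟨hlr, ?_⟩
  have hcap := h.K_eq hlr
  obtain ⟨Kt, Kc, T, y, hth, hT, hy, hya, hy0, hP⟩ := exists_of_mem_Gamma4 hM hG
  have hyT : x₀ = y T := congrArg Prod.fst hP
  have hh : h' = M.cap Kc T := congrArg Prod.snd hP
  obtain ⟨σt, xt, zt, lt, ht⟩ := hth.exists_path
  have hKc := ht.Kc_pos hM
  have hKch : Kc ≤ h' := by
    have := hM.cap_le hKc hT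
    rwa [cap_zero, ← hh] at this
  rcases h.cases hM with ⟨hb, hz⟩ | ⟨σ, hd⟩
  · exfalso
    rcases le_or_gt K₁ Kt with h1 | h1
    · have := ht.cap_lt_of_pos hM hK1 h1 hb hz
      linarith
    · obtain ⟨s, hs0, hs, -, h2⟩ := ht.xtil_lt hM h1 h.K_lt hb
      have hsτ : s < τ := by
        rw [← hM.cap_lt_iff hK1, hs, hcap]; linarith
      have := h2 τ ⟨hsτ.le, le_rfl⟩
      rw [h.x_end] at this
      linarith
  rcases h.left_cases hM hd hx with ⟨h1, h2⟩ | ⟨h1, σ₂, h3, h4, h5⟩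
  · exfalso
    have hlt := (ht.lt_of_first_zero hM hK1 h.K_lt hd.σ_pos hd.back hd.z_pos hd.z_eq h1).2
    -- the time at which the capital `Kc` is reached
    obtain ⟨e, he0, he⟩ := hM.exists_cap_eq (cap_pos (M := M) hK1 σ) hlt.le
    rw [← cap_add] at he
    have hσe : 0 < e := by
      rcases he0.eq_or_lt with h6 | h6
      · rw [← h6, add_zero] at he; exact absurd he hlt.ne
      · exact h6
    set tc := σ + e with htc
    have htcT : tc + T < τ := by
      rw [← hM.cap_lt_iff hK1, cap_add, he, ← hh, hcap]; exact hK₀h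
    have hanti := h.ext.idle_anti hM hd.σ_pos.le le_rfl (fun t ht => h2 t ⟨ht.1, ht.2.le⟩) h1.le
    have hidle : M.IsFull 0 x σ τ := isFull_zero
      (fun t ht => h.ext.isSwitch.mem t ⟨hd.σ_pos.le.trans ht.1, ht.2⟩)
      (h.ext.idle σ τ hd.σ_pos.le le_rfl fun t ht => h2 t ⟨ht.1, ht.2.le⟩)
    have h6 := ((hidle.mono (a' := tc + 0) (b' := tc + T) (by linarith) htcT.le).shift (d := tc))
    rw [show M.cap 0 tc = 0 by simp [cap]] at h6
    have h7 := (h6.isSub hM).lt_super hM (hy.isSuper hM) (by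
      simp only [add_zero, hy0]
      exact (hanti ⟨le_rfl, hd.σ_le⟩ ⟨by linarith, by linarith⟩ (by linarith)).trans h1) (t := T)
      ⟨hT, le_rfl⟩
    have h8 := hanti (a := tc + T) (b := τ) ⟨by linarith, htcT.le⟩ ⟨hd.σ_le, le_rfl⟩ htcT
    rw [h.x_end] at h8
    linarith
  · exact ⟨σ₂, ⟨hd.σ_pos.trans_le h3.1, h3.2⟩, h4, h5⟩

/-- The capital K₀ exceeds Kc. A path with z > 0 throughout either has less capital than Kc, or is
to the right of xtil when its capital is Kc; in the latter case it stays ahead of `Γ₃` and ends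
beyond x₀. A zero of z on xtil remains. -/
theorem of_mem_R5 (hM : M.Assumptions) (hno : M.NoIntersection) (hreach : M.JumpCurveReaches)
    (h : M.IsApproach x₀ K₀ K₁ τ x z l) (hR : (x₀, K₀) ∈ M.R5) :
    l τ < M.r ∧ ∃ σ ∈ Ioo 0 τ, x σ = M.xtil ∧ ∀ t ∈ Ioc σ τ, 0 < z t := by
  have hK1 := h.ext.K_pos
  obtain ⟨hx, hxb, h', hG, hK₀h⟩ := hR
  simp only at hx hxb hG hK₀h
  obtain ⟨Kt, Kc, T, y, hth, hT, hy, hy0, hP⟩ := exists_of_mem_Gamma3 hM hG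
  have hyT : x₀ = y T := congrArg Prod.fst hP
  have hh : h' = M.cap Kc T := congrArg Prod.snd hP
  obtain ⟨σt, xt, zt, lt, ht⟩ := hth.exists_path
  have hKc := ht.Kc_pos hM
  have hKch : Kc ≤ h' := by
    have := hM.cap_le hKc hT
    rwa [cap_zero, ← hh] at this
  rcases h.cases hM with ⟨hb, hz⟩ | ⟨σ, hd⟩
  · exfalso
    rcases le_or_gt K₁ Kt with h1 | h1
    · have := ht.cap_lt_of_pos hM hK1 h1 hb hz
      linarith [h.K_le]
    · obtain ⟨s, hs0, hs, -, h2⟩ := ht.xtil_lt hM h1 h.K_lt hb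
      have hsT : s + T < τ := by
        rw [← hM.cap_lt_iff hK1, cap_add, hs, ← hh]; linarith [h.K_le]
      have hxs := h2 s ⟨le_rfl, by linarith⟩
      have h6 := (hb.isFull.mono (a' := s + 0) (b' := s + T) (by linarith) hsT.le).shift (d := s)
      rw [hs] at h6
      have h7 := (hy.isSub hM).lt_super hM (h6.isSuper hM) (by
        simp only [add_zero, hy0]; exact hxs) (t := T) ⟨hT, le_rfl⟩
      have hphi : M.phi (x s) ≤ M.cap K₁ s := by
        rw [hs]
        exact (hM.phi_le hM.xtil_mem.1 hxs.le (hb.x_mem s ⟨hs0, by linarith⟩).2).trans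
          (ht.phi_le hM)
      have hmono := (hb.isFull.mono hs0 le_rfl).strictMonoOn hM hK1 hphi
      have h9 := hmono (a := s + T) (b := τ) ⟨by linarith, hsT.le⟩ ⟨by linarith, le_rfl⟩ hsT
      rw [h.x_end] at h9
      linarith
  · obtain ⟨h1, σ₂, h3, h4, h5, -⟩ := h.isSubpath hM hd hx
    exact ⟨h.l_lt_of_delayed hM hno hreach hd hxb, σ₂, ⟨hd.σ_pos.trans_le h3.1, h3.2⟩,
      h4 σ₂ ⟨h3.1, le_rfl⟩, h5⟩

end IsApproach
end Fishery

/-! ### Integral equations and a backward Gronwall inequality. -/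

theorem hasDerivWithinAt_of_integral_eq {f φ : ℝ → ℝ} {a b : ℝ} (hφ : ContinuousOn φ (Icc a b))
    (h : ∀ t ∈ Icc a b, f t = f a + ∫ s in a..t, φ s) {t : ℝ} (ht : t ∈ Icc a b) :
    HasDerivWithinAt f (φ t) (Icc a b) t := by
  have hab := ht.1.trans ht.2
  set ψ := IccExtend hab ((Icc a b).domRestrict φ) with hψ
  have hc : Continuous ψ := continuous_IccExtend_iff.2 hφ.domRestrict
  have heq : ∀ s ∈ Icc a b, ψ s = φ s := fun s hs => IccExtend_of_mem hab _ hs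
  have hd := (intervalIntegral.integral_hasDerivAt_right (hc.intervalIntegrable a t)
    (hc.stronglyMeasurableAtFilter _ _) hc.continuousAt).const_add (f a)
  rw [heq t ht] at hd
  have hf : ∀ s ∈ Icc a b, f s = f a + ∫ v in a..s, ψ v := fun s hs => by
    rw [h s hs]
    congr 1
    refine intervalIntegral.integral_congr fun v hv => ?_
    rw [uIcc_of_le hs.1] at hv
    exact (heq v ⟨hv.1, hv.2.trans hs.2⟩).symm
  exact hd.hasDerivWithinAt.congr hf (hf t ht)

/-- A Gronwall inequality, backwards from the end of the interval. -/
theorem nonpos_of_le_integral {w : ℝ → ℝ} {a b B : ℝ} (hB : 0 ≤ B)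
    (hw : IntervalIntegrable w volume a b)
    (h : ∀ s ∈ Icc a b, w s ≤ B * ∫ v in s..b, w v) {s : ℝ} (hs : s ∈ Icc a b) : w s ≤ 0 := by
  have hab := hs.1.trans hs.2
  set W := (Ioc a b).indicator w with hW
  have hWi : Integrable W :=
    ((intervalIntegrable_iff_integrableOn_Ioc_of_le hab).1 hw).integrable_indicator
      measurableSet_Ioc
  have heq : ∀ s ∈ Icc a b, ∫ v in s..b, w v = ∫ v in s..b, W v := fun s hs => by
    refine intervalIntegral.integral_congr_ae (ae_of_all _ fun v hv => ?_)
    rw [uIoc_of_le hs.2] at hv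
    have hm : v ∈ Ioc a b := ⟨hs.1.trans_lt hv.1, hv.2⟩
    rw [hW, indicator_of_mem hm]
  -- Since w is only integrable, the argument is carried out for the continuous tail integral, which
  -- satisfies the same inequality.
  set R : ℝ → ℝ := fun s => ∫ v in s..b, W v with hR
  have hRc : Continuous R := by
    have : R = fun s => - ∫ v in b..s, W v := funext fun s => intervalIntegral.integral_symm _ _
    rw [this]
    exact (intervalIntegral.continuous_primitive (fun _ _ => hWi.intervalIntegrable) b).neg
  have hRle : ∀ s ∈ Icc a b, R s ≤ B * ∫ v in s..b, R v := fun s hs => by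
    rw [hR, ← intervalIntegral.integral_const_mul]
    simp only
    rw [← heq s hs]
    refine intervalIntegral.integral_mono_on hs.2
      (hw.mono_set (by rw [uIcc_of_le hs.2, uIcc_of_le hab]; exact Icc_subset_Icc_left hs.1))
      ((hRc.const_mul B).intervalIntegrable _ _) fun v hv => ?_
    rw [← heq v ⟨hs.1.trans hv.1, hv.2⟩]
    exact h v ⟨hs.1.trans hv.1, hv.2⟩
  have hH : ∀ s, HasDerivAt (fun s => ∫ v in s..b, R v) (-R s) s := fun s =>
    intervalIntegral.integral_hasDerivAt_left (hRc.intervalIntegrable _ _)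
      (hRc.stronglyMeasurableAtFilter _ _) hRc.continuousAt
  have hd : ∀ σ ∈ Icc 0 (b - a), HasDerivWithinAt (fun σ => -∫ v in (b - σ)..b, R v) (-R (b - σ))
      (Icc 0 (b - a)) σ := fun σ _ =>
    (((hH (b - σ)).comp_const_sub b σ).neg.congr_deriv (by ring)).hasDerivWithinAt
  have := lin_nonneg (k := fun _ => -B) continuousOn_const hd (fun σ hσ => by
    have := hRle (b - σ) ⟨by linarith [hσ.2], by linarith [hσ.1]⟩
    linarith) (by simp) (t := b - s) ⟨by linarith [hs.2], by linarith [hs.1]⟩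
  rw [sub_sub_cancel] at this
  have h1 := h s hs
  rw [heq s hs] at h1
  have h2 := hRle s hs
  have h3 : R s ≤ 0 := h2.trans (mul_nonpos_of_nonneg_of_nonpos hB (by linarith))
  exact h1.trans (mul_nonpos_of_nonneg_of_nonpos hB h3)

/-! ### Positivity and regularity of admissible processes. -/

namespace Fishery
variable {M : Fishery}

namespace IsAdmissible

variable {x₀ K₀ : ℝ} {x K u : ℝ → ℝ} {μ : Measure ℝ}

theorem K_intervalIntegrable (h : M.IsAdmissible x₀ K₀ x K u μ) {s t : ℝ} (hs : 0 ≤ s)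
    (ht : 0 ≤ t) : IntervalIntegrable K volume s t := (h.K_int s hs).symm.trans (h.K_int t ht)

theorem K_sub (h : M.IsAdmissible x₀ K₀ x K u μ) {s t : ℝ} (hs : 0 ≤ s) (hst : s ≤ t) :
    K t = K s - M.γ * (∫ v in s..t, K v) + (μ (Ioc s t)).toReal := by
  have ht := hs.trans hst
  have h1 : μ (Icc 0 t) = μ (Icc 0 s) + μ (Ioc s t) := by
    rw [← measure_union (disjoint_left.2 fun v hv hv' => not_lt.2 hv.2 hv'.1) measurableSet_Ioc,
      Icc_union_Ioc_eq_Icc hs hst]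
  have h2 : μ (Ioc s t) ≠ ⊤ := by
    refine ((measure_mono ?_).trans_lt (h.μ_finite t)).ne
    exact fun v hv => ⟨hs.trans hv.1.le, hv.2⟩
  rw [h.K_eq t ht, h.K_eq s hs, h1, ENNReal.toReal_add (h.μ_finite s).ne h2,
    intervalIntegral.integral_const_mul, intervalIntegral.integral_const_mul,
    ← intervalIntegral.integral_interval_sub_left (h.K_int t ht) (h.K_int s hs)]
  ring

theorem K_zero (h : M.IsAdmissible x₀ K₀ x K u μ) : K 0 = K₀ + (μ {0}).toReal := by
  have := h.K_eq 0 le_rfl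
  rwa [intervalIntegral.integral_same, sub_zero, Icc_self] at this

theorem le_K_zero (h : M.IsAdmissible x₀ K₀ x K u μ) : K₀ ≤ K 0 := by
  rw [h.K_zero]; linarith [ENNReal.toReal_nonneg (a := μ {0})]

theorem integral_K_nonneg (h : M.IsAdmissible x₀ K₀ x K u μ) {s t : ℝ} (hs : 0 ≤ s) (hst : s ≤ t) :
    0 ≤ ∫ v in s..t, K v :=
  intervalIntegral.integral_nonneg hst fun v hv => h.K_nonneg v (hs.trans hv.1)

theorem K_le (hM : M.Assumptions) (h : M.IsAdmissible x₀ K₀ x K u μ) {t T : ℝ}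
    (ht : t ∈ Icc 0 T) : K t ≤ K 0 + (μ (Icc 0 T)).toReal := by
  have h1 := h.K_sub le_rfl ht.1
  have h2 := mul_nonneg hM.γ_pos.le (h.integral_K_nonneg le_rfl ht.1)
  have h3 : (μ (Ioc 0 t)).toReal ≤ (μ (Icc 0 T)).toReal :=
    ENNReal.toReal_mono (h.μ_finite T).ne (measure_mono fun v hv => ⟨hv.1.le, hv.2.trans ht.2⟩)
  linarith

/-- If K vanished at t, then K s ≤ γ ∫ₛᵗ K for s ≤ t, because investment only adds, and Gronwall
backwards from t would give K 0 ≤ 0 < K₀. -/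
theorem K_pos (hM : M.Assumptions) (h : M.IsAdmissible x₀ K₀ x K u μ) (hK₀ : 0 < K₀) {t : ℝ}
    (ht : 0 ≤ t) : 0 < K t := by
  refine (h.K_nonneg t ht).lt_of_ne fun he => ?_
  have := nonpos_of_le_integral hM.γ_pos.le (h.K_int t ht) (fun s hs => by
    have h1 := h.K_sub hs.1 hs.2
    linarith [ENNReal.toReal_nonneg (a := μ (Ioc s t))]) (s := 0) ⟨le_rfl, ht⟩
  linarith [h.le_K_zero]

theorem K_eq_exp (h : M.IsAdmissible x₀ K₀ x K u μ) {a t : ℝ} (ha : 0 ≤ a) (hat : a ≤ t)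
    (hμ : μ (Ioc a t) = 0) : K t = K a * Real.exp (-(M.γ * (t - a))) := by
  have hK : ∀ s ∈ Icc a t, K s = K a + ∫ v in a..s, -(M.γ * K v) := fun s hs => by
    rw [h.K_sub ha hs.1, measure_mono_null (Ioc_subset_Ioc_right hs.2) hμ,
      intervalIntegral.integral_neg, intervalIntegral.integral_const_mul]
    simp; ring
  have hint : IntegrableOn (fun v => -(M.γ * K v)) (Icc a t) :=
    (((intervalIntegrable_iff_integrableOn_Icc_of_le hat).1
      (h.K_intervalIntegrable ha (ha.trans hat))).const_mul M.γ).neg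
  have hc : ContinuousOn K (Icc a t) := by
    have h1 : ContinuousOn (fun s => K a + ∫ v in Icc a s, -(M.γ * K v)) (Icc a t) :=
      continuousOn_const.add (intervalIntegral.continuousOn_primitive_Icc hint)
    refine h1.congr fun s hs => ?_
    rw [hK s hs, intervalIntegral.integral_of_le hs.1, ← integral_Icc_eq_integral_Ioc]
  have hd := fun s hs => hasDerivWithinAt_of_integral_eq (hc.const_mul M.γ).neg hK (t := s) hs
  have := lin_zero (w := fun s => K s - K a * Real.exp (-(M.γ * (s - a)))) (k := fun _ => M.γ)
    continuousOn_const (fun s hs => (hd s hs).sub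
      ((((((hasDerivAt_id s).sub_const a).const_mul M.γ).neg).exp.const_mul (K a)).hasDerivWithinAt))
    (fun s _ => by simp only [Pi.neg_apply, id]; ring) (by simp) (t := t) ⟨hat, le_rfl⟩
  linarith

theorem x_zero (h : M.IsAdmissible x₀ K₀ x K u μ) : x 0 = x₀ := by
  have := h.x_eq 0 le_rfl
  rwa [intervalIntegral.integral_same, add_zero] at this

theorem x_intervalIntegrable (h : M.IsAdmissible x₀ K₀ x K u μ) {s t : ℝ} (hs : 0 ≤ s)
    (ht : 0 ≤ t) : IntervalIntegrable (fun s => M.F (x s) - u s * K s * x s) volume s t :=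
  (h.x_int s hs).symm.trans (h.x_int t ht)

theorem x_sub (h : M.IsAdmissible x₀ K₀ x K u μ) {s t : ℝ} (hs : 0 ≤ s) (ht : 0 ≤ t) :
    x t = x s + ∫ v in s..t, (M.F (x v) - u v * K v * x v) := by
  rw [h.x_eq t ht, h.x_eq s hs,
    ← intervalIntegral.integral_interval_sub_left (h.x_int t ht) (h.x_int s hs)]
  ring

theorem u_mem_ae (h : M.IsAdmissible x₀ K₀ x K u μ) {s t : ℝ} (hs : 0 ≤ s) :
    ∀ᵐ v ∂volume.restrict (Icc s t), u v ∈ Icc (0 : ℝ) 1 :=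
  ae_mono (Measure.restrict_mono (fun _ hv => hs.trans hv.1) le_rfl) h.u_mem

/-- At a first contact with xbar, the distance xbar − x is at most L times its own integral up to
that time, since F(xbar) = 0 and harvesting only lowers x. Backward Gronwall makes it vanish at time
0 already. -/
theorem x_lt (hM : M.Assumptions) (h : M.IsAdmissible x₀ K₀ x K u μ) (hx : x₀ < M.xbar) {t : ℝ}
    (ht : 0 ≤ t) : x t < M.xbar := by
  by_contra hc
  obtain ⟨σ, h1, h2, h3⟩ := exists_first_zero (f := fun s => M.xbar - x s)
    (continuousOn_const.sub (h.x_cont.mono Icc_subset_Ici_self)) (by rw [h.x_zero]; linarith) ht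
    (by linarith)
  obtain ⟨L, hL⟩ := hM.exists_lipschitz_F
  have hxs : ∀ s ∈ Icc 0 σ, x s ≤ M.xbar := fun s hs => by
    rcases hs.2.eq_or_lt with h4 | h4
    · rw [h4]; linarith
    · linarith [h3 s ⟨hs.1, h4⟩]
  have hcont : ContinuousOn (fun s => M.xbar - x s) (Icc 0 σ) :=
    continuousOn_const.sub (h.x_cont.mono Icc_subset_Ici_self)
  have := nonpos_of_le_integral (w := fun s => M.xbar - x s) L.2
    (hcont.intervalIntegrable_of_Icc h1.1.le) (fun s hs => ?_) (s := 0) ⟨le_rfl, h1.1.le⟩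
  · rw [h.x_zero] at this; linarith
  · have h4 := h.x_sub hs.1 h1.1.le
    have hsub : Icc s σ ⊆ Icc 0 σ := Icc_subset_Icc_left hs.1
    rw [show M.xbar - x s = ∫ v in s..σ, (M.F (x v) - u v * K v * x v) by linarith]
    change _ ≤ (L : ℝ) * _
    rw [← intervalIntegral.integral_const_mul]
    refine intervalIntegral.integral_mono_ae_restrict hs.2 (h.x_intervalIntegrable hs.1 h1.1.le)
      (((hcont.mono hsub).const_mul _).intervalIntegrable_of_Icc hs.2) ?_
    filter_upwards [h.u_mem_ae hs.1, ae_restrict_mem measurableSet_Icc] with v hv hvm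
    have hv0 := hs.1.trans hvm.1
    have hx0 := h.x_nonneg v hv0
    have h5 := hL.dist_le_mul (x v) ⟨hx0, hxs v (hsub hvm)⟩ M.xbar ⟨hM.xbar_pos.le, le_rfl⟩
    rw [Real.dist_eq, Real.dist_eq, hM.F_xbar, sub_zero, abs_sub_comm,
      abs_of_nonneg (sub_nonneg.2 (hxs v (hsub hvm)))] at h5
    have h6 := mul_nonneg (mul_nonneg hv.1 (h.K_nonneg v hv0)) hx0
    linarith [le_abs_self (M.F (x v))]

theorem F_nonneg (hM : M.Assumptions) {y : ℝ} (h0 : 0 ≤ y) (h1 : y ≤ M.xbar) : 0 ≤ M.F y := by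
  rcases h0.eq_or_lt with h | h
  · rw [← h, hM.F_zero]
  rcases h1.eq_or_lt with h' | h'
  · rw [h', hM.F_xbar]
  · exact (hM.F_pos y ⟨h, h'⟩).le

/-- Growth is nonnegative and the mortality u K is bounded on bounded intervals, so a zero of x
would propagate back to time 0. -/
theorem x_pos (hM : M.Assumptions) (h : M.IsAdmissible x₀ K₀ x K u μ) (hx₀ : 0 < x₀)
    (hx : x₀ < M.xbar) {t : ℝ} (ht : 0 ≤ t) : 0 < x t := by
  refine (h.x_nonneg t ht).lt_of_ne fun he => ?_
  have hB0 : 0 ≤ K 0 + (μ (Icc 0 t)).toReal := by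
    have := h.K_nonneg 0 le_rfl
    positivity
  have hcont : ContinuousOn x (Icc 0 t) := h.x_cont.mono Icc_subset_Ici_self
  have := nonpos_of_le_integral (w := x) hB0
    (hcont.intervalIntegrable_of_Icc ht) (fun s hs => ?_) (s := 0) ⟨le_rfl, ht⟩
  · rw [h.x_zero] at this; linarith
  · have h4 := h.x_sub hs.1 ht
    have hsub : Icc s t ⊆ Icc 0 t := Icc_subset_Icc_left hs.1
    rw [show x s = ∫ v in s..t, -(M.F (x v) - u v * K v * x v) by
      rw [intervalIntegral.integral_neg]; linarith]
    rw [← intervalIntegral.integral_const_mul]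
    refine intervalIntegral.integral_mono_ae_restrict hs.2 (h.x_intervalIntegrable hs.1 ht).neg
      (((hcont.mono hsub).const_mul _).intervalIntegrable_of_Icc hs.2) ?_
    filter_upwards [h.u_mem_ae hs.1, ae_restrict_mem measurableSet_Icc] with v hv hvm
    have hv0 := hs.1.trans hvm.1
    have hx0 := h.x_nonneg v hv0
    have h5 := F_nonneg hM hx0 (h.x_lt hM hx hv0).le
    have hK := h.K_nonneg v hv0
    have h6 : u v * K v ≤ K 0 + (μ (Icc 0 t)).toReal :=
      (mul_le_of_le_one_left hK hv.2).trans (h.K_le hM (hsub hvm))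
    linarith [mul_le_mul_of_nonneg_right h6 hx0]

/-- Once u K agrees almost everywhere with a continuous function, the integral equation becomes a
classical one. -/
theorem x_hasDerivWithinAt (hM : M.Assumptions) (h : M.IsAdmissible x₀ K₀ x K u μ) {a b : ℝ}
    {c : ℝ → ℝ} (ha : 0 ≤ a) (hc : Continuous c)
    (hu : ∀ᵐ t ∂volume.restrict (Ioo a b), u t * K t = c t) {t : ℝ} (ht : t ∈ Icc a b) :
    HasDerivWithinAt x (M.F (x t) - c t * x t) (Icc a b) t := by
  have hx : ContinuousOn x (Icc a b) := h.x_cont.mono fun v hv => ha.trans hv.1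
  refine hasDerivWithinAt_of_integral_eq (φ := fun t => M.F (x t) - c t * x t)
    ((hM.continuousOn_F.comp hx fun v hv => h.x_nonneg v (ha.trans hv.1)).sub
      (hc.continuousOn.mul hx)) (fun s hs => ?_) ht
  rw [h.x_sub ha (ha.trans hs.1)]
  congr 1
  refine intervalIntegral.integral_congr_ae ?_
  rw [uIoc_of_le hs.1, ← ae_restrict_iff' measurableSet_Ioc, ← restrict_Ioo_eq_restrict_Ioc]
  filter_upwards [ae_mono (Measure.restrict_mono (Ioo_subset_Ioo_right hs.2) le_rfl) hu] with v hv
  rw [hv]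

end IsAdmissible

end Fishery

/-! ### The contact set λ = r. -/

namespace Fishery
variable {M : Fishery}

/-- An admissible process starting in the interior of the phase space, with adjoint variables. -/
structure IsCandidate (M : Fishery) (x₀ K₀ : ℝ) (x K u : ℝ → ℝ) (μ : Measure ℝ) (z lam : ℝ → ℝ) :
    Prop where
  adm : M.IsAdmissible x₀ K₀ x K u μ
  adj : M.IsAdjoint x K u μ z lam
  x₀_mem : x₀ ∈ Ioo 0 M.xbar
  K₀_pos : 0 < K₀

namespace IsCandidate

variable {x₀ K₀ : ℝ} {x K u z lam : ℝ → ℝ} {μ : Measure ℝ}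

theorem z_cont (h : M.IsCandidate x₀ K₀ x K u μ z lam) : ContinuousOn z (Ici 0) :=
  fun t ht => (h.adj.z_deriv t ht).continuousWithinAt

theorem x_mem (hM : M.Assumptions) (h : M.IsCandidate x₀ K₀ x K u μ z lam) {t : ℝ} (ht : 0 ≤ t) :
    x t ∈ Ioo 0 M.xbar :=
  ⟨h.adm.x_pos hM h.x₀_mem.1 h.x₀_mem.2 ht, h.adm.x_lt hM h.x₀_mem.2 ht⟩

theorem K_pos (hM : M.Assumptions) (h : M.IsCandidate x₀ K₀ x K u μ z lam) {t : ℝ} (ht : 0 ≤ t) :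
    0 < K t := h.adm.K_pos hM h.K₀_pos ht

theorem u_ae (hM : M.Assumptions) (h : M.IsCandidate x₀ K₀ x K u μ z lam) :
    ∀ᵐ t ∂(volume.restrict (Ici (0 : ℝ))), (0 < z t → u t = 1) ∧ (z t < 0 → u t = 0) := by
  filter_upwards [h.adj.maximum, h.adm.u_mem, ae_restrict_mem measurableSet_Ici] with t hm hu ht
  have hK := h.K_pos hM ht
  refine ⟨fun hz => ?_, fun hz => ?_⟩
  · have h1 := hm 1 ⟨zero_le_one, le_rfl⟩
    have := le_of_mul_le_mul_left h1 (mul_pos hz hK)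
    linarith [hu.2]
  · have h1 := hm 0 ⟨le_rfl, zero_le_one⟩
    have := (mul_le_mul_left_of_neg (mul_neg_of_neg_of_pos hz hK)).1 h1
    linarith [hu.1]

theorem u_ae_Ioo (hM : M.Assumptions) (h : M.IsCandidate x₀ K₀ x K u μ z lam) {a b : ℝ}
    (ha : 0 ≤ a) :
    ∀ᵐ t ∂(volume.restrict (Ioo a b)), (0 < z t → u t = 1) ∧ (z t < 0 → u t = 0) :=
  ae_mono (Measure.restrict_mono (fun _ hv => ha.trans hv.1.le) le_rfl) (h.u_ae hM)

theorem u_eq_one (hM : M.Assumptions) (h : M.IsCandidate x₀ K₀ x K u μ z lam) {a b : ℝ}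
    (ha : 0 ≤ a) (hz : ∀ t ∈ Ioo a b, 0 < z t) : ∀ᵐ t ∂(volume.restrict (Ioo a b)), u t = 1 := by
  filter_upwards [h.u_ae_Ioo hM ha, ae_restrict_mem measurableSet_Ioo] with t ht htm
  exact ht.1 (hz t htm)

theorem u_eq_zero (hM : M.Assumptions) (h : M.IsCandidate x₀ K₀ x K u μ z lam) {a b : ℝ}
    (ha : 0 ≤ a) (hz : ∀ t ∈ Ioo a b, z t < 0) : ∀ᵐ t ∂(volume.restrict (Ioo a b)), u t = 0 := by
  filter_upwards [h.u_ae_Ioo hM ha, ae_restrict_mem measurableSet_Ioo] with t ht htm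
  exact ht.2 (hz t htm)

/-- The maximum condition gives z u = max(z, 0) almost everywhere. The control thus disappears from
the equation of λ, even where z = 0 leaves it undetermined, and the right side is continuous. -/
theorem lam_deriv (hM : M.Assumptions) (h : M.IsCandidate x₀ K₀ x K u μ z lam) {a b t : ℝ}
    (ha : 0 ≤ a) (ht : t ∈ Icc a b) :
    HasDerivWithinAt lam (M.κ * lam t - max (z t) 0) (Icc a b) t := by
  have hsub : Icc 0 b ⊆ Ici 0 := Icc_subset_Ici_self
  refine (hasDerivWithinAt_of_integral_eq (φ := fun t => M.κ * lam t - max (z t) 0) (a := 0) (b := b)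
    ?_ (fun s hs => ?_) ⟨ha.trans ht.1, ht.2⟩).mono (Icc_subset_Icc_left ha)
  · exact (continuousOn_const.mul (h.adj.lam_cont.mono hsub)).sub
      ((h.z_cont.mono hsub).sup continuousOn_const)
  · rw [h.adj.lam_eq s hs.1]
    congr 1
    refine intervalIntegral.integral_congr_ae ?_
    rw [uIoc_of_le hs.1, ← ae_restrict_iff' measurableSet_Ioc]
    filter_upwards [ae_mono (Measure.restrict_mono (fun v hv => hv.1.le) le_rfl) (h.u_ae hM)]
      with v hv
    have : z v * u v = max (z v) 0 := by
      rcases lt_trichotomy (z v) 0 with h1 | h1 | h1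
      · rw [hv.2 h1, max_eq_right h1.le, mul_zero]
      · simp [h1]
      · rw [hv.1 h1, max_eq_left h1.le, mul_one]
    rw [this, r']
    ring

theorem z_hasDerivWithinAt (h : M.IsCandidate x₀ K₀ x K u μ z lam) {a b t : ℝ}
    (ha : 0 ≤ a) (ht : t ∈ Icc a b) :
    HasDerivWithinAt z (z t * M.g (x t) - M.ψ (x t)) (Icc a b) t :=
  (h.adj.z_deriv t (ha.trans ht.1)).mono fun _ hv => ha.trans hv.1

theorem g_cont (hM : M.Assumptions) (h : M.IsCandidate x₀ K₀ x K u μ z lam) {a b : ℝ}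
    (ha : 0 ≤ a) : ContinuousOn (fun t => M.g (x t)) (Icc a b) :=
  hM.continuousOn_g.comp (h.adm.x_cont.mono fun _ hv => ha.trans hv.1)
    fun _ hv => (h.x_mem hM (ha.trans hv.1)).1

theorem measure_Ioo_eq_zero (h : M.IsCandidate x₀ K₀ x K u μ z lam) {a b : ℝ}
    (hlam : ∀ t ∈ Ioo a b, lam t < M.r) : μ (Ioo a b) = 0 :=
  measure_mono_null (fun t ht => (hlam t ht).ne) (ae_iff.1 h.adj.lam_eq_ae)

theorem K_eq_of_gap (h : M.IsCandidate x₀ K₀ x K u μ z lam) {a b t : ℝ} (ha : 0 ≤ a)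
    (hμ : μ (Ioo a b) = 0) (ht : t ∈ Ico a b) : K t = K a * Real.exp (-(M.γ * (t - a))) :=
  h.adm.K_eq_exp ha ht.1 (measure_mono_null (Ioc_subset_Ioo_right ht.2) hμ)

/-- The capital backwards in time, between two times of investment. -/
theorem cap_eq (k a b s : ℝ) :
    M.cap (k * Real.exp (-(M.γ * (b - a)))) s = k * Real.exp (-(M.γ * (b - s - a))) := by
  rw [cap, mul_assoc, ← Real.exp_add]
  congr 2
  ring

/-- Time is reversed on a stretch without investment. The initial capital of the reversed motion is
the left limit of K at b, which may differ from K b by a jump. -/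
theorem isExtremal_of_gap (hM : M.Assumptions) (h : M.IsCandidate x₀ K₀ x K u μ z lam) {a b : ℝ}
    (ha : 0 ≤ a) (hab : a < b) (hμ : μ (Ioo a b) = 0) (hl : lam b = M.r) (hz : z b = M.r')
    (hx : x b ≤ M.xstar) :
    M.IsExtremal (K a * Real.exp (-(M.γ * (b - a)))) (b - a) (fun s => x (b - s))
      (fun s => z (b - s)) (fun s => lam (b - s)) := by
  have hmem : ∀ t ∈ Icc 0 (b - a), b - t ∈ Icc a b := fun t ht =>
    ⟨by linarith [ht.2], by linarith [ht.1]⟩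
  have hxm : ∀ t ∈ Icc 0 (b - a), x (b - t) ∈ Ioc 0 M.xbar := fun t ht =>
    Ioo_subset_Ioc_self (h.x_mem hM (ha.trans (hmem t ht).1))
  have hK : ∀ t ∈ Ioo a b, K t = K a * Real.exp (-(M.γ * (t - a))) := fun t ht =>
    h.K_eq_of_gap ha hμ ⟨ht.1.le, ht.2⟩
  have hflow : ∀ c d, 0 ≤ c → d ≤ b - a → ∀ w : ℝ,
      (∀ᵐ t ∂volume.restrict (Ioo (b - d) (b - c)), u t = w) → ∀ t ∈ Icc c d,
      HasDerivWithinAt (fun s => x (b - s))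
        (-(M.F (x (b - t)) - w * (K a * Real.exp (-(M.γ * (b - t - a)))) * x (b - t)))
        (Icc c d) t := by
    intro c d hc hd w hu t ht
    refine (h.adm.x_hasDerivWithinAt hM (a := b - d) (b := b - c) (by linarith)
      (c := fun t => w * (K a * Real.exp (-(M.γ * (t - a))))) (by fun_prop) ?_
      ⟨by linarith [ht.2], by linarith [ht.1]⟩).reflect le_rfl le_rfl
    filter_upwards [hu, ae_restrict_mem measurableSet_Ioo] with s hs hsm
    rw [hs, hK s ⟨by linarith [hsm.1], by linarith [hsm.2]⟩]
  refine ⟨mul_pos (h.K_pos hM ha) (Real.exp_pos _), sub_pos.2 hab, ⟨hxm, ?_, fun t ht => ?_⟩,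
    fun t ht => ?_, fun c d hc hd hzp => ⟨fun t ht => hxm t ⟨hc.trans ht.1, ht.2.trans hd⟩,
      fun t ht => ?_⟩, fun c d hc hd hzn t ht => ?_, by simpa using hx, by simpa using hz,
    by simpa using hl⟩
  · exact h.adm.x_cont.comp (continuousOn_const.sub continuousOn_id)
      fun t ht => ha.trans (hmem t ht).1
  · refine ((h.z_hasDerivWithinAt ha (hmem t ht)).reflect (by linarith) (by linarith)).congr_deriv ?_
    rw [G]; ring
  · refine ((h.lam_deriv hM ha (hmem t ht)).reflect (by linarith) (by linarith)).congr_deriv ?_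
    ring
  · refine (hflow c d hc hd 1 (h.u_eq_one hM (by linarith) fun t ht => ?_) t ht).congr_deriv ?_
    · have := hzp (b - t) ⟨by linarith [ht.2], by linarith [ht.1]⟩
      rwa [sub_sub_cancel] at this
    · rw [cap_eq]; ring
  · refine (hflow c d hc hd 0 (h.u_eq_zero hM (by linarith) fun t ht => ?_) t ht).congr_deriv ?_
    · have := hzn (b - t) ⟨by linarith [ht.2], by linarith [ht.1]⟩
      rwa [sub_sub_cancel] at this
    · ring

/-- At a time of investment, `z = r'` and `x ≤ x^*`. -/
theorem z_eq_and_x_le (hM : M.Assumptions) (h : M.IsCandidate x₀ K₀ x K u μ z lam) {t : ℝ}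
    (ht : 0 < t) (hl : lam t = M.r) : z t = M.r' ∧ x t ≤ M.xstar := by
  have hz : z t = M.r' := by
    -- λ has a maximum at t, so its derivative κ r − max(z, 0) vanishes there.
    have h1 := nonpos_of_hasDerivWithinAt_right (lt_add_one t)
      (h.lam_deriv hM ht.le ⟨le_rfl, (lt_add_one t).le⟩)
      fun s hs => (h.adj.lam_le s (ht.le.trans hs.1.le)).trans hl.ge
    have h2 := nonneg_of_hasDerivWithinAt_left ht (h.lam_deriv hM le_rfl ⟨ht.le, le_rfl⟩)
      fun s hs => (h.adj.lam_le s hs.1.le).trans hl.ge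
    have h3 : max (z t) 0 = M.r' := by rw [r']; rw [hl] at h1 h2; linarith
    rcases le_total (z t) 0 with h4 | h4
    · rw [max_eq_right h4] at h3; exact absurd h3 hM.r'_pos.ne
    · rwa [max_eq_left h4] at h3
  refine ⟨hz, ?_⟩
  -- If x > x^* at t, then ψ_* > 0 drives z below r' right after t, and this drives λ above r.
  by_contra hc
  have hx := h.adm.x_cont.continuousAt (Ici_mem_nhds ht)
  obtain ⟨ε, hε, hxε⟩ := Metric.eventually_nhds_iff.1 (hx.eventually (lt_mem_nhds (not_le.1 hc)))
  have hx' : ∀ s ∈ Ioo t (t + ε / 2), M.xstar < x s := fun s hs => hxε (by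
    rw [Real.dist_eq, abs_of_pos (sub_pos.2 hs.1)]; linarith [hs.2])
  have hz' : ∀ s ∈ Ioc t (t + ε / 2), 0 < M.r' - z s := fun s hs =>
    lin_pos_of_strict (w := fun s => M.r' - z s) (k := fun s => -M.g (x s))
      (h.g_cont hM ht.le (b := t + ε / 2)).neg
      (fun v hv => (h.z_hasDerivWithinAt ht.le hv).const_sub M.r') (fun v hv => by
        have := hM.ψstar_pos' (hx' v hv) (h.x_mem hM (ht.le.trans hv.1.le)).2.le
        rw [ψstar_eq] at this
        linarith) (by simp [hz]) hs
  have := lin_pos_of_strict (w := fun s => lam s - M.r) (k := fun _ => -M.κ) continuousOn_const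
    (fun v hv => (h.lam_deriv hM ht.le (b := t + ε / 2) hv).sub_const M.r) (fun v hv => by
      have h1 := hz' v ⟨hv.1, hv.2.le⟩
      have h2 : max (z v) 0 < M.r' := max_lt (by linarith) hM.r'_pos
      have : M.r' = M.r * M.κ := rfl
      linarith) (by simp [hl]) (t := t + ε / 2) ⟨by linarith, le_rfl⟩
  linarith [h.adj.lam_le (t + ε / 2) (by linarith)]

/-- Over a gap the reversed motion is extremal with both end stocks at most x^*, so λ would be below
r at the earlier end. -/
theorem exists_lam_eq_of_gap (hM : M.Assumptions) (h : M.IsCandidate x₀ K₀ x K u μ z lam) {a b : ℝ}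
    (ha : 0 < a) (hab : a < b) (hla : lam a = M.r) (hlb : lam b = M.r) :
    ∃ t ∈ Ioo a b, lam t = M.r := by
  by_contra! hc
  obtain ⟨h1, h2⟩ := h.z_eq_and_x_le hM (ha.trans hab) hlb
  have h3 := h.isExtremal_of_gap hM ha.le hab (h.measure_Ioo_eq_zero fun t ht =>
    (h.adj.lam_le t (ha.le.trans ht.1.le)).lt_of_ne (hc t ht)) hlb h1 h2
  have h4 := h3.l_lt_of_le hM (by simpa using (h.z_eq_and_x_le hM ha hla).2)
  rw [sub_sub_cancel] at h4
  exact h4.ne hla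

/-- An excursion of λ below r would be bounded by two consecutive contact times, contrary to
`exists_lam_eq_of_gap`. -/
theorem lam_eq_of_mem_Icc (hM : M.Assumptions) (h : M.IsCandidate x₀ K₀ x K u μ z lam) {a b t : ℝ}
    (ha : 0 < a) (hla : lam a = M.r) (hlb : lam b = M.r) (ht : t ∈ Icc a b) : lam t = M.r := by
  by_contra hc
  have h0 : 0 < M.r - lam t := sub_pos.2 ((h.adj.lam_le t (ha.le.trans ht.1)).lt_of_ne hc)
  have hcont : ContinuousOn (fun t => M.r - lam t) (Ici 0) := continuousOn_const.sub h.adj.lam_cont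
  obtain ⟨σ, h1, h2, h3⟩ := exists_first_zero
    (hcont.mono fun v hv => (ha.le.trans ht.1).trans hv.1) h0 ht.2 (by linarith)
  obtain ⟨ρ, h4, h5, h6⟩ := exists_last_zero
    (hcont.mono fun v hv => ha.le.trans hv.1) h0 ht.1 (by linarith)
  obtain ⟨s, h7, h8⟩ := h.exists_lam_eq_of_gap hM (ha.trans_le h4.1) (h4.2.trans h1.1)
    (sub_eq_zero.1 h5).symm (sub_eq_zero.1 h2).symm
  rcases le_total s t with h9 | h9
  · linarith [h6 s ⟨h7.1, h9⟩]
  · linarith [h3 s ⟨h9, h7.2⟩]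

end IsCandidate

end Fishery

namespace Fishery
variable {M : Fishery}

namespace IsCandidate

variable {x₀ K₀ : ℝ} {x K u z lam : ℝ → ℝ} {μ : Measure ℝ}

/-- The process stays at `x^*` once `λ = r`. -/
theorem eq_xstar_of_lam_eq (hM : M.Assumptions) (h : M.IsCandidate x₀ K₀ x K u μ z lam) {a b : ℝ}
    (ha : 0 < a) (hla : lam a = M.r) (hlb : lam b = M.r) {t : ℝ} (ht : t ∈ Ico a b) :
    z t = M.r' ∧ x t = M.xstar := by
  have hz : ∀ s ∈ Icc a b, z s = M.r' := fun s hs =>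
    (h.z_eq_and_x_le hM (ha.trans_le hs.1) (h.lam_eq_of_mem_Icc hM ha hla hlb hs)).1
  have hzt := hz t (Ico_subset_Icc_self ht)
  refine ⟨hzt, hM.eq_xstar (Ioo_subset_Ioc_self (h.x_mem hM (ha.le.trans ht.1))) ?_⟩
  have hd := h.z_hasDerivWithinAt (ha.le.trans ht.1) (b := b) ⟨le_rfl, ht.2.le⟩
  have hc : ∀ s ∈ Ioo t b, z s = z t := fun s hs => by
    rw [hzt, hz s ⟨ht.1.trans hs.1.le, hs.2.le⟩]
  have h1 := nonpos_of_hasDerivWithinAt_right ht.2 hd fun s hs => (hc s hs).le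
  have h2 := nonneg_of_hasDerivWithinAt_right ht.2 hd fun s hs => (hc s hs).ge
  rw [hzt] at h1 h2
  rw [ψstar_eq]
  linarith

/-- While the stock is kept at `x^*`, the capital is at most `K^*`. -/
theorem K_le_Kstar (hM : M.Assumptions) (h : M.IsCandidate x₀ K₀ x K u μ z lam) {a : ℝ}
    (ha : 0 ≤ a) (hz : ∀ t, a < t → z t = M.r') (hx : ∀ t, a ≤ t → x t = M.xstar) :
    K a ≤ M.Kstar := by
  -- A stock at rest at x^* under full effort means that K has the mean K^* on every [a, t].
  have hint : ∀ t, a ≤ t → ∫ s in a..t, K s = M.Kstar * (t - a) := fun t hat => by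
    have h1 := h.adm.x_sub ha (ha.trans hat)
    have h2 : ∫ v in a..t, (M.F (x v) - u v * K v * x v) =
        ∫ v in a..t, M.xstar * (M.Kstar - K v) := by
      refine intervalIntegral.integral_congr_ae ?_
      rw [uIoc_of_le hat, ← ae_restrict_iff' measurableSet_Ioc, ← restrict_Ioo_eq_restrict_Ioc]
      filter_upwards [h.u_eq_one hM ha fun t ht => by rw [hz t ht.1]; exact hM.r'_pos,
        ae_restrict_mem measurableSet_Ioo] with v hv hvm
      rw [hv, hx v hvm.1.le, F_eq hM.xstar_mem.1.ne', Kstar, phi]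
      ring
    rw [h2, hx a le_rfl, hx t hat, intervalIntegral.integral_const_mul,
      intervalIntegral.integral_sub intervalIntegrable_const
        (h.adm.K_intervalIntegrable ha (ha.trans hat)), intervalIntegral.integral_const,
      smul_eq_mul] at h1
    have h3 : M.xstar * ((t - a) * M.Kstar - ∫ s in a..t, K s) = 0 := by linarith
    rcases mul_eq_zero.1 h3 with h4 | h4
    · exact absurd h4 hM.xstar_mem.1.ne'
    · linarith
  have hK := hM.Kstar_pos
  have hγ := hM.γ_pos
  refine le_of_forall_pos_le_add fun ε hε => ?_
  -- On [a, a + d] depreciation takes away at most γ K^* d = ε, so K ≥ K a − ε there, while its mean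
  -- is K^*.
  set d := ε / (M.γ * M.Kstar) with hd
  have hd0 : 0 < d := div_pos hε (mul_pos hγ hK)
  have hdε : M.γ * M.Kstar * d = ε := by rw [hd]; field_simp
  have h1 : ∫ s in a..(a + d), (K a - ε) ≤ ∫ s in a..(a + d), K s := by
    refine intervalIntegral.integral_mono_on (by linarith) intervalIntegrable_const
      (h.adm.K_intervalIntegrable ha (by linarith)) fun s hs => ?_
    have h2 := h.adm.K_sub ha hs.1
    rw [hint s hs.1] at h2
    have h3 : M.γ * (M.Kstar * (s - a)) ≤ ε := by
      rw [← hdε, mul_assoc]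
      gcongr
      linarith [hs.2]
    linarith [ENNReal.toReal_nonneg (a := μ (Ioc a s))]
  rw [hint _ (by linarith), intervalIntegral.integral_const, smul_eq_mul, add_sub_cancel_left,
    mul_comm] at h1
  linarith [le_of_mul_le_mul_right h1 hd0]

/-- With K₁ ≥ K^* the stock would rise at once beyond x^*, which drives z above r' and then λ above
r. -/
theorem lt_Kstar_of_isExtremal (hM : M.Assumptions) {K₁ T : ℝ} {x z l : ℝ → ℝ}
    (h : M.IsExtremal K₁ T x z l) (hx : x 0 = M.xstar) (hl : ∀ t ∈ Ioo 0 T, l t ≤ M.r) :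
    K₁ < M.Kstar := by
  by_contra hc
  have hz := h.isSwitch.z_cont
  obtain ⟨ε, hε, hεT, hzp⟩ : ∃ ε, 0 < ε ∧ ε < T ∧ ∀ t ∈ Icc 0 ε, 0 < z t := by
    by_cases hall : ∀ t ∈ Icc 0 T, 0 < z t
    · exact ⟨T / 2, half_pos h.T_pos, half_lt_self h.T_pos,
        fun t ht => hall t ⟨ht.1, by linarith [ht.2, h.T_pos]⟩⟩
    push Not at hall
    obtain ⟨t, ht, htz⟩ := hall
    obtain ⟨σ, h1, -, h3⟩ := exists_first_zero (hz.mono (Icc_subset_Icc_right ht.2))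
      (by rw [h.z_zero]; exact hM.r'_pos) ht.1 htz
    exact ⟨σ / 2, by linarith [h1.1], by linarith [h1.1, h1.2, ht.2],
      fun t ht => h3 t ⟨ht.1, by linarith [ht.2, h1.1]⟩⟩
  have hf := h.full 0 ε le_rfl hεT.le fun t ht => hzp t (Ioo_subset_Icc_self ht)
  have hasc : ∀ t ∈ Ioc 0 ε, M.xstar < x t := fun t ht => by
    have := hf.lt_of_ascending hM h.K_pos (s := 0) le_rfl
      (by rw [hx, cap_zero]; exact not_lt.1 hc) ht
    rwa [hx] at this
  have hs := h.isSwitch.mono le_rfl hεT.le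
  have hzr : ∀ t ∈ Ioc 0 ε, 0 < z t - M.r' := fun t ht =>
    lin_pos_of_strict (w := fun s => z s - M.r') (k := fun s => M.g (x s)) (hs.g_cont hM)
      (fun v hv => (hs.deriv v hv).sub_const M.r') (fun v hv => by
        have := hM.ψstar_pos' (hasc v ⟨hv.1, hv.2.le⟩) (hf.mem v (Ioo_subset_Icc_self hv)).2
        rw [G_eq_ψstar]
        linarith) (by simp [h.z_zero]) ht
  have := lin_pos_of_strict (w := fun s => l s - M.r) (k := fun _ => M.κ) continuousOn_const
    (fun v hv => ((h.l_deriv v ⟨hv.1, hv.2.trans hεT.le⟩).mono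
      (Icc_subset_Icc_right hεT.le)).sub_const M.r) (fun v hv => by
      have h1 := hzr v ⟨hv.1, hv.2.le⟩
      have h2 := le_max_left (z v) 0
      have : M.r' = M.r * M.κ := rfl
      linarith) (by simp [h.l_zero]) (t := ε) ⟨hε, le_rfl⟩
  linarith [hl ε ⟨hε, hεT⟩]

/-- A process in which investment never ceases either starts on `Σ^*` or has an initial period
without investment which brings it to `Σ^*`. -/
theorem isApproach_or (hM : M.Assumptions) (h : M.IsCandidate x₀ K₀ x K u μ z lam)
    (hunb : ∀ T, ∃ t > T, lam t = M.r) :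
    (x₀ = M.xstar ∧ K₀ ≤ M.Kstar) ∨ ∃ τ, 0 < τ ∧ (∀ t ∈ Ioo 0 τ, lam t < M.r) ∧
      x τ = M.xstar ∧ K τ ≤ M.Kstar ∧ M.IsApproach x₀ K₀ (K 0 * Real.exp (-(M.γ * (τ - 0)))) τ
        (fun s => x (τ - s)) (fun s => z (τ - s)) (fun s => lam (τ - s)) := by
  have hafter : ∀ a, 0 < a → lam a = M.r → ∀ t, a ≤ t → z t = M.r' ∧ x t = M.xstar := by
    intro a ha hla t hat
    obtain ⟨b, hb, hlb⟩ := hunb t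
    exact h.eq_xstar_of_lam_eq hM ha hla hlb ⟨hat, hb⟩
  -- Either contact times accumulate at 0, or there is a first positive one; contact at time 0
  -- itself does not count, as it may reflect an initial jump.
  by_cases hc : ∀ ε > 0, ∃ a, 0 < a ∧ a < ε ∧ lam a = M.r
  · left
    have hpos : ∀ t, 0 < t → z t = M.r' ∧ x t = M.xstar := fun t ht => by
      obtain ⟨a, h1, h2, h3⟩ := hc t ht
      exact hafter a h1 h3 t h2.le
    have hx0 : x 0 = M.xstar := by
      have h1 : Tendsto x (𝓝[>] 0) (𝓝 (x 0)) :=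
        (h.adm.x_cont 0 self_mem_Ici).mono_left (nhdsWithin_mono _ Ioi_subset_Ici_self)
      refine tendsto_nhds_unique (h1.congr' ?_) tendsto_const_nhds
      filter_upwards [self_mem_nhdsWithin] with t ht using (hpos t ht).2
    refine ⟨h.adm.x_zero ▸ hx0, h.adm.le_K_zero.trans (h.K_le_Kstar hM le_rfl
      (fun t ht => (hpos t ht).1) fun t ht => ?_)⟩
    rcases ht.eq_or_lt with h1 | h1
    · rw [← h1, hx0]
    · exact (hpos t h1).2
  · right
    push Not at hc
    obtain ⟨ε, hε, hne⟩ := hc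
    have hlt : ∀ t ∈ Ioo 0 ε, lam t < M.r := fun t ht =>
      (h.adj.lam_le t ht.1.le).lt_of_ne (hne t ht.1 ht.2)
    obtain ⟨b, hb, hlb⟩ := hunb ε
    obtain ⟨τ, h1, h2, h3⟩ := exists_first_zero (f := fun t => M.r - lam t) (a := ε / 2) (t := b)
      (continuousOn_const.sub (h.adj.lam_cont.mono fun v hv => (half_pos hε).le.trans hv.1))
      (sub_pos.2 (hlt _ ⟨half_pos hε, half_lt_self hε⟩)) (by linarith) (by linarith)
    have hlτ : lam τ = M.r := (sub_eq_zero.1 h2).symm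
    have hτ : 0 < τ := (half_pos hε).trans h1.1
    have hlt' : ∀ t ∈ Ioo 0 τ, lam t < M.r := fun t ht => by
      rcases lt_or_ge t ε with h4 | h4
      · exact hlt t ⟨ht.1, h4⟩
      · linarith [h3 t ⟨by linarith, ht.2⟩]
    have haf := hafter τ hτ hlτ
    have hext := h.isExtremal_of_gap hM le_rfl hτ (h.measure_Ioo_eq_zero hlt') hlτ
      (haf τ le_rfl).1 (haf τ le_rfl).2.le
    rw [sub_zero] at hext
    have hcap : M.cap (K 0 * Real.exp (-(M.γ * τ))) τ = K 0 := by
      have := cap_eq (M := M) (K 0) 0 τ τ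
      simpa using this
    have hx0 : (fun s => x (τ - s)) 0 = M.xstar := by simpa using (haf τ le_rfl).2
    refine ⟨τ, hτ, hlt', (haf τ le_rfl).2, h.K_le_Kstar hM hτ.le (fun t ht => (haf t ht.le).1)
      fun t ht => (haf t ht).2, ?_⟩
    rw [sub_zero]
    refine ⟨hext, lt_Kstar_of_isExtremal hM hext hx0 fun t ht =>
      h.adj.lam_le _ (by linarith [ht.2]), hx0, ?_, ?_, ?_, fun hl => ?_⟩
    · exact h.adj.lam_le _ (by simp)
    · simpa using h.adm.x_zero
    · rw [hcap]; exact h.adm.le_K_zero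
    · rw [hcap, h.adm.K_zero]
      simp only [sub_self] at hl
      have : μ {0} = 0 := measure_mono_null (t := {t | ¬ lam t = M.r})
        (fun t ht => by rw [mem_singleton_iff.1 ht]; exact hl.ne) (ae_iff.1 h.adj.lam_eq_ae)
      simp [this]

end IsCandidate

end Fishery

/-! ### Splicing two functions at a time `T` -/

/-- The function which is `f` before the time `T`, and `f'` from then on. -/
def splice (T : ℝ) (f f' : ℝ → ℝ) (t : ℝ) : ℝ := if t < T then f t else f' t

section Splice

variable {T t : ℝ} {f f' : ℝ → ℝ}

theorem splice_of_lt (h : t < T) : splice T f f' t = f t := if_pos h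

theorem splice_of_le (h : T ≤ t) : splice T f f' t = f' t := if_neg (not_lt.2 h)

theorem splice_intervalIntegrable_left (h : IntervalIntegrable f volume 0 t) (ht : 0 ≤ t)
    (htT : t ≤ T) : IntervalIntegrable (splice T f f') volume 0 t := by
  rw [intervalIntegrable_iff_integrableOn_Ioo_of_le ht] at h ⊢
  exact h.congr_fun (fun s hs => (splice_of_lt (hs.2.trans_le htT)).symm) measurableSet_Ioo

theorem splice_integral_left (ht : 0 ≤ t) (htT : t ≤ T) :
    ∫ s in (0 : ℝ)..t, splice T f f' s = ∫ s in (0 : ℝ)..t, f s := by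
  rw [intervalIntegral.integral_of_le ht, intervalIntegral.integral_of_le ht,
    integral_Ioc_eq_integral_Ioo, integral_Ioc_eq_integral_Ioo]
  exact setIntegral_congr_fun measurableSet_Ioo fun s hs => splice_of_lt (hs.2.trans_le htT)

theorem splice_intervalIntegrable_right (h : IntervalIntegrable f' volume T t) (ht : T ≤ t) :
    IntervalIntegrable (splice T f f') volume T t := by
  rw [intervalIntegrable_iff_integrableOn_Ioc_of_le ht] at h ⊢
  exact h.congr_fun (fun s hs => (splice_of_le hs.1.le).symm) measurableSet_Ioc

theorem splice_integral_right (ht : T ≤ t) :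
    ∫ s in T..t, splice T f f' s = ∫ s in T..t, f' s := by
  refine intervalIntegral.integral_congr fun s hs => ?_
  rw [uIcc_of_le ht] at hs
  exact splice_of_le hs.1

theorem splice_intervalIntegrable (hT : 0 ≤ T) (h : ∀ t, 0 ≤ t → IntervalIntegrable f volume 0 t)
    (h' : ∀ t, T ≤ t → IntervalIntegrable f' volume T t) (ht : 0 ≤ t) :
    IntervalIntegrable (splice T f f') volume 0 t := by
  rcases le_total t T with h1 | h1
  · exact splice_intervalIntegrable_left (h t ht) ht h1
  · exact (splice_intervalIntegrable_left (h T hT) hT le_rfl).trans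
      (splice_intervalIntegrable_right (h' t h1) h1)

theorem splice_integral (hT : 0 ≤ T) (h : IntervalIntegrable f volume 0 T)
    (h' : IntervalIntegrable f' volume T t) (ht : T ≤ t) :
    ∫ s in (0 : ℝ)..t, splice T f f' s = (∫ s in (0 : ℝ)..T, f s) + ∫ s in T..t, f' s := by
  rw [← intervalIntegral.integral_add_adjacent_intervals
    (splice_intervalIntegrable_left h hT le_rfl) (splice_intervalIntegrable_right h' ht),
    splice_integral_left hT le_rfl, splice_integral_right ht]

theorem splice_aemeasurable {ν : Measure ℝ} (h : AEMeasurable f ν) (h' : AEMeasurable f' ν) :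
    AEMeasurable (splice T f f') ν := by
  refine ((h.indicator (measurableSet_Iio (a := T))).add
    (h'.indicator (measurableSet_Ici (a := T)))).congr (ae_of_all _ fun t => ?_)
  rcases lt_or_ge t T with h1 | h1
  · simp [splice_of_lt h1, h1]
  · simp [splice_of_le h1, h1]

end Splice

namespace Fishery
variable {M : Fishery}

/-- Full effort `u = 1` from the time `T` on, with capital `E` and rate of investment `q`,
along which the stock `y` stays above `x^*` and the capital is at least `m`. -/
structure IsContinuation (M : Fishery) (T m : ℝ) (y E q : ℝ → ℝ) : Prop where
  y_deriv : ∀ t, HasDerivAt y (M.F (y t) - E t * y t) t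
  E_deriv : ∀ t, HasDerivAt E (q t - M.γ * E t) t
  q_cont : Continuous q
  q_nonneg : ∀ t, T ≤ t → 0 ≤ q t
  y_mem : ∀ t, T ≤ t → y t ∈ Ioo M.xstar M.xbar
  le_E : ∀ t, T ≤ t → m ≤ E t
  E_bdd : ∃ C, ∀ t, T ≤ t → E t ≤ C

/-- The measure of investment: `μ` up to the time `T`, then a jump to `E` and the rate `q`. -/
def spliceMeasure (T : ℝ) (μ : Measure ℝ) (j : ℝ) (q : ℝ → ℝ) : Measure ℝ :=
  μ + ENNReal.ofReal j • Measure.dirac T +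
    (volume.restrict (Ioi T)).withDensity fun t => ENNReal.ofReal (q t)

theorem spliceMeasure_apply_of_disjoint {T j : ℝ} {μ : Measure ℝ} {q : ℝ → ℝ} {s : Set ℝ}
    (hs : MeasurableSet s) (h : s ⊆ Iio T) : spliceMeasure T μ j q s = μ s := by
  have h1 : s ∩ Ioi T = ∅ := by
    ext t
    simp only [mem_inter_iff, mem_Ioi, mem_empty_iff_false, iff_false, not_and, not_lt]
    exact fun ht => (h ht).le
  have h2 : T ∉ s := fun hT => lt_irrefl T (h hT)
  rw [spliceMeasure, Measure.add_apply, Measure.add_apply, withDensity_apply _ hs,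
    Measure.restrict_restrict hs, h1, Measure.smul_apply, Measure.dirac_apply' _ hs]
  simp [h2]

theorem spliceMeasure_Icc {T j t : ℝ} {μ : Measure ℝ} {q : ℝ → ℝ} (hT : 0 ≤ T) (ht : T ≤ t)
    (hμ : μ (Ioi T) = 0) (hq : Continuous q) (hq0 : ∀ t, T ≤ t → 0 ≤ q t) :
    spliceMeasure T μ j q (Icc 0 t) =
      μ (Icc 0 T) + ENNReal.ofReal j + ENNReal.ofReal (∫ s in T..t, q s) := by
  have h1 : Icc 0 t ∩ Ioi T = Ioc T t := by
    ext s
    simp only [mem_inter_iff, mem_Icc, mem_Ioi, mem_Ioc]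
    exact ⟨fun h => ⟨h.2, h.1.2⟩, fun h => ⟨⟨hT.trans h.1.le, h.2⟩, h.1⟩⟩
  have h2 : μ (Icc 0 t) = μ (Icc 0 T) := by
    refine le_antisymm ?_ (measure_mono (Icc_subset_Icc_right ht))
    calc μ (Icc 0 t) ≤ μ (Icc 0 T ∪ Ioi T) := measure_mono fun s hs => by
          rcases le_or_gt s T with h | h
          · exact .inl ⟨hs.1, h⟩
          · exact .inr h
      _ ≤ μ (Icc 0 T) + μ (Ioi T) := measure_union_le _ _
      _ = _ := by rw [hμ, add_zero]
  rw [spliceMeasure, Measure.add_apply, Measure.add_apply, withDensity_apply _ measurableSet_Icc,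
    Measure.restrict_restrict measurableSet_Icc, h1, h2, Measure.smul_apply,
    Measure.dirac_apply' _ measurableSet_Icc, indicator_of_mem (show T ∈ Icc 0 t from ⟨hT, ht⟩),
    intervalIntegral.integral_of_le ht,
    ofReal_integral_eq_lintegral_ofReal ((hq.integrableOn_Icc).mono_set Ioc_subset_Icc_self)]
  · simp
  · filter_upwards [ae_restrict_mem measurableSet_Ioc] with s hs using hq0 s hs.1.le

theorem IsAdmissible.continued (hM : M.Assumptions) {x₀ K₀ T m : ℝ} {x K u y E q : ℝ → ℝ}
    {μ : Measure ℝ} (h : M.IsAdmissible x₀ K₀ x K u μ) (hc : M.IsContinuation T m y E q)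
    (hT : 0 ≤ T) (hy : y T = x T) (hm : 0 ≤ m) (hE : K T ≤ E T) (hμ : μ (Ioi T) = 0) :
    M.IsAdmissible x₀ K₀ (splice T x y) (splice T K E) (splice T u fun _ => 1)
      (spliceMeasure T μ (E T - K T) q) := by
  have hEc : Continuous E := continuous_iff_continuousAt.2 fun t => (hc.E_deriv t).continuousAt
  have hyc : Continuous y := continuous_iff_continuousAt.2 fun t => (hc.y_deriv t).continuousAt
  have hyint : ∀ t, T ≤ t → IntervalIntegrable (fun s => M.F (y s) - E s * y s) volume T t :=
    fun t ht => by
      refine ContinuousOn.intervalIntegrable_of_Icc ht (ContinuousOn.sub ?_ (by fun_prop))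
      exact hM.continuousOn_F.comp hyc.continuousOn
        fun s hs => (hM.xstar_mem.1.trans (hc.y_mem s hs.1).1).le
  have hγK : ∀ t, 0 ≤ t → IntervalIntegrable (fun s => M.γ * K s) volume 0 t :=
    fun t ht => (h.K_int t ht).const_mul _
  have hγE : ∀ t, T ≤ t → IntervalIntegrable (fun s => M.γ * E s) volume T t :=
    fun t _ => (continuous_const.mul hEc).intervalIntegrable _ _
  have hrhs : (fun s => M.F (splice T x y s) -
      (splice T u fun _ => 1) s * splice T K E s * splice T x y s) =
      splice T (fun s => M.F (x s) - u s * K s * x s) (fun s => M.F (y s) - E s * y s) := by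
    funext s
    rcases lt_or_ge s T with h1 | h1
    · simp only [splice_of_lt h1]
    · simp only [splice_of_le h1, one_mul]
  have hγL : (fun s => M.γ * splice T K E s) =
      splice T (fun s => M.γ * K s) (fun s => M.γ * E s) := by
    funext s
    rcases lt_or_ge s T with h1 | h1
    · simp only [splice_of_lt h1]
    · simp only [splice_of_le h1]
  refine ⟨?_, ?_, ?_, fun t => ?_, fun t ht => ?_, fun t ht => ?_, fun t ht => ?_, fun t ht => ?_,
    ?_, fun t ht => ?_, fun t ht => ?_⟩
  · exact splice_aemeasurable h.u_meas aemeasurable_const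
  · filter_upwards [h.u_mem] with t ht
    rcases lt_or_ge t T with h1 | h1
    · rwa [splice_of_lt h1]
    · rw [splice_of_le h1]; exact ⟨zero_le_one, le_rfl⟩
  · rw [spliceMeasure_apply_of_disjoint measurableSet_Iio (Iio_subset_Iio hT), h.μ_neg]
  · refine (measure_mono (Icc_subset_Icc_right (le_max_left t T))).trans_lt ?_
    rw [spliceMeasure_Icc hT (le_max_right t T) hμ hc.q_cont hc.q_nonneg]
    exact ENNReal.add_lt_top.2 ⟨ENNReal.add_lt_top.2 ⟨h.μ_finite T, ENNReal.ofReal_lt_top⟩,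
      ENNReal.ofReal_lt_top⟩
  · rcases lt_or_ge t T with h1 | h1
    · rw [splice_of_lt h1]; exact h.K_nonneg t ht
    · rw [splice_of_le h1]; exact hm.trans (hc.le_E t h1)
  · exact splice_intervalIntegrable hT h.K_int (fun t _ => hEc.intervalIntegrable _ _) ht
  · rw [hγL]
    rcases lt_or_ge t T with h1 | h1
    · rw [splice_of_lt h1, splice_integral_left ht h1.le,
        spliceMeasure_apply_of_disjoint measurableSet_Icc fun s hs => hs.2.trans_lt h1]
      exact h.K_eq t ht
    · have h2 : ∫ s in T..t, (q s - M.γ * E s) = E t - E T :=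
        intervalIntegral.integral_eq_sub_of_hasDerivAt (fun s _ => hc.E_deriv s)
          ((hc.q_cont.sub (continuous_const.mul hEc)).intervalIntegrable _ _)
      rw [intervalIntegral.integral_sub (hc.q_cont.intervalIntegrable _ _) (hγE t h1)] at h2
      have h3 : 0 ≤ ∫ s in T..t, q s :=
        intervalIntegral.integral_nonneg h1 fun s hs => hc.q_nonneg s hs.1
      rw [splice_of_le h1, splice_integral hT (hγK T hT) (hγE t h1) h1,
        spliceMeasure_Icc hT h1 hμ hc.q_cont hc.q_nonneg,
        ENNReal.toReal_add (ENNReal.add_lt_top.2 ⟨h.μ_finite T, ENNReal.ofReal_lt_top⟩).ne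
          ENNReal.ofReal_ne_top, ENNReal.toReal_add (h.μ_finite T).ne ENNReal.ofReal_ne_top,
        ENNReal.toReal_ofReal h3, ENNReal.toReal_ofReal (sub_nonneg.2 hE)]
      linarith [h.K_eq T hT]
  · rcases lt_or_ge t T with h1 | h1
    · rw [splice_of_lt h1]; exact h.x_nonneg t ht
    · rw [splice_of_le h1]; exact (hM.xstar_mem.1.trans (hc.y_mem t h1).1).le
  · have h1 : ContinuousOn (fun t => x (min t T) + y (max t T) - x T) (Ici 0) :=
      ((h.x_cont.comp (by fun_prop) fun t ht => le_min ht hT).add (by fun_prop)).sub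
        continuousOn_const
    refine h1.congr fun t _ => ?_
    simp only
    rcases lt_or_ge t T with h2 | h2
    · rw [splice_of_lt h2, min_eq_left h2.le, max_eq_right h2.le, hy]; ring
    · rw [splice_of_le h2, min_eq_right h2, max_eq_left h2]; ring
  · rw [hrhs]
    exact splice_intervalIntegrable hT h.x_int hyint ht
  · rw [hrhs]
    rcases lt_or_ge t T with h1 | h1
    · rw [splice_of_lt h1, splice_integral_left ht h1.le]
      exact h.x_eq t ht
    · have h2 := intervalIntegral.integral_eq_sub_of_hasDerivAt (a := T) (b := t)
        (fun s _ => hc.y_deriv s) (hyint t h1)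
      rw [splice_of_le h1, splice_integral hT (h.x_int T hT) (hyint t h1) h1, h2, hy]
      linarith [h.x_eq T hT]

end Fishery

namespace Fishery
variable {M : Fishery}

/-! ### The cost of ceasing to invest -/

/-- The discounted running cost. -/
def running (M : Fishery) (x K u : ℝ → ℝ) (t : ℝ) : ℝ :=
  Real.exp (-M.δ * t) * ((M.c - M.p * x t) * u t * K t)

theorem cost_eq {x K u : ℝ → ℝ} {μ : Measure ℝ}
    (h : ∫⁻ t, ENNReal.ofReal (Real.exp (-M.δ * t) * M.r) ∂μ ≠ ⊤) :
    M.cost x K u μ = (((∫⁻ t, ENNReal.ofReal (Real.exp (-M.δ * t) * M.r) ∂μ).toReal +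
      ∫ t in Ici (0 : ℝ), M.running x K u t : ℝ) : EReal) := by
  rw [cost, ← EReal.coe_ennreal_toReal h, EReal.coe_add]
  rfl

theorem running_le {x u K : ℝ} {e : ℝ} (hM : M.Assumptions) (hx : x ∈ Icc 0 M.xbar)
    (hu : u ∈ Icc (0 : ℝ) 1) (hK : 0 ≤ K) (he : 0 ≤ e) :
    |e * ((M.c - M.p * x) * u * K)| ≤ e * ((M.c + M.p * M.xbar) * K) ∧
      -(e * (M.p * M.xbar * K)) ≤ e * ((M.c - M.p * x) * u * K) := by
  have hp := hM.p_pos.le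
  have hc := hM.c_pos.le
  have h1 : M.p * x ≤ M.p * M.xbar := mul_le_mul_of_nonneg_left hx.2 hp
  have h0 : 0 ≤ M.p * x := mul_nonneg hp hx.1
  have huK : 0 ≤ u * K := mul_nonneg hu.1 hK
  have huK' : u * K ≤ K := mul_le_of_le_one_left hK hu.2
  constructor
  · rw [abs_mul, abs_of_nonneg he, mul_assoc, abs_mul, abs_of_nonneg huK]
    gcongr
    · linarith
    rw [abs_le]
    exact ⟨by linarith, by linarith⟩
  · rw [← mul_neg]
    gcongr
    have h2 : M.p * x * (u * K) ≤ M.p * M.xbar * K :=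
      mul_le_mul h1 huK' huK (h0.trans h1)
    have h3 := mul_nonneg hc huK
    linarith

theorem integral_discount (hM : M.Assumptions) (T : ℝ) :
    ∫ t in Ioi T, Real.exp (-M.δ * t) = Real.exp (-M.δ * T) / M.δ := by
  rw [integral_exp_mul_Ioi (by linarith [hM.δ_pos])]
  exact neg_div_neg_eq _ _

theorem integrableOn_discount (hM : M.Assumptions) (T : ℝ) :
    IntegrableOn (fun t => Real.exp (-M.δ * t)) (Ioi T) := exp_neg_integrableOn_Ioi T hM.δ_pos

namespace IsAdmissible

variable {x₀ K₀ T : ℝ} {x K u : ℝ → ℝ} {μ : Measure ℝ}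

theorem running_aestronglyMeasurable (h : M.IsAdmissible x₀ K₀ x K u μ) {s : Set ℝ}
    (hs : MeasurableSet s) (hs0 : s ⊆ Ici 0) (hK : AEStronglyMeasurable K (volume.restrict s)) :
    AEStronglyMeasurable (M.running x K u) (volume.restrict s) := by
  have hx : AEStronglyMeasurable x (volume.restrict s) :=
    (h.x_cont.mono hs0).aestronglyMeasurable hs
  have hu : AEStronglyMeasurable u (volume.restrict s) :=
    (h.u_meas.mono_measure (Measure.restrict_mono hs0 le_rfl)).aestronglyMeasurable
  have he : Continuous fun t => Real.exp (-M.δ * t) := by fun_prop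
  exact he.aestronglyMeasurable.mul
    (((aestronglyMeasurable_const.sub (aestronglyMeasurable_const.mul hx)).mul hu).mul hK)

theorem running_integrableOn_left (hM : M.Assumptions) (h : M.IsAdmissible x₀ K₀ x K u μ)
    (hx : x₀ < M.xbar) (hT : 0 ≤ T) : IntegrableOn (M.running x K u) (Ico 0 T) := by
  have hK : IntegrableOn K (Ico 0 T) :=
    (intervalIntegrable_iff_integrableOn_Ico_of_le hT).1 (h.K_int T hT)
  refine Integrable.mono' (hK.const_mul (M.c + M.p * M.xbar))
    (h.running_aestronglyMeasurable measurableSet_Ico Ico_subset_Ici_self hK.1) ?_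
  filter_upwards [ae_mono (Measure.restrict_mono Ico_subset_Ici_self le_rfl) h.u_mem,
    ae_restrict_mem measurableSet_Ico] with t hu ht
  have hKt := h.K_nonneg t ht.1
  refine (running_le hM ⟨h.x_nonneg t ht.1, (h.x_lt hM hx ht.1).le⟩ hu hKt
    (Real.exp_pos _).le).1.trans ?_
  have h1 : 0 ≤ (M.c + M.p * M.xbar) * K t :=
    mul_nonneg (add_nonneg hM.c_pos.le (mul_pos hM.p_pos hM.xbar_pos).le) hKt
  refine mul_le_of_le_one_left h1 (Real.exp_le_one_iff.2 ?_)
  rw [neg_mul]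
  exact neg_nonpos.2 (mul_nonneg hM.δ_pos.le ht.1)

theorem K_eq_exp_of_le (h : M.IsAdmissible x₀ K₀ x K u μ) (hT : 0 ≤ T) (hμ : μ (Ioi T) = 0)
    {t : ℝ} (ht : T ≤ t) : K t = K T * Real.exp (-(M.γ * (t - T))) :=
  h.K_eq_exp hT ht (measure_mono_null Ioc_subset_Ioi_self hμ)

theorem K_le_of_le (hM : M.Assumptions) (h : M.IsAdmissible x₀ K₀ x K u μ) (hT : 0 ≤ T)
    (hμ : μ (Ioi T) = 0) {t : ℝ} (ht : T ≤ t) : K t ≤ K T := by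
  rw [h.K_eq_exp_of_le hT hμ ht]
  exact mul_le_of_le_one_right (h.K_nonneg T hT) (Real.exp_le_one_iff.2
    (neg_nonpos.2 (mul_nonneg hM.γ_pos.le (sub_nonneg.2 ht))))

/-- Without investment K stays at most K T, so the revenue rate never exceeds p xbar K T. -/
theorem running_right (hM : M.Assumptions) (h : M.IsAdmissible x₀ K₀ x K u μ)
    (hx : x₀ < M.xbar) (hT : 0 ≤ T) (hμ : μ (Ioi T) = 0) :
    IntegrableOn (M.running x K u) (Ioi T) ∧
      -(M.p * M.xbar * K T * (Real.exp (-M.δ * T) / M.δ)) ≤ ∫ t in Ioi T, M.running x K u t := by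
  have hsub : Ioi T ⊆ Ici 0 := fun t ht => hT.trans (le_of_lt ht)
  have hK : AEStronglyMeasurable K (volume.restrict (Ioi T)) := by
    have h1 : Continuous fun t => K T * Real.exp (-(M.γ * (t - T))) := by fun_prop
    refine h1.aestronglyMeasurable.congr ?_
    filter_upwards [ae_restrict_mem measurableSet_Ioi] with t ht
    exact (h.K_eq_exp_of_le hT hμ (le_of_lt ht)).symm
  have hb : ∀ᵐ t ∂volume.restrict (Ioi T),
      |M.running x K u t| ≤ (M.c + M.p * M.xbar) * K T * Real.exp (-M.δ * t) ∧
      -(M.p * M.xbar * K T) * Real.exp (-M.δ * t) ≤ M.running x K u t := by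
    filter_upwards [ae_mono (Measure.restrict_mono hsub le_rfl) h.u_mem,
      ae_restrict_mem measurableSet_Ioi] with t hu ht
    have ht0 := hsub ht
    have hKt := h.K_le_of_le hM hT hμ (le_of_lt ht)
    obtain ⟨h1, h2⟩ := running_le hM ⟨h.x_nonneg t ht0, (h.x_lt hM hx ht0).le⟩ hu
      (h.K_nonneg t ht0) (Real.exp_pos (-M.δ * t)).le
    have hpx := (mul_pos hM.p_pos hM.xbar_pos).le
    have hc := hM.c_pos.le
    have he := (Real.exp_pos (-M.δ * t)).le
    refine ⟨h1.trans ?_, le_trans ?_ h2⟩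
    · rw [mul_comm]; gcongr
    · rw [neg_mul, neg_le_neg_iff, mul_comm]; gcongr
  have hint : IntegrableOn (M.running x K u) (Ioi T) :=
    Integrable.mono' ((integrableOn_discount hM T).const_mul _)
      (h.running_aestronglyMeasurable measurableSet_Ioi hsub hK) (hb.mono fun t ht => ht.1)
  refine ⟨hint, ?_⟩
  rw [← integral_discount hM, ← neg_mul, ← integral_const_mul]
  exact integral_mono_ae ((integrableOn_discount hM T).const_mul _) hint (hb.mono fun t ht => ht.2)

theorem lintegral_ne_top (hM : M.Assumptions) (h : M.IsAdmissible x₀ K₀ x K u μ)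
    (hμ : μ (Ioi T) = 0) :
    ∫⁻ t, ENNReal.ofReal (Real.exp (-M.δ * t) * M.r) ∂μ ≠ ⊤ := by
  have hmem : ∀ᵐ t ∂μ, t ∈ Icc 0 T := by
    have h1 : ∀ᵐ t ∂μ, t ∉ Iio 0 := measure_eq_zero_iff_ae_notMem.1 h.μ_neg
    have h2 : ∀ᵐ t ∂μ, t ∉ Ioi T := measure_eq_zero_iff_ae_notMem.1 hμ
    filter_upwards [h1, h2] with t h3 h4 using ⟨not_lt.1 h3, not_lt.1 h4⟩
  rw [← Measure.restrict_eq_self_of_ae_mem hmem]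
  refine ((setLIntegral_mono_ae aemeasurable_const (g := fun _ => ENNReal.ofReal M.r)
    (ae_of_all _ fun t ht => ENNReal.ofReal_le_ofReal ?_)).trans_lt ?_).ne
  · refine mul_le_of_le_one_left hM.r_pos.le (Real.exp_le_one_iff.2 ?_)
    rw [neg_mul]
    exact neg_nonpos.2 (mul_nonneg hM.δ_pos.le ht.1)
  · rw [setLIntegral_const]
    exact ENNReal.mul_lt_top ENNReal.ofReal_lt_top (h.μ_finite T)

end IsAdmissible

namespace IsContinuation

variable {T m : ℝ} {y E q : ℝ → ℝ}

theorem continuous_E (h : M.IsContinuation T m y E q) : Continuous E :=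
  continuous_iff_continuousAt.2 fun t => (h.E_deriv t).continuousAt

theorem continuous_y (h : M.IsContinuation T m y E q) : Continuous y :=
  continuous_iff_continuousAt.2 fun t => (h.y_deriv t).continuousAt

theorem integrableOn_E (hM : M.Assumptions) (h : M.IsContinuation T m y E q) (hm : 0 ≤ m) :
    IntegrableOn (fun t => Real.exp (-M.δ * t) * E t) (Ioi T) := by
  obtain ⟨C, hC⟩ := h.E_bdd
  have hEc := h.continuous_E
  refine Integrable.mono' ((integrableOn_discount hM T).const_mul C)
    (by fun_prop : Continuous fun t => Real.exp (-M.δ * t) * E t).aestronglyMeasurable ?_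
  filter_upwards [ae_restrict_mem measurableSet_Ioi] with t ht
  rw [Real.norm_eq_abs, abs_of_nonneg (mul_nonneg (Real.exp_pos _).le
    (hm.trans (h.le_E t (le_of_lt ht)))), mul_comm]
  exact mul_le_mul_of_nonneg_right (hC t (le_of_lt ht)) (Real.exp_pos _).le

theorem le_integral_E (hM : M.Assumptions) (h : M.IsContinuation T m y E q) (hm : 0 ≤ m) :
    m * (Real.exp (-M.δ * T) / M.δ) ≤ ∫ t in Ioi T, Real.exp (-M.δ * t) * E t := by
  rw [← integral_discount hM, ← integral_const_mul]
  refine setIntegral_mono_on ((integrableOn_discount hM T).const_mul _) (h.integrableOn_E hM hm)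
    measurableSet_Ioi fun t ht => ?_
  rw [mul_comm]
  exact mul_le_mul_of_nonneg_left (h.le_E t (le_of_lt ht)) (Real.exp_pos _).le

/-- Integration by parts: (e^{−δt} E)' = e^{−δt}(q − κ E), and the boundary term at infinity
vanishes because E is bounded. -/
theorem integral_q (hM : M.Assumptions) (h : M.IsContinuation T m y E q) (hm : 0 ≤ m) :
    IntegrableOn (fun t => Real.exp (-M.δ * t) * q t) (Ioi T) ∧
      ∫ t in Ioi T, Real.exp (-M.δ * t) * q t =
        M.κ * (∫ t in Ioi T, Real.exp (-M.δ * t) * E t) - Real.exp (-M.δ * T) * E T := by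
  obtain ⟨C, hC⟩ := h.E_bdd
  have hEc := h.continuous_E
  have hc : Continuous fun t => Real.exp (-M.δ * t) * E t := by fun_prop
  have hd : ∀ t ∈ Ici T, HasDerivAt (fun t => Real.exp (-M.δ * t) * E t +
      M.κ * ∫ s in T..t, Real.exp (-M.δ * s) * E s) (Real.exp (-M.δ * t) * q t) t := fun t _ => by
    have h1 := ((((hasDerivAt_id t).const_mul (-M.δ)).exp).mul (h.E_deriv t)).add
      ((hc.integral_hasStrictDerivAt T t).hasDerivAt.const_mul M.κ)
    refine h1.congr_deriv ?_
    simp only [id, κ]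
    ring
  have h0 : Tendsto (fun t => Real.exp (-M.δ * t) * E t) atTop (𝓝 0) := by
    have h1 : Tendsto (fun t => C * Real.exp (-M.δ * t)) atTop (𝓝 (C * 0)) :=
      (Real.tendsto_exp_atBot.comp (tendsto_id.const_mul_atTop_of_neg
        (by linarith [hM.δ_pos]))).const_mul C
    rw [mul_zero] at h1
    refine squeeze_zero' ?_ ?_ h1
    · filter_upwards [eventually_ge_atTop T] with t ht
      exact mul_nonneg (Real.exp_pos _).le (hm.trans (h.le_E t ht))
    · filter_upwards [eventually_ge_atTop T] with t ht
      rw [mul_comm]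
      exact mul_le_mul_of_nonneg_right (hC t ht) (Real.exp_pos _).le
  have ht := h0.add ((intervalIntegral_tendsto_integral_Ioi T (h.integrableOn_E hM hm)
    tendsto_id).const_mul M.κ)
  rw [zero_add] at ht
  have hnn : ∀ t ∈ Ioi T, 0 ≤ Real.exp (-M.δ * t) * q t := fun t ht =>
    mul_nonneg (Real.exp_pos _).le (h.q_nonneg t (le_of_lt ht))
  refine ⟨integrableOn_Ioi_deriv_of_nonneg' hd hnn ht, ?_⟩
  rw [integral_Ioi_of_hasDerivAt_of_nonneg' hd hnn ht]
  simp

theorem running_le (hM : M.Assumptions) (h : M.IsContinuation T m y E q) (hm : 0 ≤ m) :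
    IntegrableOn (M.running y E fun _ => 1) (Ioi T) ∧
      ∫ t in Ioi T, M.running y E (fun _ => 1) t ≤
        (M.c - M.p * M.xstar) * ∫ t in Ioi T, Real.exp (-M.δ * t) * E t := by
  have hp := hM.p_pos.le
  have hEc := h.continuous_E
  have hyc := h.continuous_y
  have hint : IntegrableOn (M.running y E fun _ => 1) (Ioi T) := by
    have hc : Continuous (M.running y E fun _ => 1) := by unfold running; fun_prop
    refine Integrable.mono' ((h.integrableOn_E hM hm).const_mul (M.c + M.p * M.xbar))
      hc.aestronglyMeasurable ?_
    filter_upwards [ae_restrict_mem measurableSet_Ioi] with t ht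
    have hy := h.y_mem t (le_of_lt ht)
    refine (Fishery.running_le hM ⟨(hM.xstar_mem.1.trans hy.1).le, hy.2.le⟩
      ⟨zero_le_one, le_rfl⟩ (hm.trans (h.le_E t (le_of_lt ht))) (Real.exp_pos _).le).1.trans ?_
    exact le_of_eq (by ring)
  refine ⟨hint, ?_⟩
  rw [← integral_const_mul]
  refine setIntegral_mono_on hint ((h.integrableOn_E hM hm).const_mul _) measurableSet_Ioi
    fun t ht => ?_
  have hy := h.y_mem t (le_of_lt ht)
  have h1 : 0 ≤ Real.exp (-M.δ * t) * E t :=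
    mul_nonneg (Real.exp_pos _).le (hm.trans (h.le_E t (le_of_lt ht)))
  calc M.running y E (fun _ => 1) t = (M.c - M.p * y t) * (Real.exp (-M.δ * t) * E t) := by
        rw [running]; ring
    _ ≤ _ := mul_le_mul_of_nonneg_right
        (by linarith [mul_le_mul_of_nonneg_left hy.1.le hp]) h1

theorem lintegral_spliceMeasure (hM : M.Assumptions) (h : M.IsContinuation T m y E q)
    (hm : 0 ≤ m) {μ : Measure ℝ} {j : ℝ} (hj : 0 ≤ j)
    (hμ : ∫⁻ t, ENNReal.ofReal (Real.exp (-M.δ * t) * M.r) ∂μ ≠ ⊤) :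
    ∫⁻ t, ENNReal.ofReal (Real.exp (-M.δ * t) * M.r) ∂(spliceMeasure T μ j q) ≠ ⊤ ∧
    (∫⁻ t, ENNReal.ofReal (Real.exp (-M.δ * t) * M.r) ∂(spliceMeasure T μ j q)).toReal =
      (∫⁻ t, ENNReal.ofReal (Real.exp (-M.δ * t) * M.r) ∂μ).toReal +
        j * (Real.exp (-M.δ * T) * M.r) + M.r * (∫ t in Ioi T, Real.exp (-M.δ * t) * q t) := by
  have hw : Measurable fun t => ENNReal.ofReal (Real.exp (-M.δ * t) * M.r) := by fun_prop
  have hq : Measurable fun t => ENNReal.ofReal (q t) := h.q_cont.measurable.ennreal_ofReal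
  have hnn : ∀ t ∈ Ioi T, 0 ≤ Real.exp (-M.δ * t) * q t := fun t ht =>
    mul_nonneg (Real.exp_pos _).le (h.q_nonneg t (le_of_lt ht))
  have h0 : 0 ≤ ∫ t in Ioi T, Real.exp (-M.δ * t) * q t :=
    setIntegral_nonneg measurableSet_Ioi hnn
  have hd : ∫⁻ t, ENNReal.ofReal (Real.exp (-M.δ * t) * M.r)
      ∂((volume.restrict (Ioi T)).withDensity fun t => ENNReal.ofReal (q t)) =
      ENNReal.ofReal (M.r * ∫ t in Ioi T, Real.exp (-M.δ * t) * q t) := by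
    rw [lintegral_withDensity_eq_lintegral_mul _ hq hw, ← integral_const_mul,
      ofReal_integral_eq_lintegral_ofReal ((h.integral_q hM hm).1.const_mul M.r)]
    · refine setLIntegral_congr_fun measurableSet_Ioi fun t ht => ?_
      rw [Pi.mul_apply, ← ENNReal.ofReal_mul (h.q_nonneg t (le_of_lt ht))]
      congr 1
      ring
    · filter_upwards [ae_restrict_mem measurableSet_Ioi] with t ht
      exact mul_nonneg hM.r_pos.le (hnn t ht)
  have he : 0 ≤ Real.exp (-M.δ * T) * M.r := mul_nonneg (Real.exp_pos _).le hM.r_pos.le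
  have htot : ∫⁻ t, ENNReal.ofReal (Real.exp (-M.δ * t) * M.r) ∂(spliceMeasure T μ j q) =
      ∫⁻ t, ENNReal.ofReal (Real.exp (-M.δ * t) * M.r) ∂μ +
        ENNReal.ofReal (j * (Real.exp (-M.δ * T) * M.r)) +
        ENNReal.ofReal (M.r * ∫ t in Ioi T, Real.exp (-M.δ * t) * q t) := by
    rw [spliceMeasure, lintegral_add_measure, lintegral_add_measure, lintegral_smul_measure,
      lintegral_dirac' _ hw, hd, ENNReal.ofReal_mul hj, smul_eq_mul]
  rw [htot]
  have h1 := ENNReal.add_ne_top.2 ⟨hμ, ENNReal.ofReal_ne_top (r := j * (Real.exp (-M.δ * T) * M.r))⟩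
  refine ⟨ENNReal.add_ne_top.2 ⟨h1, ENNReal.ofReal_ne_top⟩, ?_⟩
  rw [ENNReal.toReal_add h1 ENNReal.ofReal_ne_top, ENNReal.toReal_add hμ ENNReal.ofReal_ne_top,
    ENNReal.toReal_ofReal (mul_nonneg hj he), ENNReal.toReal_ofReal (mul_nonneg hM.r_pos.le h0)]

/-- An optimal process cannot be improved by resuming the investment. -/
theorem le_of_isOptimal (hM : M.Assumptions) {x₀ K₀ : ℝ} {x K u : ℝ → ℝ} {μ : Measure ℝ}
    (h : M.IsContinuation T m y E q) (hm : 0 ≤ m) (hopt : M.IsOptimal x₀ K₀ x K u μ)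
    (hx : x₀ < M.xbar) (hT : 0 ≤ T) (hμ : μ (Ioi T) = 0) (hy : y T = x T) (hE : K T ≤ E T) :
    (M.p * M.xstar - M.cstar) * m ≤ M.p * M.xbar * K T := by
  obtain ⟨hadm, hopt⟩ := hopt
  have hle := hopt _ _ _ _ (hadm.continued hM h hT hy hm hE hμ)
  have hfin := hadm.lintegral_ne_top hM hμ
  obtain ⟨hfin', hB⟩ := h.lintegral_spliceMeasure hM hm (sub_nonneg.2 hE) hfin
  -- E T cancels: the jump costs r (E T − K T) e^{−δT}, and the boundary term of `integral_q`
  -- contributes −r E T e^{−δT}. What remains of the investment is r κ ∫ e^{−δt} E, which turns c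
  -- into c_*.
  rw [cost_eq hfin, cost_eq hfin', EReal.coe_le_coe_iff, hB, (h.integral_q hM hm).2] at hle
  obtain ⟨hR, hR'⟩ := hadm.running_right hM hx hT hμ
  obtain ⟨hS, hS'⟩ := h.running_le hM hm
  have hL := hadm.running_integrableOn_left hM hx hT
  have hdisj : Disjoint (Ico 0 T) (Ici T) := disjoint_left.2 fun t h1 h2 => not_lt.2 h2 h1.2
  have h1 : ∫ t in Ici (0 : ℝ), M.running x K u t =
      (∫ t in Ico 0 T, M.running x K u t) + ∫ t in Ioi T, M.running x K u t := by
    rw [← Ico_union_Ici_eq_Ici hT, setIntegral_union hdisj measurableSet_Ici hL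
      ((integrableOn_Ici_iff_integrableOn_Ioi (by simp)).2 hR), integral_Ici_eq_integral_Ioi]
  have hf1 : EqOn (M.running x K u)
      (M.running (splice T x y) (splice T K E) (splice T u fun _ => 1)) (Ico 0 T) := fun t ht => by
    simp only [running, splice_of_lt ht.2]
  have hf2 : EqOn (M.running y E fun _ => 1)
      (M.running (splice T x y) (splice T K E) (splice T u fun _ => 1)) (Ici T) := fun t ht => by
    simp only [running, splice_of_le (mem_Ici.1 ht)]
  have h2 : ∫ t in Ici (0 : ℝ),
      M.running (splice T x y) (splice T K E) (splice T u fun _ => 1) t =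
      (∫ t in Ico 0 T, M.running x K u t) + ∫ t in Ioi T, M.running y E (fun _ => 1) t := by
    rw [← Ico_union_Ici_eq_Ici hT, setIntegral_union hdisj measurableSet_Ici
      (hL.congr_fun hf1 measurableSet_Ico)
      (((integrableOn_Ici_iff_integrableOn_Ioi (by simp)).2 hS).congr_fun hf2 measurableSet_Ici),
      ← setIntegral_congr_fun measurableSet_Ico hf1, ← setIntegral_congr_fun measurableSet_Ici hf2,
      integral_Ici_eq_integral_Ioi]
  rw [h1, h2] at hle
  have hJ := h.le_integral_E hM hm
  set J := ∫ t in Ioi T, Real.exp (-M.δ * t) * E t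
  set D := Real.exp (-M.δ * T) / M.δ with hD
  have hD0 : 0 < D := div_pos (Real.exp_pos _) hM.δ_pos
  have h3 : 0 ≤ K T * (Real.exp (-M.δ * T) * M.r) :=
    mul_nonneg (hadm.K_nonneg T hT) (mul_nonneg (Real.exp_pos _).le hM.r_pos.le)
  have h4 : (M.p * M.xstar - M.cstar) * (m * D) ≤ (M.p * M.xstar - M.cstar) * J :=
    mul_le_mul_of_nonneg_left hJ (sub_nonneg.2 hM.cstar_lt.le)
  have h5 : (M.p * M.xstar - M.cstar) * J = (M.p * M.xstar - M.c) * J - M.r * (M.κ * J) := by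
    rw [cstar, r']; ring
  refine le_of_mul_le_mul_right (a := D) ?_ hD0
  linarith

end IsContinuation

end Fishery

/-! ### A profitable continuation; investment never ceases. -/

namespace Fishery
variable {M : Fishery}

/-- The stock relaxes to x^* at the rate γ; under full effort this prescribes E = φ(y) + γ h / y.
With exactly this rate the term −γ² h / y of E' cancels against γ E, and q = E' + γ E is a sum of
nonnegative terms. For a fixed w between x^* and xbar, E is at least φ(w) where y ≤ w, and at least
γ(1 − x^*/w) where y ≥ w, so m does not depend on ξ. -/
theorem exists_isContinuation (hM : M.Assumptions) :
    ∃ m > 0, ∀ T, ∀ ξ ∈ Ioo M.xstar M.xbar, ∃ y E q, M.IsContinuation T m y E q ∧ y T = ξ := by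
  have hxs := hM.xstar_mem.1
  have hγ := hM.γ_pos
  obtain ⟨w, hw1, hw2⟩ := exists_between hM.xstar_mem.2
  have hw0 := hxs.trans hw1
  refine ⟨min (M.phi w) (M.γ * (1 - M.xstar / w)), lt_min (hM.phi_pos ⟨hw0, hw2⟩)
    (mul_pos hγ (sub_pos.2 ((div_lt_one hw0).2 hw1))), fun T ξ hξ => ?_⟩
  have ha : 0 < ξ - M.xstar := sub_pos.2 hξ.1
  set h : ℝ → ℝ := fun t => (ξ - M.xstar) * Real.exp (-(M.γ * (t - T))) with hh
  set y : ℝ → ℝ := fun t => M.xstar + h t with hy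
  have hh0 : ∀ t, 0 < h t := fun t => mul_pos ha (Real.exp_pos _)
  have hy0 : ∀ t, 0 < y t := fun t => add_pos hxs (hh0 t)
  have hhd : ∀ t, HasDerivAt h (-(M.γ * h t)) t := fun t => by
    refine (((((hasDerivAt_id t).sub_const T).const_mul M.γ).neg.exp).const_mul
      (ξ - M.xstar)).congr_deriv ?_
    simp only [hh, Pi.neg_apply, id]
    ring
  have hyd : ∀ t, HasDerivAt y (-(M.γ * h t)) t := fun t => (hhd t).const_add _
  have hyc : Continuous y := continuous_iff_continuousAt.2 fun t => (hyd t).continuousAt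
  have hhc : Continuous h := continuous_iff_continuousAt.2 fun t => (hhd t).continuousAt
  have hym : ∀ t, T ≤ t → y t ∈ Ioo M.xstar M.xbar := fun t ht => by
    have h1 : h t ≤ ξ - M.xstar := mul_le_of_le_one_right ha.le (Real.exp_le_one_iff.2
      (neg_nonpos.2 (mul_nonneg hγ.le (sub_nonneg.2 ht))))
    simp only [hy]
    exact ⟨by linarith [hh0 t], by linarith [hξ.2]⟩
  have hle1 : ∀ t, h t / y t ≤ 1 := fun t => (div_le_one (hy0 t)).2 (by simp only [hy]; linarith)
  have hdiv : ∀ t, 0 < h t / y t := fun t => div_pos (hh0 t) (hy0 t)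
  refine ⟨y, fun t => M.phi (y t) + M.γ * (h t / y t),
    fun t => M.γ * (h t / y t) * (M.phi (y t) - deriv M.F (y t)) + M.γ * M.phi (y t) +
      M.γ ^ 2 * (h t / y t) ^ 2, ⟨fun t => ?_, fun t => ?_, ?_, fun t ht => ?_, hym, fun t ht => ?_,
      M.phi M.xstar + M.γ, fun t ht => ?_⟩, by simp [hy, hh]⟩
  · refine (hyd t).congr_deriv ?_
    have := (hy0 t).ne'
    rw [F_eq this]
    field_simp
    ring
  · have h1 := ((hM.hasDerivAt_phi (hy0 t)).comp t (hyd t)).add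
      (((hhd t).div (hyd t) (hy0 t).ne').const_mul M.γ)
    refine h1.congr_deriv ?_
    have := (hy0 t).ne'
    field_simp
    ring
  · have h1 : Continuous fun t => M.phi (y t) := hM.continuousOn_phi.comp_continuous hyc hy0
    have h2 : Continuous fun t => deriv M.F (y t) := hM.continuousOn_deriv.comp_continuous hyc hy0
    have h3 : Continuous fun t => h t / y t := hhc.div hyc fun t => (hy0 t).ne'
    fun_prop
  · have hyt : y t ∈ Ioc 0 M.xbar := ⟨hy0 t, (hym t ht).2.le⟩
    have h1 := sub_pos.2 (hM.deriv_lt_phi hyt)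
    have h2 := hM.phi_nonneg hyt
    have h3 := hdiv t
    positivity
  · have hyt : y t ∈ Ioc 0 M.xbar := ⟨hy0 t, (hym t ht).2.le⟩
    have h2 := hM.phi_nonneg hyt
    have h3 := mul_pos hγ (hdiv t)
    rcases le_total (y t) w with h4 | h4
    · exact (min_le_left _ _).trans (by linarith [hM.phi_le (hy0 t) h4 hw2.le])
    · refine (min_le_right _ _).trans ?_
      have h5 : 1 - M.xstar / w ≤ h t / y t := by
        have h6 : h t / y t = 1 - M.xstar / y t := by
          have := (hy0 t).ne'
          field_simp
          simp only [hy]; ring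
        rw [h6]
        gcongr
      linarith [mul_le_mul_of_nonneg_left h5 hγ.le]
  · have h1 := hM.phi_le hxs (hym t ht).1.le (hym t ht).2.le
    linarith [mul_le_mul_of_nonneg_left (hle1 t) hγ.le]

namespace IsCandidate

variable {x₀ K₀ : ℝ} {x K u z lam : ℝ → ℝ} {μ : Measure ℝ}

/-- Without investment, the capital tends to zero and the stock recovers. -/
theorem exists_late_time (hM : M.Assumptions) (h : M.IsCandidate x₀ K₀ x K u μ z lam) {T η : ℝ}
    (hT : 0 ≤ T) (hμ : μ (Ioi T) = 0) (hη : 0 < η) : ∃ t, T ≤ t ∧ K t < η ∧ M.xstar < x t := by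
  have hφ := hM.phi_pos hM.xstar_mem
  -- With K below φ(x^*)/2, harvesting cannot take more than half of the growth while x ≤ x^*, so
  -- the stock keeps rising.
  set η' := min η (M.phi M.xstar / 2) with hη'
  have hη0 : 0 < η' := lt_min hη (half_pos hφ)
  have hlim : Tendsto (fun t => K T * Real.exp (-(M.γ * (t - T)))) atTop (𝓝 (K T * 0)) := by
    refine (Real.tendsto_exp_atBot.comp ?_).const_mul _
    exact tendsto_neg_atTop_atBot.comp ((tendsto_atTop_add_const_right _ (-T)
      tendsto_id).const_mul_atTop hM.γ_pos)
  rw [mul_zero] at hlim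
  obtain ⟨S, hS⟩ := eventually_atTop.1 (hlim.eventually (gt_mem_nhds hη0))
  set S' := max S T with hS'
  have hST : T ≤ S' := le_max_right _ _
  have hS0 : 0 ≤ S' := hT.trans hST
  have hK : ∀ t, S' ≤ t → K t < η' := fun t ht => by
    rw [h.adm.K_eq_exp_of_le hT hμ (hST.trans ht)]
    exact hS t ((le_max_left _ _).trans ht)
  by_contra! hc
  have hx : ∀ t, S' ≤ t → x t ≤ M.xstar := fun t ht =>
    hc t (hST.trans ht) ((hK t ht).trans_le (min_le_left _ _))
  have hincr : ∀ s t, S' ≤ s → s ≤ t → ∀ b,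
      (∀ v ∈ Icc s t, b ≤ x v * (M.phi M.xstar / 2)) → x s + b * (t - s) ≤ x t := by
    intro s t hs hst b hb
    have h0s := hS0.trans hs
    have h1 := h.adm.x_sub h0s (h0s.trans hst)
    have h2 : ∫ v in s..t, b ≤ ∫ v in s..t, (M.F (x v) - u v * K v * x v) := by
      refine intervalIntegral.integral_mono_ae_restrict hst intervalIntegrable_const
        (h.adm.x_intervalIntegrable h0s (h0s.trans hst)) ?_
      filter_upwards [h.adm.u_mem_ae h0s, ae_restrict_mem measurableSet_Icc] with v hu hv
      have hv' := hs.trans hv.1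
      have hxv := h.x_mem hM (hS0.trans hv')
      have h3 : u v * K v ≤ M.phi M.xstar / 2 :=
        (mul_le_of_le_one_left (h.K_pos hM (hS0.trans hv')).le hu.2).trans
          ((hK v hv').le.trans (min_le_right _ _))
      have h4 := hM.phi_le hxv.1 (hx v hv') hM.xstar_mem.2.le
      rw [F_eq hxv.1.ne']
      refine (hb v hv).trans ?_
      rw [mul_comm (u v * K v), ← mul_sub]
      exact mul_le_mul_of_nonneg_left (by linarith) hxv.1.le
    rw [intervalIntegral.integral_const, smul_eq_mul] at h2
    linarith
  have hmono : ∀ t, S' ≤ t → x S' ≤ x t := fun t ht => by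
    have := hincr S' t le_rfl ht 0
      fun v hv => mul_nonneg (h.x_mem hM (hS0.trans hv.1)).1.le (half_pos hφ).le
    linarith
  have hxS := (h.x_mem hM hS0).1
  set b := x S' * (M.phi M.xstar / 2) with hb
  have hb0 : 0 < b := mul_pos hxS (half_pos hφ)
  -- Growth at a rate of at least b during the time xbar / b would carry the stock beyond xbar.
  have hlong : S' ≤ S' + M.xbar / b := by linarith [div_pos hM.xbar_pos hb0]
  have := hincr S' (S' + M.xbar / b) le_rfl hlong b
    fun v hv => mul_le_mul_of_nonneg_right (hmono v hv.1) (half_pos hφ).le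
  rw [add_sub_cancel_left, mul_div_cancel₀ _ hb0.ne'] at this
  linarith [(h.x_mem hM (hS0.trans hlong)).2]

/-- The investment of an optimal process never ceases. -/
theorem exists_lam_eq_gt (hM : M.Assumptions) (h : M.IsCandidate x₀ K₀ x K u μ z lam)
    (hopt : M.IsOptimal x₀ K₀ x K u μ) (T : ℝ) : ∃ t > T, lam t = M.r := by
  by_contra! hc
  have hT0 : 0 ≤ max T 0 := le_max_right _ _
  have hμ : μ (Ioi (max T 0)) = 0 := measure_mono_null
    (fun t ht => hc t ((le_max_left _ _).trans_lt ht)) (ae_iff.1 h.adj.lam_eq_ae)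
  obtain ⟨m, hm, hcont⟩ := exists_isContinuation hM
  have hpx := mul_pos hM.p_pos hM.xbar_pos
  have hgain := mul_pos (sub_pos.2 hM.cstar_lt) hm
  -- K < m permits the upward jump to the continuation; K < (p x^* − c_*) m / (p xbar) contradicts
  -- `le_of_isOptimal`.
  obtain ⟨t, htT, hKt, hxt⟩ := h.exists_late_time hM hT0 hμ
    (lt_min hm (div_pos hgain hpx))
  have ht0 := hT0.trans htT
  obtain ⟨y, E, q, hC, hy⟩ := hcont t (x t) ⟨hxt, (h.x_mem hM ht0).2⟩
  have h1 := hC.le_of_isOptimal hM hm.le hopt h.x₀_mem.2 ht0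
    (measure_mono_null (Ioi_subset_Ioi htT) hμ) hy
    ((hKt.le.trans (min_le_left _ _)).trans (hC.le_E t le_rfl))
  have h2 := (lt_div_iff₀ hpx).1 (hKt.trans_le (min_le_right _ _))
  linarith

end IsCandidate

end Fishery

namespace Fishery
variable {M : Fishery}

/-! ### The regions -/

theorem Kstar_le_of_mem_SigmaS (hM : M.Assumptions) {k : ℝ} (h : (M.xstar, k) ∈ M.SigmaS) :
    M.Kstar ≤ k := by
  rcases h with h | ⟨Kt, Kc, K₁, τ, x, z, l, hth, hK, hτ, hb, -, -, hP⟩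
  · exact (congrArg Prod.snd h).ge
  · have h1 : M.xstar = x τ := congrArg Prod.fst hP
    have h2 : k = M.cap K₁ τ := congrArg Prod.snd hP
    have := hb.phi_le_cap hM (hth.1.1.trans_le hK.1) ⟨hτ, le_rfl⟩ h1.le
    rwa [← h1, ← h2] at this

theorem Kstar_lt_of_mem_Gamma3 (hM : M.Assumptions) {P : ℝ × ℝ} (h : P ∈ M.Gamma3) :
    M.Kstar < P.2 := by
  obtain ⟨Kt, Kc, T, y, hth, hT, -, -, hP⟩ := exists_of_mem_Gamma3 hM h
  obtain ⟨σ, x, z, l, ht⟩ := hth.exists_path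
  rw [hP]
  have := hM.cap_le (ht.Kc_pos hM) hT
  rw [cap_zero] at this
  exact (ht.Kstar_lt hM).trans_le this

theorem pos_of_mem_Gamma4 (hM : M.Assumptions) {P : ℝ × ℝ} (h : P ∈ M.Gamma4) : 0 < P.2 := by
  obtain ⟨Kt, Kc, T, y, hth, -, -, -, -, hP⟩ := h
  obtain ⟨σ, x, z, l, ht⟩ := hth.exists_path
  rw [hP]
  exact cap_pos (ht.Kc_pos hM) T

theorem pos_of_mem_Sigma0 {P : ℝ × ℝ} (h : P ∈ M.Sigma0) : 0 < P.1 := by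
  obtain ⟨K₁, -, σ, x, z, l, hσ, hb, -, -, -, hP⟩ := h
  rw [hP]
  exact (hb.x_mem σ ⟨hσ.le, le_rfl⟩).1

/-- The union of the five regions. -/
def regions (M : Fishery) : Set (ℝ × ℝ) := M.R1 ∪ M.R2 ∪ M.R3 ∪ M.R4 ∪ M.R5

theorem mem_interior_of_mem_regions (hM : M.Assumptions) {x₀ K₀ : ℝ} (h : (x₀, K₀) ∈ M.regions) :
    x₀ ∈ Ioo 0 M.xbar ∧ 0 < K₀ := by
  have hs := hM.xstar_mem
  have ht := hM.xtil_mem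
  rcases h with (((⟨h1, h2, h3, -⟩ | ⟨h1, ⟨h2, s, h3, h4⟩ | ⟨h2, h3, -⟩⟩) | ⟨h1, h2, h3, -⟩) |
    ⟨h1, h2, k, h3, h4⟩) | ⟨h1, h2, k, h3, h4⟩
  · exact ⟨⟨hs.1.trans h1, h2⟩, h3⟩
  · exact ⟨⟨(pos_of_mem_Sigma0 h3).trans h4, h2.trans ht.2⟩, h1⟩
  · exact ⟨⟨ht.1.trans_le h2, h3⟩, h1⟩
  · exact ⟨⟨h1, h2.trans ht.2⟩, h3⟩
  · exact ⟨⟨h1, h2.trans ht.2⟩, (pos_of_mem_Gamma4 hM h3).trans h4⟩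
  · exact ⟨⟨ht.1.trans h1, h2⟩, (hM.Kstar_pos.trans (Kstar_lt_of_mem_Gamma3 hM h3)).trans h4⟩

/-- This excludes a start on `Σ^*`, the only alternative to an initial period without investment. -/
theorem Kstar_lt_of_mem_regions (hM : M.Assumptions) {K₀ : ℝ} (h : (M.xstar, K₀) ∈ M.regions) :
    M.Kstar < K₀ := by
  have hts := hM.xtil_lt_xstar
  rcases h with (((⟨h1, -⟩ | ⟨-, ⟨h2, -⟩ | ⟨-, -, -, h2⟩⟩) | ⟨-, h2, -⟩) |
    ⟨-, h2, -⟩) | ⟨-, -, k, h3, h4⟩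
  · exact absurd h1 (lt_irrefl _)
  · exact absurd h2 (not_lt.2 hts.le)
  · obtain ⟨k, h3, h4⟩ := h2 le_rfl
    exact (Kstar_le_of_mem_SigmaS hM h3).trans_lt h4
  · exact absurd h2 (not_lt.2 hts.le)
  · exact absurd h2 (not_lt.2 hts.le)
  · exact (Kstar_lt_of_mem_Gamma3 hM h3).trans h4

/-- An optimal process starting in one of the regions has an initial period without investment,
on `(0, τ)`, which brings it to `Σ^*`. -/
structure Arrives (M : Fishery) (x₀ K₀ : ℝ) (x K u : ℝ → ℝ) (μ : Measure ℝ) (z lam : ℝ → ℝ)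
    (τ : ℝ) : Prop where
  cand : M.IsCandidate x₀ K₀ x K u μ z lam
  τ_pos : 0 < τ
  lam_lt : ∀ t ∈ Ioo 0 τ, lam t < M.r
  mem : (x τ, K τ) ∈ M.SigmaStar
  approach : M.IsApproach x₀ K₀ (K 0 * Real.exp (-(M.γ * (τ - 0)))) τ
    (fun s => x (τ - s)) (fun s => z (τ - s)) (fun s => lam (τ - s))

theorem exists_arrives (hM : M.Assumptions) {x₀ K₀ : ℝ} {x K u z lam : ℝ → ℝ} {μ : Measure ℝ}
    (hopt : M.IsOptimal x₀ K₀ x K u μ) (hadj : M.IsAdjoint x K u μ z lam)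
    (hR : (x₀, K₀) ∈ M.regions) : ∃ τ, M.Arrives x₀ K₀ x K u μ z lam τ := by
  obtain ⟨h1, h2⟩ := mem_interior_of_mem_regions hM hR
  have hc : M.IsCandidate x₀ K₀ x K u μ z lam := ⟨hopt.1, hadj, h1, h2⟩
  rcases hc.isApproach_or hM (hc.exists_lam_eq_gt hM hopt) with ⟨h3, h4⟩ | ⟨τ, h3, h4, h5, h6, h7⟩
  · rw [h3] at hR
    exact absurd (Kstar_lt_of_mem_regions hM hR) (not_lt.2 h4)
  · exact ⟨τ, hc, h3, h4, ⟨h5, hopt.1.K_nonneg τ h3.le, h6⟩, h7⟩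

namespace Arrives

variable {x₀ K₀ τ : ℝ} {x K u z lam : ℝ → ℝ} {μ : Measure ℝ}

theorem measure_eq_zero (h : M.Arrives x₀ K₀ x K u μ z lam τ) {t : ℝ} (ht : t ≤ τ) :
    μ (Ioo 0 t) = 0 :=
  h.cand.measure_Ioo_eq_zero fun s hs => h.lam_lt s ⟨hs.1, hs.2.trans_le ht⟩

theorem K_eq (h : M.Arrives x₀ K₀ x K u μ z lam τ) {s : ℝ} (hs : s ∈ Ioc 0 τ) :
    K (τ - s) = M.cap (K 0 * Real.exp (-(M.γ * (τ - 0)))) s := by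
  rw [IsCandidate.cap_eq]
  exact h.cand.K_eq_of_gap le_rfl (h.measure_eq_zero le_rfl)
    ⟨by linarith [hs.2], by linarith [hs.1]⟩

theorem tendsto_K (h : M.Arrives x₀ K₀ x K u μ z lam τ) : Tendsto K (𝓝[>] 0) (𝓝 (K 0)) := by
  have h1 : Continuous fun t => K 0 * Real.exp (-(M.γ * (t - 0))) := by fun_prop
  have h2 : Tendsto (fun t => K 0 * Real.exp (-(M.γ * (t - 0)))) (𝓝[>] 0) (𝓝 (K 0)) := by
    have := (h1.tendsto 0).mono_left (nhdsWithin_le_nhds (s := Ioi 0))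
    simpa using this
  refine h2.congr' ?_
  filter_upwards [Ioo_mem_nhdsGT h.τ_pos] with t ht
  exact (h.cand.K_eq_of_gap le_rfl (h.measure_eq_zero le_rfl) ⟨ht.1.le, ht.2⟩).symm

theorem reaches_SigmaStar (hM : M.Assumptions) (h : M.Arrives x₀ K₀ x K u μ z lam τ)
    (hz : ∀ s ∈ Icc 0 τ, 0 < z (τ - s)) : ReachesWith x K u μ 1 M.SigmaStar := by
  refine ⟨τ, h.τ_pos, h.mem, h.cand.u_eq_one hM le_rfl fun t ht => ?_, h.measure_eq_zero le_rfl⟩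
  have := hz (τ - t) ⟨by linarith [ht.2], by linarith [ht.1]⟩
  rwa [sub_sub_cancel] at this

theorem reaches_one (hM : M.Assumptions) (h : M.Arrives x₀ K₀ x K u μ z lam τ) {σ : ℝ}
    (hσ : σ ∈ Ioo 0 τ) {S : Set (ℝ × ℝ)}
    (hS : (x (τ - σ), M.cap (K 0 * Real.exp (-(M.γ * (τ - 0)))) σ) ∈ S)
    (hz : ∀ s ∈ Ioc σ τ, 0 < z (τ - s)) : ReachesWith x K u μ 1 S := by
  refine ⟨τ - σ, sub_pos.2 hσ.2, ?_, h.cand.u_eq_one hM le_rfl fun t ht => ?_,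
    h.measure_eq_zero (by linarith [hσ.1])⟩
  · rwa [h.K_eq ⟨hσ.1, hσ.2.le⟩]
  · have := hz (τ - t) ⟨by linarith [ht.2], by linarith [ht.1]⟩
    rwa [sub_sub_cancel] at this

theorem reaches_zero (hM : M.Assumptions) (h : M.Arrives x₀ K₀ x K u μ z lam τ) {σ : ℝ}
    (hσ : σ ∈ Ioo 0 τ) {S : Set (ℝ × ℝ)}
    (hS : (x (τ - σ), M.cap (K 0 * Real.exp (-(M.γ * (τ - 0)))) σ) ∈ S)
    (hz : ∀ s ∈ Ioc σ τ, z (τ - s) < 0) : ReachesWith x K u μ 0 S := by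
  refine ⟨τ - σ, sub_pos.2 hσ.2, ?_, h.cand.u_eq_zero hM le_rfl fun t ht => ?_,
    h.measure_eq_zero (by linarith [hσ.1])⟩
  · rwa [h.K_eq ⟨hσ.1, hσ.2.le⟩]
  · have := hz (τ - t) ⟨by linarith [ht.2], by linarith [ht.1]⟩
    rwa [sub_sub_cancel] at this

theorem mem_SigmaTil (hM : M.Assumptions) (h : M.Arrives x₀ K₀ x K u μ z lam τ) {σ : ℝ}
    (hx : x (τ - σ) = M.xtil) :
    (x (τ - σ), M.cap (K 0 * Real.exp (-(M.γ * (τ - 0)))) σ) ∈ M.SigmaTil :=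
  ⟨hx, (cap_pos (mul_pos (h.cand.K_pos hM le_rfl) (Real.exp_pos _)) σ).le⟩

end Arrives

end Fishery

end

/-! ### The five cases. -/

theorem mainTheorem1 (M : Fishery) (hM : M.Assumptions)
    (hreach : M.JumpCurveReaches) (hno : M.NoIntersection)
    (x₀ K₀ : ℝ) (x K u : ℝ → ℝ) (μ : MeasureTheory.Measure ℝ) (z lam : ℝ → ℝ)
    (hopt : M.IsOptimal x₀ K₀ x K u μ) (hadj : M.IsAdjoint x K u μ z lam) :
    ((x₀, K₀) ∈ M.R1 →
      M.r' < z 0 ∧ lam 0 = M.r ∧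
      (∃ Kplus : ℝ, Filter.Tendsto K (nhdsWithin 0 (Set.Ioi 0)) (nhds Kplus) ∧
        (x₀, Kplus) ∈ M.SigmaS) ∧
      ReachesWith x K u μ 1 M.SigmaStar) ∧
    ((x₀, K₀) ∈ M.R2 → 0 < z 0 ∧ lam 0 < M.r ∧ ReachesWith x K u μ 1 M.SigmaStar) ∧
    ((x₀, K₀) ∈ M.R3 → z 0 < 0 ∧ lam 0 < M.r ∧ ReachesWith x K u μ 0 M.Sigma0) ∧
    ((x₀, K₀) ∈ M.R4 → z 0 < 0 ∧ lam 0 < M.r ∧ ReachesWith x K u μ 0 M.SigmaTil) ∧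
    ((x₀, K₀) ∈ M.R5 → 0 < z 0 ∧ lam 0 < M.r ∧ ReachesWith x K u μ 1 M.SigmaTil) := by
  have arrives : (x₀, K₀) ∈ M.regions → ∃ τ, M.Arrives x₀ K₀ x K u μ z lam τ :=
    Fishery.exists_arrives hM hopt hadj
  refine ⟨fun hR => ?_, fun hR => ?_, fun hR => ?_, fun hR => ?_, fun hR => ?_⟩
  · obtain ⟨τ, h⟩ := arrives (.inl (.inl (.inl (.inl hR))))
    obtain ⟨hz, hl, hS, hpos⟩ := h.approach.of_mem_R1 hM hno hreach
      (fun t ht => h.lam_lt _ ⟨by linarith [ht.2], by linarith [ht.1]⟩) hR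
    -- Backward time τ is time 0, and the capital there is K 0, the value after the initial jump and
    -- thus the right limit of K.
    rw [← h.K_eq ⟨h.τ_pos, le_rfl⟩] at hS
    rw [sub_self] at hz hl hS
    exact ⟨hz, hl, ⟨K 0, h.tendsto_K, hS⟩, h.reaches_SigmaStar hM hpos⟩
  · obtain ⟨τ, h⟩ := arrives (.inl (.inl (.inl (.inr hR))))
    obtain ⟨hl, hpos⟩ := h.approach.of_mem_R2 hM hno hreach hR
    have hz := hpos τ ⟨h.τ_pos.le, le_rfl⟩
    rw [sub_self] at hz hl
    exact ⟨hz, hl, h.reaches_SigmaStar hM hpos⟩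
  · obtain ⟨τ, h⟩ := arrives (.inl (.inl (.inr hR)))
    obtain ⟨hl, σ, hσ, hS, hneg⟩ := h.approach.of_mem_R3 hM hR
    have hz := hneg τ ⟨hσ.2, le_rfl⟩
    rw [sub_self] at hz hl
    exact ⟨hz, hl, h.reaches_zero hM hσ hS hneg⟩
  · obtain ⟨τ, h⟩ := arrives (.inl (.inr hR))
    obtain ⟨hl, σ, hσ, hS, hneg⟩ := h.approach.of_mem_R4 hM hR
    have hz := hneg τ ⟨hσ.2, le_rfl⟩
    rw [sub_self] at hz hl
    exact ⟨hz, hl, h.reaches_zero hM hσ (h.mem_SigmaTil hM hS) hneg⟩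
  · obtain ⟨τ, h⟩ := arrives (.inr hR)
    obtain ⟨hl, σ, hσ, hS, hpos⟩ := h.approach.of_mem_R5 hM hno hreach hR
    have hz := hpos τ ⟨hσ.2, le_rfl⟩
    rw [sub_self] at hz hl
    exact ⟨hz, hl, h.reaches_one hM hσ (h.mem_SigmaTil hM hS) hpos⟩
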